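/- Let $\tau$ be a point of the upper half-plane and put $\theta_\tau(z)=\sum_{n\in\mathbb Z}(-1)^n q^{\frac12(n+\frac12)^2}w^{n+\frac12}$ with $q=e^{2\pi i\tau}$, $w=e^{2\pi i z}$, and $$F_\tau(\alpha;z)=\frac{\theta_\tau(z+\alpha)\,\theta_\tau'(0)}{\theta_\tau(z)\,\theta_\tau(\alpha)}=\sum_{n\ge 0}f_\tau^{(n)}(z)\,\alpha^{n-1}$$ (Laurent expansion at $\alpha=0$). If a function $f(\epsilon)$ satisfies, for small $\epsilon>0$, $f(\epsilon)=\sum_{n=0}^N c_n(\log(-2\pi i\epsilon))^n+O(\epsilon^\delta)$ with $N\in\mathbb{Z}_{\ge 0}$, constants $c_n\in\mathbb C$ and some $\delta>0$ (branch of the logarithm with $\log(-i)=-\pi i/2$), write $\mathrm{Reg}_{\epsilon\to0}f(\epsilon):=c_0$. For $0<z<1$, $k_1,\dots,k_m\ge0$ and $a_1,\dots,a_m\in\{0,z\}$ let $$\Gamma_\tau\!\left({k_1,\dots,k_m\atop a_1,\dots,a_m};z\right)=\mathrm{Reg}_{\epsilon\to0}\int_{\epsilon<z_1<\cdots<z_m<z-\epsilon}f_\tau^{(k_1)}(z_1-a_1)\,dz_1\cdots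 f_\tau^{(k_m)}(z_m-a_m)\,dz_m,$$ the integral being $1$ for $m=0$, and let $$A_\tau\!\left({v_1,\dots,v_m\atop a_1,\dots,a_m};z\right)=\sum_{k_1,\dots,k_m\ge0}\Gamma_\tau\!\left({k_1,\dots,k_m\atop a_1,\dots,a_m};z\right)v_1^{k_1-1}\cdots v_m^{k_m-1},$$ where the $v_i$ are nonzero linear forms in formal variables $u_1,\dots,u_r$, regarded as an element of the fraction field of $\mathbb C[[u_1,\dots,u_r]]$. Then for every $\tau$, every $0<z<1$ and every integer $r\ge1$, all the regularized values occurring below exist, and in the fraction field of $\mathbb C[[u_1,\dots,u_r]]$ $$A_\tau\!\left({u_1,\dots,u_{r-1},u_r\atop 0,\dots,0,z};z\right)=\sum_{i=2}^r(-1)^i\zeta(i)\,A_\tau\!\left({u_i,\dots,u_{r-1}\atop 0,\dots,0};z\right)-\sum_{i=0}^{r-1}A_\tau\!\left({u_1,\dots,u_{i-1},\;u_i+\cdots+u_r,\;-u_{i+1}-\cdots-u_r,\;u_{i+1},\dots,u_{r-1}\atop 0,\dots,0};z\right).$$ Here the term $i=r$ of the first sum is $(-1)^r\zeta(r)$ (empty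 argument list), and the upper arguments of the term $i=0$ of the second sum are $(-u_1-\cdots-u_r,\,u_1,\dots,u_{r-1})$. -/

import Mathlib

noncomputable section

namespace EllipticPolylog

/-- The odd Jacobi theta function `θ_τ(z) = ∑_{n ∈ ℤ} (-1)^n q^{(n+1/2)^2/2} w^{n+1/2}`
with `q = e^{2πiτ}` and `w = e^{2πiz}`. -/
def theta (τ : UpperHalfPlane) (z : ℂ) : ℂ :=
  ∑' n : ℤ, (-1 : ℂ) ^ n
    * Complex.exp (2 * Real.pi * Complex.I * (τ : ℂ) * (((n : ℂ) + 1 / 2) ^ 2 / 2))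
    * Complex.exp (2 * Real.pi * Complex.I * z * ((n : ℂ) + 1 / 2))

/-- The Eisenstein-Kronecker series `F_τ(α; z) = θ_τ(z+α) θ_τ'(0) / (θ_τ(z) θ_τ(α))`. -/
def eisensteinKronecker (τ : UpperHalfPlane) (α z : ℂ) : ℂ :=
  theta τ (z + α) * deriv (theta τ) 0 / (theta τ z * theta τ α)

/-- The function `α ↦ α F_τ(α; z)`, with its removable singularity at `α = 0` removed. -/
def eisensteinKroneckerReg (τ : UpperHalfPlane) (z : ℂ) : ℂ → ℂ :=
  Function.update (fun α => α * eisensteinKronecker τ α z) 0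
    (Filter.limUnder (nhdsWithin 0 {0}ᶜ) fun α => α * eisensteinKronecker τ α z)

/-- The coefficients of the Laurent expansion `F_τ(α; z) = ∑_{n ≥ 0} f_τ^{(n)}(z) α^{n-1}`
at `α = 0`, that is, the Taylor coefficients of `α F_τ(α; z)`. -/
def kernelCoeff (τ : UpperHalfPlane) (n : ℕ) (z : ℂ) : ℂ :=
  iteratedDeriv n (eisensteinKroneckerReg τ z) 0 / (n.factorial : ℂ)

/-- The iterated integral `∫_{a < t_1 < ⋯ < t_r < b} g_1(t_1) dt_1 ⋯ g_r(t_r) dt_r`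
(equal to `1` for `r = 0`), the outermost integration being over `t_r`. -/
def iteratedIntegral : (r : ℕ) → (Fin r → ℝ → ℂ) → ℝ → ℝ → ℂ
  | 0, _, _, _ => 1
  | r + 1, g, a, b =>
      ∫ t in a..b, iteratedIntegral r (fun i => g i.castSucc) a t * g (Fin.last r) t

/-- `c` is a regularized value of `f` as `ε → 0⁺`: for small `ε > 0`,
`f(ε) = ∑_{n ≤ N} c_n (log(-2πiε))^n + O(ε^δ)` for some `N`, some `δ > 0` and some constants
`c_n` with `c_0 = c`. The logarithm is the principal branch, so `log(-i) = -πi/2`. -/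
def HasRegValue (f : ℝ → ℂ) (c : ℂ) : Prop :=
  ∃ (N : ℕ) (coeff : ℕ → ℂ) (δ : ℝ), 0 < δ ∧ coeff 0 = c ∧
    Asymptotics.IsBigO (nhdsWithin (0 : ℝ) (Set.Ioi 0))
      (fun ε : ℝ => f ε - ∑ n ∈ Finset.range (N + 1),
        coeff n * Complex.log (-2 * Real.pi * Complex.I * (ε : ℂ)) ^ n)
      (fun ε : ℝ => ε ^ δ)

open Classical in
/-- The regularized value of `f` as `ε → 0⁺` (with junk value `0` if there is none). -/
def regValue (f : ℝ → ℂ) : ℂ :=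
  if h : ∃ c, HasRegValue f c then h.choose else 0

/-- The integral
`∫_{ε < z_1 < ⋯ < z_r < z-ε} f_τ^{(k_1)}(z_1-a_1) dz_1 ⋯ f_τ^{(k_r)}(z_r-a_r) dz_r`
as a function of `ε`. -/
def truncatedIntegral (τ : UpperHalfPlane) {r : ℕ} (k : Fin r → ℕ) (a : Fin r → ℝ) (z : ℝ)
    (ε : ℝ) : ℂ :=
  iteratedIntegral r (fun i t => kernelCoeff τ (k i) ((t : ℂ) - (a i : ℂ))) ε (z - ε)

/-- The elliptic multiple polylogarithm `Γ_τ(k_1,…,k_r; a_1,…,a_r; z)`. -/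
def Gam (τ : UpperHalfPlane) {r : ℕ} (k : Fin r → ℕ) (a : Fin r → ℝ) (z : ℝ) : ℂ :=
  regValue (truncatedIntegral τ k a z)

/-- The power series `∑_k Γ_τ(k; a; z) X_1^{k_1} ⋯ X_r^{k_r}`. -/
def gammaSeries (τ : UpperHalfPlane) {r : ℕ} (a : Fin r → ℝ) (z : ℝ) :
    MvPowerSeries (Fin r) ℂ :=
  fun k => Gam τ k a z

/-- The generating series
`A_τ(v_1,…,v_m; a_1,…,a_m; z) = ∑_k Γ_τ(k; a; z) v_1^{k_1-1} ⋯ v_m^{k_m-1}`, for nonzero formal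
power series `v_1,…,v_m` in `u_1,…,u_r` without constant term, as an element of the fraction field
of `ℂ⟦u_1,…,u_r⟧`. -/
def A (τ : UpperHalfPlane) {r m : ℕ} (v : Fin m → MvPowerSeries (Fin r) ℂ)
    (a : Fin m → ℝ) (z : ℝ) : FractionRing (MvPowerSeries (Fin r) ℂ) :=
  algebraMap (MvPowerSeries (Fin r) ℂ) (FractionRing (MvPowerSeries (Fin r) ℂ))
      (MvPowerSeries.subst v (gammaSeries τ a z))
    / ∏ i, algebraMap (MvPowerSeries (Fin r) ℂ) (FractionRing (MvPowerSeries (Fin r) ℂ)) (v i)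

/-- The variables `u_1,…,u_r` of `ℂ⟦u_1,…,u_r⟧`, numbered from `1`
(and `0` for an index outside `1,…,r`, which is never used). -/
def u (r j : ℕ) : MvPowerSeries (Fin r) ℂ :=
  if h : 1 ≤ j ∧ j ≤ r then MvPowerSeries.X ⟨j - 1, by omega⟩ else 0

/-- The upper arguments
`(u_1,…,u_{i-1}, u_i+⋯+u_r, -u_{i+1}-⋯-u_r, u_{i+1},…,u_{r-1})`, for `0 ≤ i ≤ r-1`; for `i = 0`
they are `(-u_1-⋯-u_r, u_1,…,u_{r-1})`. The position `p : Fin r` is the `(p+1)`-st one. -/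
def upperArgs (r i : ℕ) (p : Fin r) : MvPowerSeries (Fin r) ℂ :=
  if (p : ℕ) + 1 < i then u r (p + 1)
  else if (p : ℕ) + 1 = i then ∑ j ∈ Finset.Icc i r, u r j
  else if (p : ℕ) + 1 = i + 1 then -∑ j ∈ Finset.Icc (i + 1) r, u r j
  else u r p

/-- The lower arguments `(0,…,0,z)` of length `r`. -/
def lowerLast (r : ℕ) (z : ℝ) (p : Fin r) : ℝ :=
  if (p : ℕ) + 1 = r then z else 0

end EllipticPolylog

end

noncomputable section
namespace EllipticPolylog
open Complex

/-! ### The theta function -/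

/-! The identity is proved by induction on `r`: both sides satisfy the same first-order differential
equation in `z` on `(0, 1)` and have the same regularized value as `z → 0`.

The derivative of a generating series with all lower arguments `0` is `F(v_m; z)` times the series
with the last argument dropped. The series on the left has `z` both in the last kernel and in the
range of integration. With `x = u_{r-1}` and `y = u_r`, the Fay identity `F(x; t) F(y; t - z) = F(x;
z) F(x + y; t - z) + F(y; -z) F(x + y; t)` merges the two innermost kernels in `t`. It shows that
the derivative is `F(u_{r-1}; z)` times the same kind of series for `u_1, …, u_{r-2}, u_{r-1} +
u_r`, plus `F(u_r; -z)` times a series with lower arguments `0`. The induction hypothesis applies to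
the first summand and matches the terms on the right whose last argument is `u_{r-1}`. The second
matches the term `i = r - 1`, whose last argument is `-u_r`, because `F(-x; z) = -F(x; -z)`. This is
`hasRegDeriv_iterLastFrac` against `hasRegDeriv_iterFrac_succ`, assembled in `iterLastFrac_eq`.

As `z → 0`, a nonempty series with lower arguments `0` has regularized value `0`. On the left only
`k_1 = ⋯ = k_r = 1` survives, since `f^{(1)}` alone has a pole at `0`. Scaling the integral by `z`
turns the constant term into `∫_0^1 log(s)^{r-1} / (1 - s) ds`, hence into `(-1)^r ζ(r)`
(`hasRegValue_regIterLast`). A function with derivative zero and regularized value zero vanishes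
(`HasRegDeriv.eq_zero`).

Three kinds of preparation are needed. For theta: the Fay identity, from the Weierstrass three-term
relation, and the absence of zeros in `(-1, 1)` other than `0`, from a finite form of the triple
product. For the regularization: truncated integrals have expansions in `log(-2πiε)` that are
uniform in the upper limit and stable under integration against a kernel (`IsTruncExp.step`), and
the limit `ε → 0` commutes with `d/dz` (`hasDerivAt_iterLastSeries`). For the formal parameters:
every coefficient of a generating series is a finite combination of the coefficient functions, so
analysis is done coefficientwise and denominators are cleared in the fraction field. -/

theorem theta_term_eq (τ : UpperHalfPlane) (z : ℂ) (n : ℤ) :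
    (-1 : ℂ) ^ n * cexp (2 * Real.pi * I * (τ : ℂ) * (((n : ℂ) + 1 / 2) ^ 2 / 2))
      * cexp (2 * Real.pi * I * z * ((n : ℂ) + 1 / 2))
    = cexp (Real.pi * I * τ / 4 + Real.pi * I * z)
      * jacobiTheta₂_term n (z + τ / 2 + 1 / 2) τ := by
  have h1 : (-1 : ℂ) ^ n = cexp (n * (Real.pi * I)) := by
    rw [Complex.exp_int_mul, Complex.exp_pi_mul_I]
  rw [h1, jacobiTheta₂_term, ← Complex.exp_add, ← Complex.exp_add, ← Complex.exp_add]
  congr 1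
  ring

theorem hasSum_theta (τ : UpperHalfPlane) (z : ℂ) :
    HasSum (fun n : ℤ => (-1 : ℂ) ^ n
      * cexp (2 * Real.pi * I * (τ : ℂ) * (((n : ℂ) + 1 / 2) ^ 2 / 2))
      * cexp (2 * Real.pi * I * z * ((n : ℂ) + 1 / 2))) (theta τ z) := by
  apply Summable.hasSum
  simp_rw [theta_term_eq]
  exact ((summable_jacobiTheta₂_term_iff _ _).2 τ.im_pos).mul_left _

theorem theta_eq_jacobiTheta₂ (τ : UpperHalfPlane) (z : ℂ) :
    theta τ z = cexp (Real.pi * I * τ / 4 + Real.pi * I * z)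
      * jacobiTheta₂ (z + τ / 2 + 1 / 2) τ := by
  rw [theta, jacobiTheta₂, ← tsum_mul_left]
  exact tsum_congr fun n => theta_term_eq τ z n

theorem differentiable_theta (τ : UpperHalfPlane) : Differentiable ℂ (theta τ) := by
  intro z
  have h : theta τ = fun z => cexp (Real.pi * I * τ / 4 + Real.pi * I * z)
      * jacobiTheta₂ (z + τ / 2 + 1 / 2) τ := funext fun z => theta_eq_jacobiTheta₂ τ z
  rw [h]
  refine DifferentiableAt.mul (by fun_prop) ?_
  exact (differentiableAt_jacobiTheta₂_fst (z + τ / 2 + 1 / 2) τ.im_pos).comp z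
    (f := fun z => z + (τ : ℂ) / 2 + 1 / 2) (by fun_prop)

theorem theta_neg (τ : UpperHalfPlane) (z : ℂ) : theta τ (-z) = -theta τ z := by
  -- The reindexing `n ↦ -1 - n` negates `n + 1/2` and reverses the parity of `n`.
  rw [theta, theta, ← tsum_neg, ← (Equiv.subLeft (-1 : ℤ)).tsum_eq]
  refine tsum_congr fun n => ?_
  have h : (-1 : ℂ) ^ (-1 - n) = -(-1) ^ n := by
    rw [zpow_sub₀ (by norm_num), zpow_neg, zpow_one]
    rcases Int.even_or_odd n with h | h
    · rw [h.neg_one_zpow]; norm_num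
    · rw [h.neg_one_zpow]; norm_num
  simp only [Equiv.subLeft_apply, h, neg_mul]
  push_cast
  rw [show ((-1 : ℂ) - n + 1 / 2) = -(n + 1 / 2) by ring, neg_sq]
  congr 3
  ring

theorem theta_zero (τ : UpperHalfPlane) : theta τ 0 = 0 := by
  have := theta_neg τ 0
  rw [neg_zero] at this
  linear_combination this / 2

/-- The even part of the level two decomposition of `θ(x + y) θ(x - y)`. -/
def thetaEven (τ : UpperHalfPlane) (x : ℂ) : ℂ :=
  ∑' n : ℤ, cexp (2 * Real.pi * I * τ * n ^ 2 + 2 * Real.pi * I * (2 * n) * x)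

/-- The odd part of the level two decomposition of `θ(x + y) θ(x - y)`. -/
def thetaOdd (τ : UpperHalfPlane) (x : ℂ) : ℂ :=
  ∑' n : ℤ, cexp (2 * Real.pi * I * τ * (n + 1 / 2) ^ 2 + 2 * Real.pi * I * (2 * n + 1) * x)

theorem summable_norm_jacobiTheta₂_term (z τ : ℂ) (h : 0 < τ.im) :
    Summable fun n => ‖jacobiTheta₂_term n z τ‖ :=
  ((summable_jacobiTheta₂_term_iff _ _).2 h).norm

theorem summable_thetaEven (τ : UpperHalfPlane) (x : ℂ) :
    Summable fun n : ℤ =>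
      ‖cexp (2 * Real.pi * I * τ * n ^ 2 + 2 * Real.pi * I * (2 * n) * x)‖ := by
  refine (summable_norm_jacobiTheta₂_term (2 * x) (2 * τ) (by simp [τ.im_pos])).congr fun n => ?_
  rw [jacobiTheta₂_term]; congr 2; ring

theorem summable_thetaOdd (τ : UpperHalfPlane) (x : ℂ) :
    Summable fun n : ℤ =>
      ‖cexp (2 * Real.pi * I * τ * (n + 1 / 2) ^ 2 + 2 * Real.pi * I * (2 * n + 1) * x)‖ := by
  refine ((summable_norm_jacobiTheta₂_term (2 * x + τ) (2 * τ) (by simp [τ.im_pos])).mul_left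
    ‖cexp (Real.pi * I * τ / 2 + 2 * Real.pi * I * x)‖).congr fun n => ?_
  rw [jacobiTheta₂_term, ← norm_mul, ← Complex.exp_add]; congr 2; ring

/-- Pairs of integers, split by the parity of their sum. -/
def intPairParityEquiv : (ℤ × ℤ) ⊕ (ℤ × ℤ) ≃ ℤ × ℤ :=
  Equiv.ofBijective
    (Sum.elim (fun p => (p.1 + p.2, p.1 - p.2)) fun p => (p.1 + p.2, p.1 - p.2 - 1)) <| by
    constructor
    · rintro (⟨a, b⟩ | ⟨a, b⟩) (⟨c, d⟩ | ⟨c, d⟩) h <;>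
        simp only [Sum.elim_inl, Sum.elim_inr, Prod.mk.injEq] at h
      · congr 2 <;> omega
      · omega
      · omega
      · congr 2 <;> omega
    · rintro ⟨m, n⟩
      rcases Int.even_or_odd (m + n) with ⟨k, hk⟩ | ⟨k, hk⟩
      · exact ⟨Sum.inl (k, m - k), by simp only [Sum.elim_inl, Prod.mk.injEq]; omega⟩
      · exact ⟨Sum.inr (k + 1, m - k - 1), by simp only [Sum.elim_inr, Prod.mk.injEq]; omega⟩

theorem intPairParityEquiv_inl (a b : ℤ) :
    intPairParityEquiv (Sum.inl (a, b)) = (a + b, a - b) := rfl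

theorem intPairParityEquiv_inr (a b : ℤ) :
    intPairParityEquiv (Sum.inr (a, b)) = (a + b, a - b - 1) := rfl

/-- In the double series over `(m, n)` the exponent depends only on `(m + n + 1) / 2`, paired with
`x`, and `(m - n) / 2`, paired with `y`. For `m + n` even the first is a half-integer and the second
an integer. For `m + n` odd the roles are exchanged and the sign `(-1)^(m+n)` is negative. -/
theorem theta_add_mul_theta_sub (τ : UpperHalfPlane) (x y : ℂ) :
    theta τ (x + y) * theta τ (x - y)
      = thetaOdd τ x * thetaEven τ y - thetaEven τ x * thetaOdd τ y := by
  have h1 := (hasSum_theta τ (x + y)).summable.norm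
  have h2 := (hasSum_theta τ (x - y)).summable.norm
  have hs := (summable_mul_of_summable_norm h1 h2).hasSum
  rw [← tsum_mul_tsum_of_summable_norm h1 h2, ← theta, ← theta] at hs
  have ho := (summable_mul_of_summable_norm (summable_thetaOdd τ x) (summable_thetaEven τ y)).hasSum
  rw [← tsum_mul_tsum_of_summable_norm (summable_thetaOdd τ x) (summable_thetaEven τ y),
    ← thetaOdd, ← thetaEven] at ho
  have he := (summable_mul_of_summable_norm (summable_thetaEven τ x) (summable_thetaOdd τ y)).hasSum
  rw [← tsum_mul_tsum_of_summable_norm (summable_thetaEven τ x) (summable_thetaOdd τ y),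
    ← thetaOdd, ← thetaEven] at he
  have hsplit : ∀ m n : ℤ, (-1 : ℂ) ^ m
      * cexp (2 * Real.pi * I * (τ : ℂ) * (((m : ℂ) + 1 / 2) ^ 2 / 2))
      * cexp (2 * Real.pi * I * (x + y) * ((m : ℂ) + 1 / 2)) * ((-1 : ℂ) ^ n
      * cexp (2 * Real.pi * I * (τ : ℂ) * (((n : ℂ) + 1 / 2) ^ 2 / 2))
      * cexp (2 * Real.pi * I * (x - y) * ((n : ℂ) + 1 / 2))) = (-1 : ℂ) ^ (m + n) *
      cexp (2 * Real.pi * I * τ * (((m + n + 1) / 2) ^ 2 + ((m - n) / 2) ^ 2)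
        + 2 * Real.pi * I * ((m + n + 1) * x + (m - n) * y)) := by
    intro m n
    rw [zpow_add₀ (by norm_num)]
    have : ∀ a b c d e f : ℂ, a * cexp b * cexp c * (d * cexp e * cexp f)
        = a * d * cexp (b + c + e + f) := by intros; simp only [Complex.exp_add]; ring
    rw [this]
    congr 2
    ring
  rw [← intPairParityEquiv.hasSum_iff] at hs
  have hF : ∀ c, ((fun p : ℤ × ℤ => _) ∘ intPairParityEquiv) c = _ := fun c =>
    hsplit (intPairParityEquiv c).1 (intPairParityEquiv c).2
  replace hs := hs.congr_fun fun c => (hF c).symm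
  have h1 : ∀ a b : ℤ, (-1 : ℂ) ^ (a + b + (a - b)) = 1 := fun a b => by
    rw [show a + b + (a - b) = 2 * a by ring, zpow_mul]; norm_num
  have h2 : ∀ a b : ℤ, (-1 : ℂ) ^ (a + b + (a - b - 1)) = -1 := fun a b => by
    rw [show a + b + (a - b - 1) = 2 * a - 1 by ring, zpow_sub₀ (by norm_num), zpow_mul]; norm_num
  rw [sub_eq_add_neg (thetaOdd τ x * _)]
  refine hs.unique (HasSum.sum (M := ℂ) ?_ ?_)
  · refine ho.congr_fun fun ⟨a, b⟩ => ?_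
    simp only [Function.comp_apply, intPairParityEquiv_inl, h1,
      one_mul, ← Complex.exp_add]
    push_cast
    congr 1
    ring
  · refine he.neg.congr_fun fun ⟨a, b⟩ => ?_
    simp only [Function.comp_apply, intPairParityEquiv_inr, h2,
      neg_mul, one_mul, ← Complex.exp_add]
    push_cast
    congr 2
    ring

/-- The three-term identity of Weierstrass. -/
theorem theta_three_term (τ : UpperHalfPlane) (a b c d : ℂ) :
    theta τ (a + b) * theta τ (a - b) * (theta τ (c + d) * theta τ (c - d))
      - theta τ (a + c) * theta τ (a - c) * (theta τ (b + d) * theta τ (b - d))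
      + theta τ (a + d) * theta τ (a - d) * (theta τ (b + c) * theta τ (b - c)) = 0 := by
  -- Each product is now a 2×2 determinant in the vectors (`thetaOdd`, `thetaEven`), and the claim
  -- is the Plücker relation for four vectors in the plane.
  simp only [theta_add_mul_theta_sub]
  ring

/-- The Fay identity for the theta function. -/
theorem theta_fay (τ : UpperHalfPlane) (t s u v : ℂ) :
    theta τ (t + u) * theta τ (s + v) * theta τ (t - s) * theta τ (u + v)
      = theta τ (t - s + u) * theta τ (s + (u + v)) * theta τ t * theta τ v
        - theta τ (s - t + v) * theta τ (t + (u + v)) * theta τ s * theta τ u := by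
  -- The half-sums are solved for so that the twelve sums and differences are, up to sign, the
  -- twelve arguments in the Fay identity.
  have h := theta_three_term τ ((t + u + s + v) / 2) ((t + u - s - v) / 2)
    ((t - s + u + v) / 2) ((t - s - u - v) / 2)
  have e1 := theta_neg τ v
  have e2 := theta_neg τ (s - t + v)
  rw [show (t + u + s + v) / 2 + (t + u - s - v) / 2 = t + u by ring,
    show (t + u + s + v) / 2 - (t + u - s - v) / 2 = s + v by ring,
    show (t - s + u + v) / 2 + (t - s - u - v) / 2 = t - s by ring,
    show (t - s + u + v) / 2 - (t - s - u - v) / 2 = u + v by ring,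
    show (t + u + s + v) / 2 + (t - s + u + v) / 2 = t + (u + v) by ring,
    show (t + u + s + v) / 2 - (t - s + u + v) / 2 = s by ring,
    show (t + u - s - v) / 2 + (t - s - u - v) / 2 = -(s - t + v) by ring,
    show (t + u - s - v) / 2 - (t - s - u - v) / 2 = u by ring,
    show (t + u + s + v) / 2 + (t - s - u - v) / 2 = t by ring,
    show (t + u + s + v) / 2 - (t - s - u - v) / 2 = s + (u + v) by ring,
    show (t + u - s - v) / 2 + (t - s + u + v) / 2 = t - s + u by ring,
    show (t + u - s - v) / 2 - (t - s + u + v) / 2 = -v by ring, e1, e2] at h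
  linear_combination h

end EllipticPolylog

end

noncomputable section
namespace EllipticPolylog
open Complex Filter Topology

/-! ### Non-vanishing of the theta function on the real line -/

/-- The finite product `∏_{k=1}^n (1 - q^k)`. -/
def qFactorial (q : ℂ) (n : ℕ) : ℂ := ∏ k ∈ Finset.range n, (1 - q ^ (k + 1))

/-- The inverse of `∏_{k=1}^m (1 - q^k)`, extended by zero to negative integers. -/
def invQFactorial (q : ℂ) : ℤ → ℂ
  | Int.ofNat n => (qFactorial q n)⁻¹
  | Int.negSucc _ => 0

theorem one_sub_pow_ne_zero {q : ℂ} (hq : ‖q‖ < 1) (k : ℕ) : 1 - q ^ (k + 1) ≠ 0 := by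
  intro h
  have h1 : ‖q ^ (k + 1)‖ = 1 := by rw [← sub_eq_zero.1 h, norm_one]
  rw [norm_pow] at h1
  exact absurd h1 (pow_lt_one₀ (norm_nonneg q) hq (by omega)).ne

theorem qFactorial_ne_zero {q : ℂ} (hq : ‖q‖ < 1) (n : ℕ) : qFactorial q n ≠ 0 :=
  Finset.prod_ne_zero_iff.2 fun k _ => one_sub_pow_ne_zero hq k

/-- The extension by zero is consistent at `m = 0` because `1 - q ^ 0 = 0`. The finite triple
product can then be treated as a sum over all integers without boundary cases. -/
theorem invQFactorial_sub_one {q : ℂ} (hq : ‖q‖ < 1) (m : ℤ) :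
    invQFactorial q (m - 1) = (1 - q ^ m) * invQFactorial q m := by
  match m with
  | Int.ofNat 0 =>
    change (0 : ℂ) = _
    simp
  | Int.ofNat (n + 1) =>
    have h : (Int.ofNat (n + 1) - 1 : ℤ) = Int.ofNat n := by simp
    rw [h]
    have h1 := one_sub_pow_ne_zero hq n
    have h2 := qFactorial_ne_zero hq n
    simp only [invQFactorial]
    rw [Int.ofNat_eq_natCast, zpow_natCast,
      show qFactorial q (n + 1) = qFactorial q n * (1 - q ^ (n + 1)) from Finset.prod_range_succ _ _]
    field_simp
  | Int.negSucc n =>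
    have h : (Int.negSucc n - 1 : ℤ) = Int.negSucc (n + 1) := by omega
    rw [h]
    simp [invQFactorial]

/-- The general term of the triple product series. -/
def tripleTerm (q w : ℂ) (n : ℤ) : ℂ := (-1) ^ n * w ^ n * q ^ (n * (n + 1) / 2)

theorem tripleTerm_succ {q w : ℂ} (hq : q ≠ 0) (hw : w ≠ 0) (n : ℤ) :
    tripleTerm q w (n + 1) = -(w * q ^ (n + 1)) * tripleTerm q w n := by
  have h : (n + 1) * (n + 1 + 1) / 2 = n * (n + 1) / 2 + (n + 1) := by
    rw [show (n + 1) * (n + 1 + 1) = n * (n + 1) + 2 * (n + 1) by ring]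
    omega
  rw [tripleTerm, tripleTerm, h, zpow_add₀ hq, zpow_add_one₀ (by norm_num), zpow_add_one₀ hw]
  ring

/-- The finite form of the triple product. -/
theorem hasSum_finite_triple_product {q w : ℂ} (hq0 : q ≠ 0) (hq : ‖q‖ < 1) (hw : w ≠ 0) (N : ℕ) :
    HasSum (fun n : ℤ => qFactorial q (2 * N) * invQFactorial q (N + n) * invQFactorial q (N - n)
        * tripleTerm q w n)
      (∏ k ∈ Finset.range N, ((1 - w * q ^ (k + 1)) * (1 - q ^ k / w))) := by
  induction N with
  | zero =>
    have : ∀ n : ℤ, n ≠ 0 → qFactorial q (2 * 0) * invQFactorial q ((0 : ℕ) + n)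
        * invQFactorial q ((0 : ℕ) - n) * tripleTerm q w n = 0 := by
      intro n hn
      rcases lt_or_gt_of_ne hn with h | h
      · obtain ⟨m, rfl⟩ := Int.eq_negSucc_of_lt_zero h
        simp [invQFactorial]
      · obtain ⟨m, hm⟩ := Int.eq_negSucc_of_lt_zero (neg_lt_zero.2 h)
        simp [hm, invQFactorial]
    convert hasSum_single (0 : ℤ) this using 1
    have : invQFactorial q 0 = 1 := by
      change (qFactorial q 0)⁻¹ = 1
      simp [qFactorial]
    simp [qFactorial, this, tripleTerm]
  | succ N ih =>
    rw [Finset.prod_range_succ]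
    -- The new factor `(1 - w q^(N+1)) (1 - q^N / w)` expands into `1 + q^(2N+1)`, a multiple of `w`
    -- and a multiple of `1/w`. The last two shift the summation index by one in either direction.
    have e1 := ih.mul_left (1 + q ^ (2 * N + 1))
    have e2 := ((Equiv.subRight (1 : ℤ)).hasSum_iff.2 ih).mul_left (-(w * q ^ (N + 1)))
    have e3 := ((Equiv.addRight (1 : ℤ)).hasSum_iff.2 ih).mul_left (-(q ^ N / w))
    have e := (e1.add e2).add e3
    have hval : ∀ P : ℂ, (1 + q ^ (2 * N + 1)) * P + -(w * q ^ (N + 1)) * P + -(q ^ N / w) * P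
        = P * ((1 - w * q ^ (N + 1)) * (1 - q ^ N / w)) := by
      intro P
      field_simp
      ring
    rw [hval] at e
    refine e.congr_fun fun n => ?_
    simp only [Function.comp_apply, Equiv.subRight_apply, Equiv.coe_addRight]
    -- Everything is reduced to `invQFactorial` at `N + n + 1` and `N - n + 1` and to `tripleTerm`
    -- at `n - 1`. Comparison of coefficients is then a rational identity in `q`, `q ^ N` and `q ^
    -- n`.
    have ht : tripleTerm q w n = -(w * q ^ n) * tripleTerm q w (n - 1) := by
      have := tripleTerm_succ hq0 hw (n - 1)
      rwa [sub_add_cancel] at this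
    have hs := tripleTerm_succ hq0 hw n
    have a1 := invQFactorial_sub_one hq ((N : ℤ) + n + 1)
    have a2 := invQFactorial_sub_one hq ((N : ℤ) + n)
    have b1 := invQFactorial_sub_one hq ((N : ℤ) - n + 1)
    have b2 := invQFactorial_sub_one hq ((N : ℤ) - n)
    rw [add_sub_cancel_right] at a1 b1
    rw [show (((N + 1 : ℕ) : ℤ) + n) = N + n + 1 by push_cast; ring,
      show (((N + 1 : ℕ) : ℤ) - n) = N - n + 1 by push_cast; ring,
      show ((N : ℤ) + (n - 1)) = N + n - 1 by ring, show ((N : ℤ) - (n - 1)) = N - n + 1 by ring,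
      show ((N : ℤ) + (n + 1)) = N + n + 1 by ring, show ((N : ℤ) - (n + 1)) = N - n - 1 by ring,
      a2, b2, a1, b1, hs, ht,
      show qFactorial q (2 * (N + 1)) = qFactorial q (2 * N) * (1 - q ^ (2 * N + 1))
        * (1 - q ^ (2 * N + 2)) by
        rw [show 2 * (N + 1) = 2 * N + 1 + 1 by ring, qFactorial, Finset.prod_range_succ,
          Finset.prod_range_succ, ← qFactorial]]
    have z1 : q ^ ((N : ℤ) + n + 1) = q ^ N * q ^ n * q := by
      rw [zpow_add₀ hq0, zpow_add₀ hq0, zpow_one, zpow_natCast]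
    have z2 : q ^ ((N : ℤ) + n) = q ^ N * q ^ n := by rw [zpow_add₀ hq0, zpow_natCast]
    have z3 : q ^ ((N : ℤ) - n + 1) = q ^ N * (q ^ n)⁻¹ * q := by
      rw [zpow_add₀ hq0, zpow_sub₀ hq0, zpow_one, zpow_natCast]; rfl
    have z4 : q ^ ((N : ℤ) - n) = q ^ N * (q ^ n)⁻¹ := by rw [zpow_sub₀ hq0, zpow_natCast]; rfl
    have z5 : q ^ (n + 1) = q ^ n * q := zpow_add_one₀ hq0 n
    have hqn : q ^ n ≠ 0 := zpow_ne_zero n hq0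
    rw [z1, z2, z3, z4, z5]
    generalize invQFactorial q ((N : ℤ) + n + 1) = r
    generalize invQFactorial q ((N : ℤ) - n + 1) = s
    generalize tripleTerm q w (n - 1) = t
    generalize qFactorial q (2 * N) = F
    generalize q ^ n = Q at *
    field_simp
    ring

theorem exists_tendsto_qFactorial {q : ℂ} (hq : ‖q‖ < 1) :
    ∃ l : ℂ, l ≠ 0 ∧ Tendsto (qFactorial q) atTop (𝓝 l) := by
  have hs : Summable fun k : ℕ => ‖-q ^ (k + 1)‖ := by
    simp only [norm_neg, norm_pow]
    exact (summable_nat_add_iff 1).2 (summable_geometric_of_lt_one (norm_nonneg q) hq)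
  refine ⟨∏' k : ℕ, (1 + -q ^ (k + 1)), tprod_one_add_ne_zero_of_summable (fun k => ?_) hs, ?_⟩
  · rw [← sub_eq_add_neg]; exact one_sub_pow_ne_zero hq k
  · have := (multipliable_one_add_of_summable hs).hasProd.tendsto_prod_nat
    simpa only [← sub_eq_add_neg] using! this

/-- Factor by factor, `|1 - w q^k| ≥ 1 - |q|^k`. The bound is uniform over the unit circle and stays
away from zero as `n → ∞`. -/
theorem norm_qFactorial_le {q : ℂ} (hq : ‖q‖ < 1) (n : ℕ) {w : ℂ} (hw : ‖w‖ = 1) :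
    ‖qFactorial ‖q‖ n‖ ≤ ∏ k ∈ Finset.range n, ‖1 - w * q ^ (k + 1)‖ := by
  rw [qFactorial, norm_prod]
  refine Finset.prod_le_prod (fun _ _ => norm_nonneg _) fun k _ => ?_
  have h1 : ‖(1 : ℂ) - (‖q‖ : ℂ) ^ (k + 1)‖ = 1 - ‖q‖ ^ (k + 1) := by
    have : (1 : ℂ) - (‖q‖ : ℂ) ^ (k + 1) = ((1 - ‖q‖ ^ (k + 1) : ℝ) : ℂ) := by push_cast; rfl
    rw [this, Complex.norm_real, Real.norm_of_nonneg]
    exact sub_nonneg.2 (pow_le_one₀ (norm_nonneg q) hq.le)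
  rw [h1]
  refine le_trans (le_of_eq ?_) (norm_sub_norm_le _ _)
  rw [norm_one, norm_mul, hw, one_mul, norm_pow]

theorem theta_term_eq_tripleTerm (τ : UpperHalfPlane) (z : ℂ) (n : ℤ) :
    (-1 : ℂ) ^ n * cexp (2 * Real.pi * I * (τ : ℂ) * (((n : ℂ) + 1 / 2) ^ 2 / 2))
      * cexp (2 * Real.pi * I * z * ((n : ℂ) + 1 / 2))
    = cexp (Real.pi * I * τ / 4 + Real.pi * I * z)
      * tripleTerm (cexp (2 * Real.pi * I * τ)) (cexp (2 * Real.pi * I * z)) n := by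
  have h : ((n * (n + 1) / 2 : ℤ) : ℂ) = n * (n + 1) / 2 := by
    have h2 : n * (n + 1) / 2 * 2 = n * (n + 1) :=
      Int.ediv_mul_cancel (Int.even_mul_succ_self n).two_dvd
    rw [eq_div_iff (by norm_num)]
    exact_mod_cast h2
  rw [tripleTerm, ← Complex.exp_int_mul, ← Complex.exp_int_mul, h]
  have : ∀ x a b c d e : ℂ, a + b = c + d + e →
      x * cexp a * cexp b = cexp c * (x * cexp d * cexp e) := by
    intro x a b c d e h
    rw [mul_assoc, ← Complex.exp_add, h, Complex.exp_add, Complex.exp_add]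
    ring
  apply this
  ring

theorem summable_norm_tripleTerm (τ : UpperHalfPlane) (z : ℂ) :
    Summable fun n => ‖tripleTerm (cexp (2 * Real.pi * I * τ)) (cexp (2 * Real.pi * I * z)) n‖ := by
  have h := (hasSum_theta τ z).summable
  simp_rw [theta_term_eq_tripleTerm] at h
  exact ((summable_mul_left_iff (Complex.exp_ne_zero _)).1 h).norm

theorem theta_eq_tsum_tripleTerm (τ : UpperHalfPlane) (z : ℂ) :
    theta τ z = cexp (Real.pi * I * τ / 4 + Real.pi * I * z) *
      ∑' n, tripleTerm (cexp (2 * Real.pi * I * τ)) (cexp (2 * Real.pi * I * z)) n := by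
  rw [theta, ← tsum_mul_left]
  exact tsum_congr fun n => theta_term_eq_tripleTerm τ z n

/-- A lower bound for the theta function on the real line. -/
theorem exists_sin_le_norm_theta (τ : UpperHalfPlane) :
    ∃ c > 0, ∀ t : ℝ, c * |Real.sin (Real.pi * t)| ≤ ‖theta τ t‖ := by
  set q := cexp (2 * Real.pi * I * τ) with hqdef
  have hq0 : q ≠ 0 := Complex.exp_ne_zero _
  have hq : ‖q‖ < 1 := by
    rw [hqdef, Complex.norm_exp, Real.exp_lt_one_iff]
    have := τ.im_pos
    simp
    positivity
  obtain ⟨l, hl, hlim⟩ := exists_tendsto_qFactorial hq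
  obtain ⟨l', hl', hlim'⟩ := exists_tendsto_qFactorial (q := (‖q‖ : ℂ)) (by simpa using hq)
  obtain ⟨C, hC⟩ := (hlim.norm).bddAbove_range
  obtain ⟨C', hC'⟩ := (hlim.inv₀ hl).norm.bddAbove_range
  have hC0 : ∀ n, ‖qFactorial q n‖ ≤ C := fun n => hC ⟨n, rfl⟩
  have hC'0 : ∀ n, ‖invQFactorial q n‖ ≤ C' := by
    intro n
    match n with
    | Int.ofNat n => exact hC' ⟨n, rfl⟩
    | Int.negSucc n =>
      simp only [invQFactorial, norm_zero]
      exact (norm_nonneg _).trans (hC' ⟨0, rfl⟩)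
  have hr : ∀ s : ℕ → ℤ, Tendsto s atTop atTop →
      Tendsto (fun N => invQFactorial q (s N)) atTop (𝓝 l⁻¹) := by
    intro s hs
    have h1 : Tendsto (fun N => (s N).toNat) atTop atTop := by
      refine tendsto_atTop.2 fun b => ?_
      filter_upwards [hs.eventually_ge_atTop (b : ℤ)] with N hN
      omega
    refine ((hlim.inv₀ hl).comp h1).congr' ?_
    filter_upwards [hs.eventually_ge_atTop 0] with N hN
    obtain ⟨m, hm⟩ := Int.eq_ofNat_of_zero_le hN
    simp only [Function.comp_apply, hm]
    rfl
  refine ⟨‖cexp (Real.pi * I * τ / 4)‖ * (‖l‖ * ‖l'‖ ^ 2 * 2),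
    by have := Complex.exp_ne_zero (Real.pi * I * τ / 4); positivity, fun t => ?_⟩
  set w := cexp (2 * Real.pi * I * t) with hwdef
  have hw0 : w ≠ 0 := Complex.exp_ne_zero _
  have hw : ‖w‖ = 1 := by
    rw [hwdef, show (2 * Real.pi * I * t : ℂ) = ((2 * Real.pi * t : ℝ) : ℂ) * I by push_cast; ring,
      Complex.norm_exp_ofReal_mul_I]
  -- Let `N → ∞` in the finite triple product: the coefficient of each term tends to `l * l⁻¹ * l⁻¹
  -- = l⁻¹` and is bounded independently of `N` and `n`.
  have hsum := tendsto_tsum_of_dominated_convergence (𝓕 := atTop) (β := ℤ) (G := ℂ)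
    (f := fun N : ℕ => fun n : ℤ => qFactorial q (2 * N) * invQFactorial q (N + n)
        * invQFactorial q (N - n) * tripleTerm q w n)
    (g := fun n => l⁻¹ * tripleTerm q w n)
    (bound := fun n => C * C' * C' * ‖tripleTerm q w n‖)
    ((summable_norm_tripleTerm τ t).mul_left _)
    (fun n => by
      have h1 := hr (fun N => (N : ℤ) + n)
        (tendsto_atTop_add_const_right _ _ tendsto_natCast_atTop_atTop)
      have h2 := hr (fun N => (N : ℤ) - n) (by
        simpa only [sub_eq_add_neg] using
          tendsto_atTop_add_const_right _ _ tendsto_natCast_atTop_atTop)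
      have h3 : Tendsto (fun N : ℕ => qFactorial q (2 * N)) atTop (𝓝 l) :=
        hlim.comp (tendsto_id.const_mul_atTop' (by norm_num))
      have := ((h3.mul h1).mul h2).mul_const (tripleTerm q w n)
      rwa [mul_inv_cancel₀ hl, one_mul] at this)
    (Eventually.of_forall fun N n => by
      simp only [norm_mul]
      have hCn : 0 ≤ C := (norm_nonneg _).trans (hC0 0)
      have hCn' : 0 ≤ C' := (norm_nonneg _).trans (hC'0 0)
      gcongr
      · exact hC0 _
      · exact hC'0 _
      · exact hC'0 _)
  simp only [(hasSum_finite_triple_product hq0 hq hw0 _).tsum_eq, tsum_mul_left] at hsum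
  -- The factor `1 - w⁻¹` (index `k = 0`) carries the zeros and is kept. The others are bounded
  -- below by `norm_qFactorial_le`, applied to `w` and to `w⁻¹`.
  have hlow : ∀ N : ℕ, ‖qFactorial ‖q‖ (N + 1)‖ * (‖qFactorial ‖q‖ N‖ * ‖1 - w⁻¹‖)
      ≤ ‖∏ k ∈ Finset.range (N + 1), ((1 - w * q ^ (k + 1)) * (1 - q ^ k / w))‖ := by
    intro N
    rw [Finset.prod_mul_distrib, norm_mul, Finset.prod_range_succ' (fun k => 1 - q ^ k / w),
      norm_mul, norm_prod, norm_prod, pow_zero, one_div]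
    refine mul_le_mul (norm_qFactorial_le hq _ hw) (mul_le_mul_of_nonneg_right ?_ (norm_nonneg _))
      (by positivity) (by positivity)
    have := norm_qFactorial_le hq N (w := w⁻¹) (by rw [norm_inv, hw, inv_one])
    simpa only [div_eq_inv_mul] using this
  have hlim2 := le_of_tendsto_of_tendsto
    ((((tendsto_add_atTop_iff_nat 1).2 hlim').norm).mul (hlim'.norm.mul_const ‖1 - w⁻¹‖))
    ((tendsto_add_atTop_iff_nat 1).2 hsum).norm (Eventually.of_forall hlow)
  rw [norm_mul, norm_inv] at hlim2
  have hsin : ‖1 - w⁻¹‖ = 2 * |Real.sin (Real.pi * t)| := by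
    rw [norm_sub_rev, hwdef, ← Complex.exp_neg,
      show (-(2 * Real.pi * I * t) : ℂ) = I * ((-(2 * Real.pi * t) : ℝ) : ℂ) by push_cast; ring,
      Complex.norm_exp_I_mul_ofReal_sub_one, show -(2 * Real.pi * t) / 2 = -(Real.pi * t) by ring,
      Real.sin_neg, norm_mul, norm_neg, Real.norm_eq_abs, Real.norm_eq_abs, abs_two]
  have hl0 : 0 < ‖l‖ := norm_pos_iff.2 hl
  have he : ‖cexp (Real.pi * I * τ / 4 + Real.pi * I * t)‖ = ‖cexp (Real.pi * I * τ / 4)‖ := by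
    rw [Complex.exp_add, norm_mul,
      show (Real.pi * I * t : ℂ) = ((Real.pi * t : ℝ) : ℂ) * I by push_cast; ring,
      Complex.norm_exp_ofReal_mul_I, mul_one]
  rw [theta_eq_tsum_tripleTerm, norm_mul, he, mul_assoc]
  refine mul_le_mul_of_nonneg_left ?_ (norm_nonneg _)
  rw [hsin, inv_mul_eq_div, le_div_iff₀ hl0] at hlim2
  linarith

/-- The arguments `t` and `t - z` of the kernels, with `0 < t < z < 1`, lie in this range, so no
other information on the zeros of theta is needed. -/
theorem theta_ofReal_ne_zero (τ : UpperHalfPlane) {t : ℝ} (h0 : t ≠ 0) (h1 : |t| < 1) :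
    theta τ t ≠ 0 := by
  obtain ⟨c, hc, h⟩ := exists_sin_le_norm_theta τ
  have hs : Real.sin (Real.pi * t) ≠ 0 := by
    rw [Real.sin_ne_zero_iff]
    intro n hn
    have h2 : (n : ℝ) = t := by
      have := Real.pi_pos.ne'
      field_simp at hn
      linarith
    subst h2
    have h3 : |n| < 1 := by exact_mod_cast h1
    exact h0 (by exact_mod_cast Int.abs_lt_one_iff.1 h3)
  have := h t
  intro h4
  rw [h4, norm_zero] at this
  have := mul_pos hc (abs_pos.2 hs)
  linarith

/-- Were the derivative zero, `θ(t) = o(t)`, and the lower bound by `|sin πt|` would force the sine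
to have derivative `0` at the origin. -/
theorem deriv_theta_zero_ne_zero (τ : UpperHalfPlane) : deriv (theta τ) 0 ≠ 0 := by
  obtain ⟨c, hc, h⟩ := exists_sin_le_norm_theta τ
  intro h0
  have h1 := ((differentiable_theta τ) 0).hasDerivAt
  rw [h0] at h1
  have h2 : HasDerivAt (fun t : ℝ => theta τ t) 0 0 := by
    simpa using h1.comp_ofReal (z := 0)
  have h3 : (fun t : ℝ => Real.sin (Real.pi * t)) =o[𝓝 0] fun t : ℝ => t := by
    rw [hasDerivAt_iff_isLittleO] at h2
    simp only [Complex.ofReal_zero, theta_zero, sub_zero, smul_zero] at h2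
    refine Asymptotics.IsBigO.trans_isLittleO (Asymptotics.IsBigO.of_bound c⁻¹ ?_) h2
    refine Eventually.of_forall fun t => ?_
    rw [inv_mul_eq_div, le_div_iff₀ hc, mul_comm, Real.norm_eq_abs]
    exact h t
  have h4 : HasDerivAt (fun t : ℝ => Real.sin (Real.pi * t)) 0 0 := by
    rw [hasDerivAt_iff_isLittleO]
    simpa using h3
  have h5 : HasDerivAt (fun t : ℝ => Real.sin (Real.pi * t)) Real.pi 0 := by
    simpa using ((hasDerivAt_id (0 : ℝ)).const_mul Real.pi).sin
  exact Real.pi_ne_zero (h5.unique h4)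

end EllipticPolylog

end

noncomputable section
namespace EllipticPolylog
open Complex Filter Topology

/-! ### The Kronecker function and its Taylor coefficients -/

/-- The entire function `θ(z) / z`. -/
def thetaQuot (τ : UpperHalfPlane) : ℂ → ℂ := dslope (theta τ) 0

theorem theta_eq_mul_thetaQuot (τ : UpperHalfPlane) (z : ℂ) : theta τ z = z * thetaQuot τ z := by
  have := sub_smul_dslope (theta τ) 0 z
  simpa [theta_zero, thetaQuot] using this.symm

theorem thetaQuot_zero (τ : UpperHalfPlane) : thetaQuot τ 0 = deriv (theta τ) 0 := dslope_same _ _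

theorem thetaQuot_neg (τ : UpperHalfPlane) (z : ℂ) : thetaQuot τ (-z) = thetaQuot τ z := by
  rcases eq_or_ne z 0 with rfl | hz
  · simp
  · have h1 := theta_eq_mul_thetaQuot τ z
    have h2 := theta_eq_mul_thetaQuot τ (-z)
    rw [theta_neg, h1] at h2
    apply mul_left_cancel₀ hz
    linear_combination h2

theorem differentiable_thetaQuot (τ : UpperHalfPlane) : Differentiable ℂ (thetaQuot τ) := by
  have := (Complex.differentiableOn_dslope (f := theta τ) (c := 0) univ_mem).2
    (differentiable_theta τ).differentiableOn
  exact differentiableOn_univ.1 this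

theorem thetaQuot_zero_ne_zero (τ : UpperHalfPlane) : thetaQuot τ 0 ≠ 0 := by
  rw [thetaQuot_zero]; exact deriv_theta_zero_ne_zero τ

theorem thetaQuot_ofReal_ne_zero (τ : UpperHalfPlane) {t : ℝ} (h : |t| < 1) :
    thetaQuot τ t ≠ 0 := by
  rcases eq_or_ne t 0 with rfl | ht
  · exact thetaQuot_zero_ne_zero τ
  · have := theta_ofReal_ne_zero τ ht h
    rw [theta_eq_mul_thetaQuot] at this
    exact right_ne_zero_of_mul this

/-- The function `α ↦ α F_τ(α; z)` without singularity at `α = 0`. -/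
theorem eisensteinKroneckerReg_eq (τ : UpperHalfPlane) {z : ℂ} (hz : theta τ z ≠ 0) :
    eisensteinKroneckerReg τ z
      = fun α => theta τ (z + α) * (deriv (theta τ) 0 / thetaQuot τ α) / theta τ z := by
  have h0 := thetaQuot_zero_ne_zero τ
  have hne : ∀ α : ℂ, α ≠ 0 → α * eisensteinKronecker τ α z
      = theta τ (z + α) * (deriv (theta τ) 0 / thetaQuot τ α) / theta τ z := by
    intro α hα
    rw [eisensteinKronecker, theta_eq_mul_thetaQuot τ α]
    rcases eq_or_ne (thetaQuot τ α) 0 with h | h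
    · simp [h]
    · field_simp
  have hcont : ContinuousAt
      (fun α => theta τ (z + α) * (deriv (theta τ) 0 / thetaQuot τ α) / theta τ z) 0 := by
    have h1 : Continuous fun α => theta τ (z + α) :=
      (differentiable_theta τ).continuous.comp (by fun_prop)
    have h2 := (differentiable_thetaQuot τ).continuous
    exact (h1.continuousAt.mul (continuousAt_const.div h2.continuousAt h0)).div_const _
  ext α
  rw [eisensteinKroneckerReg]
  rcases eq_or_ne α 0 with rfl | hα
  · rw [Function.update_self]
    refine Tendsto.limUnder_eq ((hcont.tendsto.mono_left nhdsWithin_le_nhds).congr' ?_)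
    filter_upwards [self_mem_nhdsWithin] with α hα
    exact (hne α hα).symm
  · rw [Function.update_of_ne hα, hne α hα]

theorem analyticAt_deriv_div_thetaQuot (τ : UpperHalfPlane) :
    AnalyticAt ℂ (fun α => deriv (theta τ) 0 / thetaQuot τ α) 0 :=
  analyticAt_const.div ((differentiable_thetaQuot τ).analyticAt 0) (thetaQuot_zero_ne_zero τ)

theorem analyticAt_eisensteinKroneckerReg (τ : UpperHalfPlane) {z : ℂ} (hz : theta τ z ≠ 0) :
    AnalyticAt ℂ (eisensteinKroneckerReg τ z) 0 := by
  rw [eisensteinKroneckerReg_eq τ hz]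
  have h1 : AnalyticAt ℂ (fun α => theta τ (z + α)) 0 := by
    have : Differentiable ℂ fun α => theta τ (z + α) :=
      (differentiable_theta τ).comp (by fun_prop)
    exact this.analyticAt 0
  exact (h1.mul (analyticAt_deriv_div_thetaQuot τ)).div analyticAt_const hz

/-- The numerator of `f_τ^{(n)}(z)` over the denominator `θ_τ(z)`. -/
def kernelNum (τ : UpperHalfPlane) (n : ℕ) (z : ℂ) : ℂ :=
  (∑ i ∈ Finset.range (n + 1), n.choose i * iteratedDeriv i (theta τ) z
    * iteratedDeriv (n - i) (fun α => deriv (theta τ) 0 / thetaQuot τ α) 0) / n.factorial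

/-- The Leibniz sum in the definition makes holomorphy in `z` visible. The present form gives the
value at `0` and the link with `kernelCoeff`. -/
theorem kernelNum_eq (τ : UpperHalfPlane) (n : ℕ) (z : ℂ) :
    kernelNum τ n z = iteratedDeriv n
      (fun α => theta τ (z + α) * (deriv (theta τ) 0 / thetaQuot τ α)) 0 / n.factorial := by
  have h1 : ContDiffAt ℂ n (fun α => theta τ (z + α)) 0 := by
    have : Differentiable ℂ fun α => theta τ (z + α) :=
      (differentiable_theta τ).comp (by fun_prop)
    exact this.contDiff.contDiffAt
  have h2 : ContDiffAt ℂ n (fun α => deriv (theta τ) 0 / thetaQuot τ α) 0 :=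
    (analyticAt_deriv_div_thetaQuot τ).contDiffAt
  have := iteratedDeriv_fun_mul h1 h2
  rw [this, kernelNum]
  congr 1
  refine Finset.sum_congr rfl fun i _ => ?_
  rw [iteratedDeriv_comp_const_add]
  simp

theorem kernelCoeff_eq_kernelNum_div (τ : UpperHalfPlane) (n : ℕ) {z : ℂ} (hz : theta τ z ≠ 0) :
    kernelCoeff τ n z = kernelNum τ n z / theta τ z := by
  rw [kernelCoeff, kernelNum_eq, eisensteinKroneckerReg_eq τ hz]
  simp only [div_eq_mul_inv _ (theta τ z)]
  rw [iteratedDeriv_mul_const_field]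
  ring

theorem differentiable_kernelNum (τ : UpperHalfPlane) (n : ℕ) :
    Differentiable ℂ (kernelNum τ n) := by
  unfold kernelNum
  refine Differentiable.div_const (Differentiable.fun_sum fun i _ => ?_) _
  refine Differentiable.mul_const (Differentiable.const_mul ?_ _) _
  exact (differentiable_theta τ).contDiff (n := i + 1) |>.differentiable_iteratedDeriv i
    (by exact_mod_cast Nat.lt_succ_self i)

/-- At `z = 0` the generating function of the numerators is `α θ'(0)` near `α = 0`, because `θ(α) =
α * thetaQuot τ α`. Hence only `f^{(1)}` has a pole at the origin, with residue `1`. -/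
theorem kernelNum_zero (τ : UpperHalfPlane) (n : ℕ) :
    kernelNum τ n 0 = if n = 1 then deriv (theta τ) 0 else 0 := by
  have h : (fun α => theta τ (0 + α) * (deriv (theta τ) 0 / thetaQuot τ α))
      =ᶠ[𝓝 0] fun α => α * deriv (theta τ) 0 := by
    filter_upwards [(differentiable_thetaQuot τ).continuous.continuousAt.eventually_ne
      (thetaQuot_zero_ne_zero τ)] with α hα
    rw [zero_add, theta_eq_mul_thetaQuot]
    field_simp
  rw [kernelNum_eq, h.iteratedDeriv_eq, iteratedDeriv_mul_const_field]
  match n with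
  | 0 => simp
  | 1 => simp
  | n + 2 =>
    have : iteratedDeriv (n + 2) (fun α : ℂ => α) 0 = 0 := by
      rw [iteratedDeriv_succ', iteratedDeriv_succ']
      simp
    simp [this]

theorem kernelCoeff_neg (τ : UpperHalfPlane) (n : ℕ) {z : ℂ} (hz : theta τ z ≠ 0) :
    kernelCoeff τ n (-z) = (-1) ^ n * kernelCoeff τ n z := by
  have hz' : theta τ (-z) ≠ 0 := by rwa [theta_neg, neg_ne_zero]
  have h : eisensteinKroneckerReg τ (-z) = fun α => eisensteinKroneckerReg τ z (-α) := by
    rw [eisensteinKroneckerReg_eq τ hz', eisensteinKroneckerReg_eq τ hz]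
    ext α
    beta_reduce
    rw [thetaQuot_neg, theta_neg τ z, show -z + α = -(z + -α) by ring, theta_neg, neg_mul,
      neg_div_neg_eq]
  rw [kernelCoeff, kernelCoeff, h, iteratedDeriv_comp_neg, neg_zero, smul_eq_mul, mul_div_assoc]

/-- The part of `f_τ^{(n)}` that is regular at `0`. -/
def kernelReg (τ : UpperHalfPlane) (n : ℕ) : ℂ → ℂ :=
  dslope (fun z => kernelNum τ n z / thetaQuot τ z) 0

theorem kernelCoeff_eq_add (τ : UpperHalfPlane) (n : ℕ) {t : ℝ} (h0 : t ≠ 0) (h1 : |t| < 1) :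
    kernelCoeff τ n t = (if n = 1 then 1 else 0) / (t : ℂ) + kernelReg τ n t := by
  have h2 := thetaQuot_ofReal_ne_zero τ h1
  have h3 : (t : ℂ) ≠ 0 := by exact_mod_cast h0
  have h4 := thetaQuot_zero_ne_zero τ
  rw [kernelCoeff_eq_kernelNum_div τ n (theta_ofReal_ne_zero τ h0 h1), theta_eq_mul_thetaQuot]
  have := sub_smul_dslope (fun z => kernelNum τ n z / thetaQuot τ z) 0 (t : ℂ)
  rw [kernelNum_zero, sub_zero, smul_eq_mul] at this
  have h5 : (if n = 1 then deriv (theta τ) 0 else 0) / thetaQuot τ 0 = if n = 1 then 1 else 0 := by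
    split_ifs
    · rw [← thetaQuot_zero, div_self h4]
    · simp
  rw [h5] at this
  rw [kernelReg, eq_comm, ← mul_right_inj' h3, mul_add, this]
  field_simp
  ring

theorem contDiffOn_kernelReg (τ : UpperHalfPlane) (n : ℕ) :
    ContDiffOn ℝ 1 (fun t : ℝ => kernelReg τ n t) (Set.Ioo (-1) 1) := by
  have hU : IsOpen {z : ℂ | thetaQuot τ z ≠ 0} :=
    isOpen_ne_fun (differentiable_thetaQuot τ).continuous continuous_const
  have h1 : DifferentiableOn ℂ (kernelReg τ n) {z : ℂ | thetaQuot τ z ≠ 0} := by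
    rw [kernelReg, Complex.differentiableOn_dslope (hU.mem_nhds (thetaQuot_zero_ne_zero τ))]
    exact (differentiable_kernelNum τ n).differentiableOn.div
      (differentiable_thetaQuot τ).differentiableOn fun z hz => hz
  refine ((h1.contDiffOn hU).restrict_scalars ℝ).comp
    (Complex.ofRealCLM.contDiff.contDiffOn) fun t ht => ?_
  exact thetaQuot_ofReal_ne_zero τ (abs_lt.2 ht)

/-- This is `theta_fay` divided by the theta denominators. Using `α F(α; z)` instead of `F` clears
the poles in the formal parameters, so the identity holds on a full neighbourhood of the origin,
axes included. Smallness of the parameters is used only to keep `thetaQuot` nonzero. -/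
theorem eisensteinKroneckerReg_fay (τ : UpperHalfPlane) {t s : ℂ} (ht : theta τ t ≠ 0)
    (hs : theta τ s ≠ 0) (hts : theta τ (t - s) ≠ 0) :
    ∀ᶠ p : ℂ × ℂ in 𝓝 0,
      (p.1 + p.2) * eisensteinKroneckerReg τ t p.1 * eisensteinKroneckerReg τ s p.2
        = p.2 * eisensteinKroneckerReg τ (t - s) p.1 * eisensteinKroneckerReg τ s (p.1 + p.2)
          + p.1 * eisensteinKroneckerReg τ (s - t) p.2
            * eisensteinKroneckerReg τ t (p.1 + p.2) := by
  have hst : theta τ (s - t) ≠ 0 := by rwa [← neg_sub, theta_neg, neg_ne_zero]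
  have hc := (differentiable_thetaQuot τ).continuous
  have h0 := thetaQuot_zero_ne_zero τ
  have e1 : ∀ᶠ p : ℂ × ℂ in 𝓝 0, thetaQuot τ p.1 ≠ 0 :=
    (hc.comp continuous_fst).continuousAt.eventually_ne h0
  have e2 : ∀ᶠ p : ℂ × ℂ in 𝓝 0, thetaQuot τ p.2 ≠ 0 :=
    (hc.comp continuous_snd).continuousAt.eventually_ne h0
  have e3 : ∀ᶠ p : ℂ × ℂ in 𝓝 0, thetaQuot τ (p.1 + p.2) ≠ 0 :=
    (hc.comp (continuous_fst.add continuous_snd)).continuousAt.eventually_ne (by simpa using h0)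
  filter_upwards [e1, e2, e3] with ⟨u, v⟩ h1 h2 h3
  simp only [eisensteinKroneckerReg_eq τ ht, eisensteinKroneckerReg_eq τ hs,
    eisensteinKroneckerReg_eq τ hts, eisensteinKroneckerReg_eq τ hst]
  have h := theta_fay τ t s u v
  rw [theta_eq_mul_thetaQuot τ u, theta_eq_mul_thetaQuot τ v,
    theta_eq_mul_thetaQuot τ (u + v)] at h
  have hn : theta τ (s - t) = -theta τ (t - s) := by rw [← neg_sub, theta_neg]
  rw [hn]
  simp only at h1 h2 h3
  field_simp
  linear_combination deriv (theta τ) 0 ^ 2 * h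

theorem eisensteinKroneckerReg_sub_sum_isBigO (τ : UpperHalfPlane) {z : ℂ} (hz : theta τ z ≠ 0)
    (N : ℕ) :
    (fun α => eisensteinKroneckerReg τ z α
      - ∑ k ∈ Finset.range (N + 1), kernelCoeff τ k z * α ^ k) =O[𝓝 0] fun α => α ^ (N + 1) := by
  have h := (analyticAt_eisensteinKroneckerReg τ hz).hasFPowerSeriesAt.isBigO_sub_partialSum_pow
    (N + 1)
  simp only [zero_add, FormalMultilinearSeries.partialSum] at h
  refine (h.congr_left fun α => ?_).trans (Asymptotics.IsBigO.of_norm_right ?_)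
  · congr 1
    refine Finset.sum_congr rfl fun k _ => ?_
    simp [FormalMultilinearSeries.ofScalars, kernelCoeff, mul_comm]
  · simp only [norm_pow]
    exact Asymptotics.isBigO_refl _ _

end EllipticPolylog

end

noncomputable section
namespace EllipticPolylog
open Filter Topology

/-! ### Power series in formal parameters -/

section PowerSeries

variable {σ : Type*}

/-- The ideal of power series all of whose terms have degree greater than `N`. -/
def degIdeal (σ : Type*) (N : ℕ) : Ideal (MvPowerSeries σ ℂ) where
  carrier := {x | (N : ℕ∞) < x.order}
  zero_mem' := by simp [MvPowerSeries.order_zero]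
  add_mem' := fun ha hb => (lt_min ha hb).trans_le MvPowerSeries.min_order_le_add
  smul_mem' := fun c x hx => lt_of_lt_of_le (lt_of_lt_of_le hx le_add_self)
    MvPowerSeries.le_order_mul

theorem mem_degIdeal {N : ℕ} {x : MvPowerSeries σ ℂ} :
    x ∈ degIdeal σ N ↔ (N : ℕ∞) < x.order := Iff.rfl

theorem mem_degIdeal_iff {N : ℕ} {x : MvPowerSeries σ ℂ} :
    x ∈ degIdeal σ N ↔ ∀ e : σ →₀ ℕ, e.degree ≤ N → MvPowerSeries.coeff e x = 0 := by
  rw [mem_degIdeal]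
  constructor
  · intro h e he
    exact MvPowerSeries.coeff_of_lt_order (lt_of_le_of_lt (by exact_mod_cast he) h)
  · intro h
    refine lt_of_lt_of_le (b := ((N + 1 : ℕ) : ℕ∞)) (by exact_mod_cast Nat.lt_succ_self N)
      (MvPowerSeries.nat_le_order fun d hd => h d (by omega))

/-- The quotient map modulo terms of degree greater than `N`. -/
abbrev truncMap (σ : Type*) (N : ℕ) :
    MvPowerSeries σ ℂ →ₐ[ℂ] MvPowerSeries σ ℂ ⧸ degIdeal σ N :=
  Ideal.Quotient.mkₐ ℂ (degIdeal σ N)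

theorem truncMap_eq_iff {N : ℕ} {x y : MvPowerSeries σ ℂ} :
    truncMap σ N x = truncMap σ N y
      ↔ ∀ e : σ →₀ ℕ, e.degree ≤ N → MvPowerSeries.coeff e x = MvPowerSeries.coeff e y := by
  rw [Ideal.Quotient.mkₐ_eq_mk, Ideal.Quotient.eq, mem_degIdeal_iff]
  simp only [map_sub, sub_eq_zero]

/-- Identities between generating series are checked in these quotients, where a substituted series
becomes a finite sum and can be manipulated algebraically. -/
theorem ext_truncMap {x y : MvPowerSeries σ ℂ} (h : ∀ N, truncMap σ N x = truncMap σ N y) :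
    x = y := by
  ext e
  exact truncMap_eq_iff.1 (h e.degree) e le_rfl

theorem prod_pow_mem_degIdeal {ι : Type*} [Fintype ι] {v : ι → MvPowerSeries σ ℂ}
    (hv : ∀ i, MvPowerSeries.constantCoeff (v i) = 0) {k : ι → ℕ} {N : ℕ} (hk : N < ∑ i, k i) :
    ∏ i, v i ^ k i ∈ degIdeal σ N := by
  rw [mem_degIdeal]
  refine lt_of_lt_of_le (b := ((∑ i, k i : ℕ) : ℕ∞)) (by exact_mod_cast hk) ?_
  refine le_trans ?_ (MvPowerSeries.le_order_prod _ _)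
  push_cast
  exact Finset.sum_le_sum fun i _ => MvPowerSeries.le_order_pow_of_constantCoeff_eq_zero _ (hv i)

/-- The power series with coefficients `c`. -/
def coeffSeries {n : ℕ} (c : (Fin n → ℕ) → ℂ) : MvPowerSeries (Fin n) ℂ := fun k => c k

theorem coeff_coeffSeries {n : ℕ} (c : (Fin n → ℕ) → ℂ) (d : Fin n →₀ ℕ) :
    MvPowerSeries.coeff d (coeffSeries c) = c d := rfl

/-- The series `∑_k c(k) v_1^{k_1} ⋯ v_n^{k_n}`. -/
def genSeries {n : ℕ} (v : Fin n → MvPowerSeries σ ℂ) (c : (Fin n → ℕ) → ℂ) :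
    MvPowerSeries σ ℂ :=
  MvPowerSeries.subst v (coeffSeries c)

theorem coeff_genSeries {n : ℕ} {v : Fin n → MvPowerSeries σ ℂ}
    (hv : ∀ i, MvPowerSeries.constantCoeff (v i) = 0) (c : (Fin n → ℕ) → ℂ)
    {N : ℕ} {e : σ →₀ ℕ} (he : e.degree ≤ N) :
    MvPowerSeries.coeff e (genSeries v c)
      = ∑ k ∈ Fintype.piFinset fun _ : Fin n => Finset.range (N + 1),
          c k * MvPowerSeries.coeff e (∏ i, v i ^ k i) := by
  rw [genSeries, MvPowerSeries.coeff_subst (MvPowerSeries.hasSubst_of_constantCoeff_zero hv)]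
  simp only [coeff_coeffSeries, smul_eq_mul, Finsupp.prod_fintype _ _ (fun i => pow_zero (v i))]
  rw [finsum_eq_sum_of_support_subset (s := (Fintype.piFinset fun _ : Fin n =>
    Finset.range (N + 1)).map Finsupp.equivFunOnFinite.symm.toEmbedding)]
  · rw [Finset.sum_map]
    rfl
  · intro d hd
    rw [Function.mem_support] at hd
    simp only [Finset.coe_map, Set.mem_image, Finset.mem_coe, Fintype.mem_piFinset,
      Finset.mem_range]
    refine ⟨d, fun i => ?_, by ext; rfl⟩
    by_contra hi
    apply hd
    have : ∏ i, v i ^ d i ∈ degIdeal σ N := by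
      refine prod_pow_mem_degIdeal hv (lt_of_lt_of_le (by omega : N < d i) ?_)
      exact Finset.single_le_sum (f := fun i => d i) (fun _ _ => Nat.zero_le _) (Finset.mem_univ i)
    rw [mem_degIdeal_iff.1 this e he, mul_zero]

theorem truncMap_genSeries {n : ℕ} {v : Fin n → MvPowerSeries σ ℂ}
    (hv : ∀ i, MvPowerSeries.constantCoeff (v i) = 0) (c : (Fin n → ℕ) → ℂ) (N : ℕ) :
    truncMap σ N (genSeries v c)
      = ∑ k ∈ Fintype.piFinset fun _ : Fin n => Finset.range (N + 1),
          c k • ∏ i, truncMap σ N (v i) ^ k i := by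
  have : truncMap σ N (genSeries v c) = truncMap σ N
      (∑ k ∈ Fintype.piFinset fun _ : Fin n => Finset.range (N + 1), c k • ∏ i, v i ^ k i) := by
    rw [truncMap_eq_iff]
    intro e he
    rw [coeff_genSeries hv c he, map_sum]
    rfl
  rw [this]
  simp only [map_sum, map_smul, map_prod, map_pow]

/-- The series `∑_j b(j) x^j`. -/
def genSeriesOne (x : MvPowerSeries σ ℂ) (b : ℕ → ℂ) : MvPowerSeries σ ℂ :=
  genSeries (fun _ : Fin 1 => x) fun k => b (k 0)

theorem truncMap_genSeriesOne {x : MvPowerSeries σ ℂ}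
    (hx : MvPowerSeries.constantCoeff x = 0) (b : ℕ → ℂ) (N : ℕ) :
    truncMap σ N (genSeriesOne x b)
      = ∑ j ∈ Finset.range (N + 1), b j • truncMap σ N x ^ j := by
  rw [genSeriesOne, truncMap_genSeries fun _ => hx]
  refine Finset.sum_bij' (fun k _ => k 0) (fun j _ => fun _ => j) ?_ ?_ ?_ ?_ ?_
  · intro k hk; exact Fintype.mem_piFinset.1 hk 0
  · intro j hj; exact Fintype.mem_piFinset.2 fun _ => hj
  · intro k _; ext i; rw [Subsingleton.elim i 0]
  · intro j _; rfl
  · intro k _; simp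

theorem genSeries_mul {n : ℕ} {v : Fin (n + 1) → MvPowerSeries σ ℂ}
    (hv : ∀ i, MvPowerSeries.constantCoeff (v i) = 0) (a : (Fin n → ℕ) → ℂ) (b : ℕ → ℂ) :
    genSeries v (fun k => a (fun i => k i.castSucc) * b (k (Fin.last n)))
      = genSeries (fun i => v i.castSucc) a * genSeriesOne (v (Fin.last n)) b := by
  refine ext_truncMap fun N => ?_
  rw [map_mul, truncMap_genSeries hv, truncMap_genSeries fun i => hv _,
    truncMap_genSeriesOne (hv _), Finset.sum_mul_sum, ← Finset.sum_product']
  refine Finset.sum_bij' (fun k _ => (fun i => k i.castSucc, k (Fin.last n)))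
    (fun p _ => Fin.snoc (α := fun _ => ℕ) p.1 p.2) ?_ ?_ ?_ ?_ ?_
  · intro k hk
    have := Fintype.mem_piFinset.1 hk
    exact Finset.mem_product.2 ⟨Fintype.mem_piFinset.2 fun i => this _, this _⟩
  · intro p hp
    have := Finset.mem_product.1 hp
    refine Fintype.mem_piFinset.2 fun i => ?_
    refine Fin.lastCases ?_ (fun i => ?_) i
    · rw [Fin.snoc_last]; exact this.2
    · rw [Fin.snoc_castSucc]; exact Fintype.mem_piFinset.1 this.1 i
  · intro k _
    exact Fin.snoc_init_self k
  · intro p _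
    simp
  · intro k _
    rw [Fin.prod_univ_castSucc, smul_mul_smul_comm]

theorem genSeries_add {n : ℕ} {v : Fin n → MvPowerSeries σ ℂ}
    (hv : ∀ i, MvPowerSeries.constantCoeff (v i) = 0) (a b : (Fin n → ℕ) → ℂ) :
    genSeries v (fun k => a k + b k) = genSeries v a + genSeries v b := by
  refine ext_truncMap fun N => ?_
  simp only [map_add, truncMap_genSeries hv, add_smul, Finset.sum_add_distrib]

theorem genSeries_smul {n : ℕ} {v : Fin n → MvPowerSeries σ ℂ}
    (hv : ∀ i, MvPowerSeries.constantCoeff (v i) = 0) (r : ℂ) (a : (Fin n → ℕ) → ℂ) :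
    genSeries v (fun k => r * a k) = r • genSeries v a := by
  refine ext_truncMap fun N => ?_
  simp only [map_smul, truncMap_genSeries hv, mul_smul, Finset.smul_sum]

theorem genSeries_zero {v : Fin 0 → MvPowerSeries σ ℂ} (a : (Fin 0 → ℕ) → ℂ) :
    genSeries v a = algebraMap ℂ _ (a 0) := by
  refine ext_truncMap fun N => ?_
  rw [truncMap_genSeries (fun i => i.elim0), AlgHom.commutes, Algebra.algebraMap_eq_smul_one,
    Fintype.piFinset_of_isEmpty]
  simp only [Finset.univ_unique, Finset.sum_singleton, Finset.univ_eq_empty, Finset.prod_empty]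
  congr 2
  exact Subsingleton.elim _ _

/-! ### The formal Fay identity -/

/-- Once the lower coefficients vanish, `Q = X ^ i * R`. Dividing the bound by `T ^ i` gives `R(T) =
O(T)`, so `R(0) = 0`. -/
theorem coeff_eq_zero_of_isBigO {Q : Polynomial ℂ} {N : ℕ}
    (h : (fun T => Q.eval T) =O[𝓝 0] fun T : ℂ => T ^ (N + 1)) {i : ℕ} (hi : i ≤ N) :
    Q.coeff i = 0 := by
  induction i using Nat.strong_induction_on with
  | _ i ih =>
    obtain ⟨R, rfl⟩ := Polynomial.X_pow_dvd_iff.2 fun d hd => ih d hd (by omega)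
    rw [Polynomial.coeff_X_pow_mul', if_pos le_rfl, Nat.sub_self, Polynomial.coeff_zero_eq_eval_zero]
    have h1 : Tendsto (fun T => R.eval T) (𝓝[≠] (0 : ℂ)) (𝓝 0) := by
      have h2 : (fun T => R.eval T) =O[𝓝[≠] 0] fun T : ℂ => T := by
        obtain ⟨C, hC⟩ := (h.mono (nhdsWithin_le_nhds (s := {0}ᶜ))).bound
        have hev : ∀ᶠ T in 𝓝[≠] (0 : ℂ), ‖T‖ ≤ 1 :=
          nhdsWithin_le_nhds ((continuous_norm.tendsto (0 : ℂ)).eventually_le_const (by simp))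
        refine Asymptotics.IsBigO.of_bound |C| ?_
        filter_upwards [hC, self_mem_nhdsWithin, hev] with T hT hT0 hT1
        have hpos : 0 < ‖T‖ ^ i := pow_pos (norm_pos_iff.2 hT0) i
        rw [Polynomial.eval_mul, Polynomial.eval_pow, Polynomial.eval_X, norm_mul, norm_pow,
          norm_pow] at hT
        refine le_of_mul_le_mul_left (hT.trans ?_) hpos
        rw [show N + 1 = i + (N - i + 1) by omega, pow_add]
        calc C * (‖T‖ ^ i * ‖T‖ ^ (N - i + 1)) ≤ |C| * (‖T‖ ^ i * ‖T‖ ^ 1) := by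
              refine mul_le_mul (le_abs_self C) ?_ (by positivity) (abs_nonneg C)
              refine mul_le_mul_of_nonneg_left ?_ hpos.le
              exact pow_le_pow_of_le_one (norm_nonneg T) hT1 (by omega)
          _ = ‖T‖ ^ i * (|C| * ‖T‖) := by ring
      exact h2.trans_tendsto (tendsto_id.mono_left nhdsWithin_le_nhds)
    have h3 : Tendsto (fun T => R.eval T) (𝓝[≠] (0 : ℂ)) (𝓝 (R.eval 0)) :=
      (R.continuous.tendsto 0).mono_left nhdsWithin_le_nhds
    exact tendsto_nhds_unique h3 h1

/-- The passage from analytic to formal identities. The coefficient of `T ^ i` in `P(a T)` is the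
value at `a` of the homogeneous component of degree `i`. Smallness along every line therefore kills
all components of degree at most `N`, and the remaining monomials land in the ideal when series
without constant term are substituted. -/
theorem aeval_mem_degIdeal {ι : Type*} [Fintype ι] {P : MvPolynomial ι ℂ} {N : ℕ}
    (hP : ∀ a : ι → ℂ, (fun T : ℂ => MvPolynomial.eval (fun j => a j * T) P)
      =O[𝓝 0] fun T : ℂ => T ^ (N + 1)) {v : ι → MvPowerSeries σ ℂ}
    (hv : ∀ i, MvPowerSeries.constantCoeff (v i) = 0) :
    MvPolynomial.aeval v P ∈ degIdeal σ N := by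
  have h1 : ∀ i ≤ N, MvPolynomial.homogeneousComponent i P = 0 := by
    intro i hi
    refine MvPolynomial.funext fun a => ?_
    have h2 : (fun T : ℂ => (MvPolynomial.aeval
        (fun j => Polynomial.C (a j) * Polynomial.X) P).eval T)
        = fun T : ℂ => MvPolynomial.eval (fun j => a j * T) P := by
      ext T
      rw [MvPolynomial.aeval_def, MvPolynomial.eval₂_eq', MvPolynomial.eval_eq',
        Polynomial.eval_finsetSum]
      simp [Polynomial.eval_prod]
    have h3 := coeff_eq_zero_of_isBigO (h2 ▸ hP a) hi
    rw [map_zero, ← h3, MvPolynomial.aeval_def, MvPolynomial.eval₂_eq',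
      MvPolynomial.homogeneousComponent_apply]
    simp only [map_sum, Polynomial.finsetSum_coeff, Finset.sum_filter]
    refine Finset.sum_congr rfl fun d _ => ?_
    have h4 : algebraMap ℂ (Polynomial ℂ) (MvPolynomial.coeff d P)
        * ∏ j, (Polynomial.C (a j) * Polynomial.X) ^ d j
        = Polynomial.C (MvPolynomial.coeff d P * ∏ j, a j ^ d j) * Polynomial.X ^ d.degree := by
      simp only [mul_pow, Finset.prod_mul_distrib, Finset.prod_pow_eq_pow_sum, map_mul, map_prod,
        map_pow, Finsupp.degree_eq_sum, Polynomial.algebraMap_eq, mul_assoc]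
    rw [h4, Polynomial.coeff_C_mul_X_pow]
    by_cases hd : d.degree = i
    · rw [if_pos hd, if_pos hd.symm, MvPolynomial.eval_monomial, Finsupp.prod_fintype]
      simp
    · rw [if_neg hd, if_neg (Ne.symm hd), map_zero]
  rw [MvPolynomial.aeval_def, MvPolynomial.eval₂_eq']
  refine Ideal.sum_mem _ fun d hd => Ideal.mul_mem_left _ _ (prod_pow_mem_degIdeal hv ?_)
  by_contra hN
  have := h1 (∑ i, d i) (by omega)
  have h4 : MvPolynomial.coeff d (MvPolynomial.homogeneousComponent (∑ i, d i) P) = 0 := by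
    rw [this, MvPolynomial.coeff_zero]
  rw [MvPolynomial.coeff_homogeneousComponent, if_pos (Finsupp.degree_eq_sum d)] at h4
  exact MvPolynomial.mem_support_iff.1 hd h4

end PowerSeries

end EllipticPolylog

end

/-! ### The Kronecker series in formal parameters -/

noncomputable section
namespace EllipticPolylog
open Filter Topology

section PowerSeries
variable {σ : Type*}

/-- The series `x F_τ(x; t)` in a formal parameter `x`. -/
def kerSeries (τ : UpperHalfPlane) (t : ℂ) (x : MvPowerSeries σ ℂ) : MvPowerSeries σ ℂ :=
  genSeriesOne x fun k => kernelCoeff τ k t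

theorem mul_sub_mul_isBigO {f f' g g' h : ℂ → ℂ} {l : Filter ℂ} (hf : (fun T => f T - f' T) =O[l] h)
    (hg : (fun T => g T - g' T) =O[l] h) (hf1 : f =O[l] fun _ => (1 : ℂ))
    (hg1 : g' =O[l] fun _ => (1 : ℂ)) : (fun T => f T * g T - f' T * g' T) =O[l] h := by
  have h1 := hf1.mul hg
  have h2 := hf.mul hg1
  simp only [one_mul, mul_one] at h1 h2
  exact (h1.add h2).congr_left fun T => by ring

theorem kernel_taylor_comp (τ : UpperHalfPlane) {z : ℂ} (hz : theta τ z ≠ 0) (N : ℕ) (α : ℂ) :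
    (fun T => eisensteinKroneckerReg τ z (α * T)
      - ∑ k ∈ Finset.range (N + 1), kernelCoeff τ k z * (α * T) ^ k)
      =O[𝓝 0] fun T => T ^ (N + 1) := by
  have h1 : Tendsto (fun T : ℂ => α * T) (𝓝 0) (𝓝 0) := by
    have : Continuous fun T : ℂ => α * T := by fun_prop
    simpa using this.tendsto 0
  refine ((eisensteinKroneckerReg_sub_sum_isBigO τ hz N).comp_tendsto h1).trans ?_
  refine Asymptotics.IsBigO.of_bound (‖α‖ ^ (N + 1)) (Eventually.of_forall fun T => ?_)
  simp [mul_pow]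

theorem kernel_comp_isBigO_one (τ : UpperHalfPlane) {z : ℂ} (hz : theta τ z ≠ 0) (α : ℂ) :
    (fun T => eisensteinKroneckerReg τ z (α * T)) =O[𝓝 0] fun _ => (1 : ℂ) := by
  have h1 : Tendsto (fun T : ℂ => α * T) (𝓝 0) (𝓝 0) := by
    have : Continuous fun T : ℂ => α * T := by fun_prop
    simpa using this.tendsto 0
  exact ((analyticAt_eisensteinKroneckerReg τ hz).continuousAt.tendsto.comp h1).isBigO_one ℂ

theorem continuous_isBigO_one {f : ℂ → ℂ} (hf : Continuous f) :
    f =O[𝓝 0] fun _ => (1 : ℂ) := (hf.tendsto 0).isBigO_one ℂ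

/-- The Fay identity for the Kronecker series in formal parameters. -/
theorem kerSeries_fay (τ : UpperHalfPlane) {t s : ℂ} (ht : theta τ t ≠ 0)
    (hs : theta τ s ≠ 0) (hts : theta τ (t - s) ≠ 0) {x y : MvPowerSeries σ ℂ}
    (hx : MvPowerSeries.constantCoeff x = 0) (hy : MvPowerSeries.constantCoeff y = 0) :
    (x + y) * kerSeries τ t x * kerSeries τ s y
      = y * kerSeries τ (t - s) x * kerSeries τ s (x + y)
        + x * kerSeries τ (s - t) y * kerSeries τ t (x + y) := by
  have hst : theta τ (s - t) ≠ 0 := by rwa [← neg_sub, theta_neg, neg_ne_zero]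
  have hxy : MvPowerSeries.constantCoeff (x + y) = 0 := by rw [map_add, hx, hy, add_zero]
  refine ext_truncMap fun N => ?_
  let p : ℂ → MvPolynomial (Fin 2) ℂ → MvPolynomial (Fin 2) ℂ := fun z X =>
    ∑ k ∈ Finset.range (N + 1), kernelCoeff τ k z • X ^ k
  let X := (MvPolynomial.X 0 : MvPolynomial (Fin 2) ℂ)
  let Y := (MvPolynomial.X 1 : MvPolynomial (Fin 2) ℂ)
  -- The identity with each Taylor series cut off at degree `N`. Along a line, replacing the cut-off
  -- series by the functions costs `O(T ^ (N + 1))`, and for the functions the identity is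
  -- `eisensteinKroneckerReg_fay`.
  let P := (X + Y) * p t X * p s Y - (Y * p (t - s) X * p s (X + Y)
    + X * p (s - t) Y * p t (X + Y))
  have hp : ∀ (z : ℂ) (X : MvPolynomial (Fin 2) ℂ), truncMap σ N (MvPolynomial.aeval ![x, y] (p z X))
      = ∑ k ∈ Finset.range (N + 1), kernelCoeff τ k z
        • truncMap σ N (MvPolynomial.aeval ![x, y] X) ^ k := by
    intro z X
    simp only [p, map_sum, map_smul, map_pow]
  have hX : MvPolynomial.aeval ![x, y] X = x := by simp [X]
  have hY : MvPolynomial.aeval ![x, y] Y = y := by simp [Y]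
  have key : truncMap σ N (MvPolynomial.aeval ![x, y] P) = 0 := by
    rw [Ideal.Quotient.mkₐ_eq_mk, Ideal.Quotient.eq_zero_iff_mem]
    refine aeval_mem_degIdeal (fun a => ?_) fun i => by fin_cases i <;> simp [hx, hy]
    have e : ∀ T : ℂ, MvPolynomial.eval (fun j => a j * T) P
        = (a 0 * T + a 1 * T) * (∑ k ∈ Finset.range (N + 1), kernelCoeff τ k t * (a 0 * T) ^ k)
            * (∑ k ∈ Finset.range (N + 1), kernelCoeff τ k s * (a 1 * T) ^ k)
          - (a 1 * T * (∑ k ∈ Finset.range (N + 1), kernelCoeff τ k (t - s) * (a 0 * T) ^ k)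
            * (∑ k ∈ Finset.range (N + 1), kernelCoeff τ k s * ((a 0 + a 1) * T) ^ k)
          + a 0 * T * (∑ k ∈ Finset.range (N + 1), kernelCoeff τ k (s - t) * (a 1 * T) ^ k)
            * (∑ k ∈ Finset.range (N + 1), kernelCoeff τ k t * ((a 0 + a 1) * T) ^ k)) := by
      intro T
      simp only [P, p, X, Y, map_sub, map_add, map_mul, map_sum, map_pow, MvPolynomial.smul_eval,
        MvPolynomial.eval_X, add_mul]
    simp only [e]
    have c : ∀ (z α : ℂ), (fun T : ℂ => ∑ k ∈ Finset.range (N + 1),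
        kernelCoeff τ k z * (α * T) ^ k) =O[𝓝 0] fun _ => (1 : ℂ) := fun z α =>
      continuous_isBigO_one (by fun_prop)
    have hterm : ∀ (z w α β γ : ℂ), theta τ z ≠ 0 → theta τ w ≠ 0 →
        (fun T : ℂ => γ * T * (∑ k ∈ Finset.range (N + 1), kernelCoeff τ k z * (α * T) ^ k)
            * (∑ k ∈ Finset.range (N + 1), kernelCoeff τ k w * (β * T) ^ k)
          - γ * T * eisensteinKroneckerReg τ z (α * T) * eisensteinKroneckerReg τ w (β * T))
        =O[𝓝 0] fun T => T ^ (N + 1) := by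
      intro z w α β γ hz hw
      have h1 := mul_sub_mul_isBigO (kernel_taylor_comp τ hz N α) (kernel_taylor_comp τ hw N β)
        (kernel_comp_isBigO_one τ hz α) (c w β)
      have h2 := (continuous_isBigO_one (f := fun T => -(γ * T)) (by fun_prop)).mul h1
      simp only [one_mul] at h2
      exact h2.congr_left fun T => by ring
    have h0 : (fun T : ℂ => (a 0 + a 1) * T * eisensteinKroneckerReg τ t (a 0 * T)
          * eisensteinKroneckerReg τ s (a 1 * T)
        - (a 1 * T * eisensteinKroneckerReg τ (t - s) (a 0 * T)
            * eisensteinKroneckerReg τ s ((a 0 + a 1) * T)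
          + a 0 * T * eisensteinKroneckerReg τ (s - t) (a 1 * T)
            * eisensteinKroneckerReg τ t ((a 0 + a 1) * T)))
        =O[𝓝 0] fun T => T ^ (N + 1) := by
      have hT : Tendsto (fun T : ℂ => (a 0 * T, a 1 * T)) (𝓝 0) (𝓝 0) := by
        have : Continuous fun T : ℂ => (a 0 * T, a 1 * T) := by fun_prop
        have h := this.tendsto 0
        simpa only [mul_zero] using! h
      refine Asymptotics.IsBigO.congr' (Asymptotics.isBigO_zero _ _) ?_ EventuallyEq.rfl
      filter_upwards [hT.eventually (eisensteinKroneckerReg_fay τ ht hs hts)] with T h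
      simp only [← add_mul] at h
      rw [h, sub_self]
    have := (((hterm t s (a 0) (a 1) (a 0 + a 1) ht hs).sub
      ((hterm (t - s) s (a 0) (a 0 + a 1) (a 1) hts hs).add
        (hterm (s - t) t (a 1) (a 0 + a 1) (a 0) hst ht)))).add h0
    exact this.congr_left fun T => by ring
  simp only [P, map_sub, map_add, map_mul, hp, hX, hY, sub_eq_zero] at key
  simp only [map_mul, map_add, kerSeries, truncMap_genSeriesOne hx, truncMap_genSeriesOne hy,
    truncMap_genSeriesOne hxy]
  exact key

end PowerSeries

end EllipticPolylog

end

noncomputable section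
namespace EllipticPolylog
open Filter Topology MeasureTheory Set

/-! ### A zeta integral -/

theorem mellin_one_div_exp_sub_one {n : ℕ} (hn : 1 ≤ n) :
    ∫ t in Ioi (0 : ℝ), (t : ℂ) ^ n * ((Real.exp t - 1)⁻¹ : ℝ)
      = n.factorial * riemannZeta (n + 1 : ℕ) := by
  -- Geometric expansion of `1 / (e^t - 1)`. The Mellin transform at `n + 1` is then taken term by
  -- term and gives the Dirichlet series of zeta.
  have hF : ∀ t ∈ Ioi (0 : ℝ), HasSum (fun i : ℕ => (1 : ℂ) * Real.exp (-((i : ℝ) + 1) * t))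
      (((Real.exp t - 1)⁻¹ : ℝ) : ℂ) := by
    intro t ht
    have h1 : Real.exp (-t) < 1 := Real.exp_lt_one_iff.2 (neg_lt_zero.2 ht)
    have h2 := (hasSum_geometric_of_lt_one (Real.exp_pos _).le h1).mul_left (Real.exp (-t))
    have h3 : Real.exp (-t) * (1 - Real.exp (-t))⁻¹ = (Real.exp t - 1)⁻¹ := by
      have h4 : Real.exp t * Real.exp (-t) = 1 := by rw [← Real.exp_add]; simp
      have h5 : 1 - Real.exp (-t) ≠ 0 := by linarith
      have h6 : Real.exp t - 1 ≠ 0 := by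
        have := Real.one_lt_exp_iff.2 ht
        linarith
      field_simp
      linear_combination h4
    rw [h3] at h2
    refine (Complex.hasSum_ofReal.2 h2).congr_fun fun i => ?_
    rw [one_mul, ← Real.exp_nat_mul, ← Real.exp_add]
    congr 2
    ring
  have hsum : Summable fun i : ℕ => ‖(1 : ℂ)‖ / ((i : ℝ) + 1) ^ ((n : ℂ) + 1).re := by
    have := (summable_nat_add_iff 1).2 (Real.summable_one_div_nat_rpow (p := (n : ℝ) + 1).2
      (by have : (1 : ℝ) ≤ n := by exact_mod_cast hn
          linarith))
    simpa using this
  have h := hasSum_mellin (a := fun _ : ℕ => (1 : ℂ)) (p := fun i => (i : ℝ) + 1)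
    (F := fun t => (((Real.exp t - 1)⁻¹ : ℝ) : ℂ)) (s := (n : ℂ) + 1)
    (fun i => Or.inr (by positivity)) (by simp; positivity) hF hsum
  have h1 : mellin (fun t => (((Real.exp t - 1)⁻¹ : ℝ) : ℂ)) ((n : ℂ) + 1)
      = ∫ t in Ioi (0 : ℝ), (t : ℂ) ^ n * ((Real.exp t - 1)⁻¹ : ℝ) := by
    rw [mellin]
    simp only [add_sub_cancel_right, Complex.cpow_natCast, smul_eq_mul]
  rw [← h1, ← h.tsum_eq, Complex.Gamma_nat_eq_factorial,
    zeta_eq_tsum_one_div_nat_add_one_cpow (by simp; omega), ← tsum_mul_left]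
  refine tsum_congr fun i => ?_
  push_cast
  ring

theorem riemannZeta_factorial_ne_zero {n : ℕ} (hn : 1 ≤ n) :
    (n.factorial : ℂ) * riemannZeta (n + 1 : ℕ) ≠ 0 := by
  refine mul_ne_zero (by exact_mod_cast n.factorial_ne_zero)
    (riemannZeta_ne_zero_of_one_lt_re ?_)
  have : (1 : ℝ) ≤ n := by exact_mod_cast hn
  push_cast
  simp
  omega

theorem image_exp_neg_Ioi : (fun t : ℝ => Real.exp (-t)) '' Ioi 0 = Ioo 0 1 := by
  ext s
  constructor
  · rintro ⟨t, ht, rfl⟩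
    exact ⟨Real.exp_pos _, Real.exp_lt_one_iff.2 (neg_lt_zero.2 ht)⟩
  · rintro ⟨h0, h1⟩
    exact ⟨-Real.log s, neg_pos.2 (Real.log_neg h0 h1), by simp [Real.exp_log h0]⟩

/-- The substitution `s = exp (-t)` reduces this to the preceding Mellin integral. It is the only
source of zeta values in the theorem. -/
theorem integral_log_pow_div_one_sub {n : ℕ} (hn : 1 ≤ n) :
    ∫ s in (0 : ℝ)..1, (Real.log s : ℂ) ^ n / (1 - s)
      = (-1) ^ n * n.factorial * riemannZeta (n + 1 : ℕ) := by
  rw [intervalIntegral.integral_of_le zero_le_one, integral_Ioc_eq_integral_Ioo,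
    ← image_exp_neg_Ioi,
    integral_image_eq_integral_abs_deriv_smul (f' := fun t => -Real.exp (-t)) measurableSet_Ioi
      (fun t _ => by simpa using ((hasDerivAt_neg t).exp).hasDerivWithinAt)
      (fun a _ b _ h => by simpa using h), mul_assoc, ← mellin_one_div_exp_sub_one hn,
    ← integral_const_mul]
  refine setIntegral_congr_fun measurableSet_Ioi fun t ht => ?_
  have h1 := Real.one_lt_exp_iff.2 ht
  have h2 : (Real.exp t : ℂ) - 1 ≠ 0 := by
    have : Real.exp t - 1 ≠ 0 := by linarith
    exact_mod_cast this
  have h3 : (Real.exp t : ℂ) * Real.exp (-t) = 1 := by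
    rw [← Complex.ofReal_mul, ← Real.exp_add]; simp
  have h4 : (1 : ℂ) - Real.exp (-t) ≠ 0 := by
    intro h
    apply h2
    linear_combination (Real.exp t : ℂ) * h + h3
  simp only [abs_neg, abs_of_pos (Real.exp_pos _), Real.log_exp, Complex.real_smul]
  push_cast at h2 h3 h4 ⊢
  rw [neg_pow]
  field_simp
  linear_combination (t : ℂ) ^ n * h3

/-- The integral of a non-integrable function is `0` by convention, whereas the value computed above
is nonzero because `ζ(n + 1) ≠ 0`. -/
theorem intervalIntegrable_log_pow_div_one_sub {n : ℕ} (hn : 1 ≤ n) :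
    IntervalIntegrable (fun s : ℝ => (Real.log s : ℂ) ^ n / (1 - s)) volume 0 1 := by
  by_contra h
  have h1 := integral_log_pow_div_one_sub hn
  rw [intervalIntegral.integral_undef h, mul_assoc] at h1
  exact mul_ne_zero (by simp) (riemannZeta_factorial_ne_zero hn) h1.symm

end EllipticPolylog

end

noncomputable section
namespace EllipticPolylog
open Filter Topology MeasureTheory Set

/-! ### Logarithmic asymptotics at `0` -/

/-- The logarithm `log(-2πit)`. -/
def tlog (t : ℝ) : ℂ := Complex.log (-2 * Real.pi * Complex.I * (t : ℂ))

/-- Scaling by a positive number does not change the argument, so the principal branch causes no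
correction term. -/
theorem tlog_mul {s t : ℝ} (hs : 0 < s) (ht : 0 < t) : tlog (t * s) = tlog t + Real.log s := by
  have h : (-2 * Real.pi * Complex.I * (t : ℂ)) ≠ 0 := by
    have := Real.pi_ne_zero
    have := ht.ne'
    simp [*]
  rw [tlog, tlog, show (-2 * Real.pi * Complex.I * ((t * s : ℝ) : ℂ))
    = (s : ℂ) * (-2 * Real.pi * Complex.I * (t : ℂ)) by push_cast; ring,
    Complex.log_ofReal_mul hs h, add_comm]

theorem tlog_eq {t : ℝ} (ht : 0 < t) : tlog t = tlog 1 + Real.log t := by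
  rw [← tlog_mul ht one_pos, one_mul]

theorem hasDerivAt_tlog {t : ℝ} (ht : 0 < t) : HasDerivAt tlog (1 / t : ℂ) t := by
  have h1 : HasDerivAt (fun t : ℝ => tlog 1 + (Real.log t : ℂ)) (1 / t : ℂ) t := by
    have := ((Real.hasDerivAt_log ht.ne').ofReal_comp).const_add (tlog 1)
    simpa using this
  refine h1.congr_of_eventuallyEq ?_
  filter_upwards [lt_mem_nhds ht] with s hs using tlog_eq hs

theorem hasDerivAt_eval_tlog (P : Polynomial ℂ) {t : ℝ} (ht : 0 < t) :
    HasDerivAt (fun t => P.eval (tlog t)) (P.derivative.eval (tlog t) / t) t := by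
  have := (P.hasDerivAt (tlog t)).comp t (hasDerivAt_tlog ht)
  rw [mul_one_div] at this
  exact this

theorem continuousOn_eval_tlog (P : Polynomial ℂ) :
    ContinuousOn (fun t => P.eval (tlog t)) (Ioi 0) := fun _ ht =>
  (hasDerivAt_eval_tlog P ht).continuousAt.continuousWithinAt

theorem rpow_isBigO_rpow {a b : ℝ} (h : b ≤ a) :
    (fun t : ℝ => t ^ a) =O[𝓝[>] 0] fun t => t ^ b := by
  refine Asymptotics.IsBigO.of_bound 1 ?_
  filter_upwards [Ioo_mem_nhdsGT (zero_lt_one' ℝ)] with t ht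
  rw [one_mul, Real.norm_of_nonneg (Real.rpow_nonneg ht.1.le _),
    Real.norm_of_nonneg (Real.rpow_nonneg ht.1.le _)]
  exact Real.rpow_le_rpow_of_exponent_ge ht.1 ht.2.le h

theorem tlog_isBigO {a : ℝ} (ha : a < 0) : tlog =O[𝓝[>] 0] fun t : ℝ => t ^ a := by
  have h1 : (fun t : ℝ => (tlog 1 : ℂ)) =O[𝓝[>] 0] fun t : ℝ => t ^ a := by
    have := (Asymptotics.isBigO_const_const (tlog 1) (one_ne_zero' ℝ) (𝓝[>] (0 : ℝ)))
    refine this.trans ?_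
    simpa using rpow_isBigO_rpow (a := 0) ha.le
  have h2 : (fun t : ℝ => (Real.log t : ℂ)) =O[𝓝[>] 0] fun t : ℝ => t ^ a := by
    refine Asymptotics.IsBigO.of_norm_left ?_
    simp only [Complex.norm_real]
    exact ((isLittleO_log_rpow_nhdsGT_zero ha).isBigO).norm_left
  refine (h1.add h2).congr' ?_ EventuallyEq.rfl
  filter_upwards [self_mem_nhdsWithin] with t ht using (tlog_eq ht).symm

theorem tlog_pow_isBigO (n : ℕ) {a : ℝ} (ha : a < 0) :
    (fun t => tlog t ^ n) =O[𝓝[>] 0] fun t : ℝ => t ^ a := by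
  rcases Nat.eq_zero_or_pos n with rfl | hn
  · have := (Asymptotics.isBigO_const_const (1 : ℂ) (one_ne_zero' ℝ) (𝓝[>] (0 : ℝ)))
    simp only [pow_zero]
    refine this.trans ?_
    simpa using rpow_isBigO_rpow (a := 0) ha.le
  · have hn' : (0 : ℝ) < n := by exact_mod_cast hn
    have := (tlog_isBigO (a := a / n) (div_neg_of_neg_of_pos ha hn')).pow n
    refine this.congr' EventuallyEq.rfl ?_
    filter_upwards [self_mem_nhdsWithin] with t ht
    rw [← Real.rpow_natCast, ← Real.rpow_mul (le_of_lt ht), div_mul_cancel₀ _ hn'.ne']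

theorem eval_tlog_isBigO (P : Polynomial ℂ) {a : ℝ} (ha : a < 0) :
    (fun t => P.eval (tlog t)) =O[𝓝[>] 0] fun t : ℝ => t ^ a := by
  simp only [Polynomial.eval_eq_sum_range]
  exact Asymptotics.IsBigO.fun_sum fun n _ => (tlog_pow_isBigO n ha).const_mul_left _

/-- `f` is bounded by a positive power of `t` as `t → 0⁺`. -/
def Negl (f : ℝ → ℂ) : Prop := ∃ δ : ℝ, 0 < δ ∧ f =O[𝓝[>] 0] fun t => t ^ δ

theorem Negl.zero : Negl fun _ => 0 := ⟨1, one_pos, Asymptotics.isBigO_zero _ _⟩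

theorem Negl.of_isBigO {f g : ℝ → ℂ} (hg : Negl g) (h : f =O[𝓝[>] 0] g) : Negl f := by
  obtain ⟨δ, hδ, hg⟩ := hg
  exact ⟨δ, hδ, h.trans hg⟩

theorem Negl.congr' {f g : ℝ → ℂ} (hg : Negl g) (h : g =ᶠ[𝓝[>] 0] f) : Negl f :=
  hg.of_isBigO h.symm.isBigO

theorem Negl.add {f g : ℝ → ℂ} (hf : Negl f) (hg : Negl g) : Negl fun t => f t + g t := by
  obtain ⟨δ, hδ, hf⟩ := hf
  obtain ⟨η, hη, hg⟩ := hg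
  exact ⟨min δ η, lt_min hδ hη, (hf.trans (rpow_isBigO_rpow (min_le_left _ _))).add
    (hg.trans (rpow_isBigO_rpow (min_le_right _ _)))⟩

theorem Negl.neg {f : ℝ → ℂ} (hf : Negl f) : Negl fun t => -f t := by
  obtain ⟨δ, hδ, hf⟩ := hf
  exact ⟨δ, hδ, hf.neg_left⟩

theorem Negl.sub {f g : ℝ → ℂ} (hf : Negl f) (hg : Negl g) : Negl fun t => f t - g t := by
  simpa only [sub_eq_add_neg] using hf.add hg.neg

theorem Negl.sum {ι : Type*} {s : Finset ι} {f : ι → ℝ → ℂ} (h : ∀ i ∈ s, Negl (f i)) :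
    Negl fun t => ∑ i ∈ s, f i t := by
  classical
  induction s using Finset.induction_on with
  | empty => simpa using Negl.zero
  | insert i s hi ih =>
    simp only [Finset.sum_insert hi]
    exact (h i (Finset.mem_insert_self _ _)).add
      (ih fun j hj => h j (Finset.mem_insert_of_mem hj))

/-- `f` grows slower than any negative power of `t` as `t → 0⁺`. -/
def Subpoly (f : ℝ → ℂ) : Prop := ∀ a : ℝ, a < 0 → f =O[𝓝[>] 0] fun t => t ^ a

theorem Negl.mul {f g : ℝ → ℂ} (hf : Negl f) (hg : Subpoly g) : Negl fun t => f t * g t := by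
  obtain ⟨δ, hδ, hf⟩ := hf
  refine ⟨δ / 2, by positivity, (hf.mul (hg (-(δ / 2)) (by linarith))).congr' EventuallyEq.rfl ?_⟩
  filter_upwards [self_mem_nhdsWithin] with t ht
  rw [← Real.rpow_add ht]
  congr 1
  ring

theorem subpoly_eval (P : Polynomial ℂ) : Subpoly fun t => P.eval (tlog t) := fun _ ha =>
  eval_tlog_isBigO P ha

theorem Subpoly.of_isBigO_one {f : ℝ → ℂ} (h : f =O[𝓝[>] 0] fun _ => (1 : ℝ)) : Subpoly f :=
  fun a ha => h.trans (by simpa using rpow_isBigO_rpow (a := 0) ha.le)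

theorem Negl.subpoly {f : ℝ → ℂ} (hf : Negl f) : Subpoly f := by
  obtain ⟨δ, hδ, hf⟩ := hf
  exact fun a ha => hf.trans (rpow_isBigO_rpow (by linarith))

theorem Subpoly.add {f g : ℝ → ℂ} (hf : Subpoly f) (hg : Subpoly g) :
    Subpoly fun t => f t + g t := fun a ha => (hf a ha).add (hg a ha)

theorem Subpoly.congr' {f g : ℝ → ℂ} (hg : Subpoly g) (h : g =ᶠ[𝓝[>] 0] f) : Subpoly f :=
  fun a ha => h.symm.isBigO.trans (hg a ha)

theorem negl_ofReal : Negl fun t => (t : ℂ) :=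
  ⟨1, one_pos, Asymptotics.IsBigO.of_norm_left (by
    simp only [Complex.norm_real, Real.rpow_one]
    exact (Asymptotics.isBigO_refl _ _).norm_left)⟩

theorem tendsto_norm_tlog : Tendsto (fun t => ‖tlog t‖) (𝓝[>] 0) atTop := by
  have h1 : Tendsto (fun t : ℝ => |Real.log t| - ‖tlog 1‖) (𝓝[>] 0) atTop :=
    tendsto_atTop_add_const_right _ _ (tendsto_abs_atBot_atTop.comp Real.tendsto_log_nhdsGT_zero)
  refine tendsto_atTop_mono' _ ?_ h1
  filter_upwards [self_mem_nhdsWithin] with t ht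
  rw [tlog_eq ht, ← Real.norm_eq_abs, ← Complex.norm_real]
  have := norm_sub_norm_le (Real.log t : ℂ) (-tlog 1)
  rw [norm_neg, sub_neg_eq_add, add_comm (Real.log t : ℂ)] at this
  exact this

theorem Negl.tendsto {f : ℝ → ℂ} (hf : Negl f) : Tendsto f (𝓝[>] 0) (𝓝 0) := by
  obtain ⟨δ, hδ, hf⟩ := hf
  refine hf.trans_tendsto ?_
  have := (Real.continuousAt_rpow_const 0 δ (Or.inr hδ.le)).tendsto
  rw [Real.zero_rpow hδ.ne'] at this
  exact this.mono_left nhdsWithin_le_nhds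

/-- A nonconstant polynomial in `tlog` is unbounded at `0`, and a nonzero constant does not tend to
`0`. Uniqueness of logarithmic expansions, and so of regularized values, rests on this. -/
theorem eq_zero_of_negl_eval {P : Polynomial ℂ} (h : Negl fun t => P.eval (tlog t)) : P = 0 := by
  have h0 := h.tendsto
  rcases lt_or_ge 0 P.degree with hd | hd
  · exact absurd h0.norm (not_tendsto_nhds_of_tendsto_atTop
      (P.tendsto_norm_atTop hd tendsto_norm_tlog) _)
  · rw [Polynomial.eq_C_of_degree_le_zero hd] at h0 ⊢
    simp only [Polynomial.eval_C] at h0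
    rw [tendsto_nhds_unique tendsto_const_nhds h0, Polynomial.C_0]

theorem hasRegValue_iff {f : ℝ → ℂ} {c : ℂ} :
    HasRegValue f c ↔ ∃ P : Polynomial ℂ, P.coeff 0 = c ∧ Negl fun t => f t - P.eval (tlog t) := by
  constructor
  · rintro ⟨N, coeff, δ, hδ, hc, h⟩
    refine ⟨∑ n ∈ Finset.range (N + 1), Polynomial.monomial n (coeff n), ?_, δ, hδ, ?_⟩
    · rw [Polynomial.finsetSum_coeff]
      simp [Polynomial.coeff_monomial, hc]
    · simpa [Polynomial.eval_finsetSum, tlog] using h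
  · rintro ⟨P, hP, δ, hδ, h⟩
    refine ⟨P.natDegree, P.coeff, δ, hδ, hP, ?_⟩
    simpa [Polynomial.eval_eq_sum_range, tlog] using h

theorem HasRegValue.unique {f : ℝ → ℂ} {c d : ℂ} (hc : HasRegValue f c) (hd : HasRegValue f d) :
    c = d := by
  obtain ⟨P, rfl, hP⟩ := hasRegValue_iff.1 hc
  obtain ⟨Q, rfl, hQ⟩ := hasRegValue_iff.1 hd
  have h : Negl fun t => (P - Q).eval (tlog t) := by
    refine (hQ.sub hP).congr' (Eventually.of_forall fun t => ?_)
    simp only [Polynomial.eval_sub]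
    ring
  rw [sub_eq_zero.1 (eq_zero_of_negl_eval h)]

theorem regValue_eq {f : ℝ → ℂ} {c : ℂ} (h : HasRegValue f c) : regValue f = c := by
  have h1 : ∃ c, HasRegValue f c := ⟨c, h⟩
  rw [regValue, dif_pos h1]
  exact h1.choose_spec.unique h

end EllipticPolylog

end

noncomputable section
namespace EllipticPolylog
open Filter Topology MeasureTheory Set

/-! ### Functions with logarithmic expansions and their regularized primitives -/

/-- The asymptotic bound near `0` and compactness on the rest combine into one constant. The
condition `b < 1` keeps away from the right endpoint, where continuity is not assumed. -/
theorem exists_bound_Ioc {F : ℝ → ℂ} {a : ℝ} (hF : ContinuousOn F (Ioo 0 1))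
    (h : F =O[𝓝[>] 0] fun t => t ^ a) {b : ℝ} (hb : b < 1) :
    ∃ C, 0 < C ∧ ∀ t ∈ Ioc 0 b, ‖F t‖ ≤ C * t ^ a := by
  obtain ⟨c, hc⟩ := h.bound
  obtain ⟨r, hr, hr'⟩ := mem_nhdsGT_iff_exists_Ioo_subset.1 hc
  have hr0 : 0 < r := hr
  have hcomp : ContinuousOn (fun t => ‖F t‖ / t ^ a) (Icc (r / 2) b) := by
    refine ContinuousOn.div (hF.mono fun t ht => ⟨by linarith [ht.1], by linarith [ht.2]⟩).norm ?_ ?_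
    · exact fun t ht => (Real.continuousAt_rpow_const t a
        (Or.inl (by linarith [ht.1] : (0 : ℝ) < t).ne')).continuousWithinAt
    · exact fun t ht => (Real.rpow_pos_of_pos (by linarith [ht.1]) a).ne'
  obtain ⟨M, hM⟩ := isCompact_Icc.exists_bound_of_continuousOn hcomp
  refine ⟨max 1 (max c M), by positivity, fun t ht => ?_⟩
  have hpos := Real.rpow_pos_of_pos ht.1 a
  rcases lt_or_ge t r with h1 | h1
  · have h2 : ‖F t‖ ≤ c * ‖t ^ a‖ := hr' ⟨ht.1, h1⟩
    rw [Real.norm_of_nonneg hpos.le] at h2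
    exact h2.trans (mul_le_mul_of_nonneg_right
      ((le_max_left _ _).trans (le_max_right _ _)) hpos.le)
  · have h2 := hM t ⟨by linarith, ht.2⟩
    rw [Real.norm_of_nonneg (by positivity), div_le_iff₀ hpos] at h2
    exact h2.trans (mul_le_mul_of_nonneg_right
      ((le_max_right _ _).trans (le_max_right _ _)) hpos.le)

theorem intervalIntegrable_rpow_bound {F : ℝ → ℂ} {C a z : ℝ} (ha : -1 < a) (hz : 0 ≤ z)
    (hF : ContinuousOn F (Ioo 0 z)) (h : ∀ t ∈ Ioo 0 z, ‖F t‖ ≤ C * t ^ a) :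
    IntervalIntegrable F volume 0 z := by
  have h1 : IntervalIntegrable (fun t : ℝ => C * t ^ a) volume 0 z :=
    (intervalIntegral.intervalIntegrable_rpow' ha).const_mul C
  rw [intervalIntegrable_iff_integrableOn_Ioo_of_le hz] at h1 ⊢
  refine Integrable.mono' h1 (hF.aestronglyMeasurable measurableSet_Ioo) ?_
  exact (ae_restrict_iff' measurableSet_Ioo).2 (Eventually.of_forall h)

theorem norm_integral_le_rpow {F : ℝ → ℂ} {C a z : ℝ} (ha : -1 < a) (hz : 0 ≤ z)
    (h : ∀ t ∈ Ioo 0 z, ‖F t‖ ≤ C * t ^ a) :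
    ‖∫ t in (0 : ℝ)..z, F t‖ ≤ C / (a + 1) * z ^ (a + 1) := by
  have h1 : IntervalIntegrable (fun t : ℝ => C * t ^ a) volume 0 z :=
    (intervalIntegral.intervalIntegrable_rpow' ha).const_mul C
  have h2 : ∀ᵐ t : ℝ, t ∈ Ioc 0 z → ‖F t‖ ≤ C * t ^ a := by
    have : ∀ᵐ t : ℝ, t ≠ z := by simp [ae_iff, measure_singleton]
    filter_upwards [this] with t ht h3
    exact h t ⟨h3.1, lt_of_le_of_ne h3.2 ht⟩
  refine (intervalIntegral.norm_integral_le_of_norm_le hz h2 h1).trans (le_of_eq ?_)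
  rw [intervalIntegral.integral_const_mul, integral_rpow (Or.inl ha),
    Real.zero_rpow (by linarith), sub_zero]
  ring

/-- `g` is continuously differentiable on `(0, 1)` with derivative `g'`, and it is a polynomial
in `log(-2πit)` up to a positive power of `t` at `0`, as is `t g'(t)`. -/
structure LogFun (g g' : ℝ → ℂ) (P : Polynomial ℂ) : Prop where
  hasDerivAt : ∀ t ∈ Ioo (0 : ℝ) 1, HasDerivAt g (g' t) t
  continuousOn' : ContinuousOn g' (Ioo 0 1)
  asymp : Negl fun t => g t - P.eval (tlog t)
  asymp' : Negl fun t => t * g' t - P.derivative.eval (tlog t)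

theorem LogFun.continuousOn {g g' : ℝ → ℂ} {P : Polynomial ℂ} (hg : LogFun g g' P) :
    ContinuousOn g (Ioo 0 1) := fun t ht => (hg.hasDerivAt t ht).continuousAt.continuousWithinAt

theorem LogFun.const (c : ℂ) : LogFun (fun _ => c) (fun _ => 0) (Polynomial.C c) where
  hasDerivAt _ _ := hasDerivAt_const _ _
  continuousOn' := continuousOn_const
  asymp := by simpa using Negl.zero
  asymp' := by simpa using Negl.zero

theorem LogFun.sub {g g' h h' : ℝ → ℂ} {P Q : Polynomial ℂ} (hg : LogFun g g' P)
    (hh : LogFun h h' Q) : LogFun (fun t => g t - h t) (fun t => g' t - h' t) (P - Q) where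
  hasDerivAt t ht := (hg.hasDerivAt t ht).sub (hh.hasDerivAt t ht)
  continuousOn' := hg.continuousOn'.sub hh.continuousOn'
  asymp := (hg.asymp.sub hh.asymp).congr' (Eventually.of_forall fun t => by
    simp only [Polynomial.eval_sub]; ring)
  asymp' := (hg.asymp'.sub hh.asymp').congr' (Eventually.of_forall fun t => by
    simp only [Polynomial.derivative_sub, Polynomial.eval_sub]; ring)

theorem LogFun.subpoly {g g' : ℝ → ℂ} {P : Polynomial ℂ} (hg : LogFun g g' P) : Subpoly g :=
  (hg.asymp.subpoly.add (subpoly_eval P)).congr' (Eventually.of_forall fun t => by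
    simp only [sub_add_cancel])

theorem LogFun.exists_bound {g g' : ℝ → ℂ} {P : Polynomial ℂ} (hg : LogFun g g' P) {b a : ℝ}
    (hb : b < 1) (ha : a < 0) : ∃ C, 0 < C ∧ ∀ t ∈ Ioc 0 b, ‖g t‖ ≤ C * t ^ a :=
  exists_bound_Ioc hg.continuousOn (hg.subpoly a ha) hb

/-- A continuous function with a logarithmic expansion has a primitive with any prescribed
compatible logarithmic expansion. -/
theorem exists_logFun {w : ℝ → ℂ} {Q : Polynomial ℂ} (hw : ContinuousOn w (Ioo 0 1))
    (h : Negl fun t => t * w t - Q.derivative.eval (tlog t)) : ∃ p, LogFun p w Q := by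
  -- Removing the derivative of `Q(tlog t)` leaves a remainder `O(t ^ (δ - 1))`. It is integrable at
  -- `0`, and its primitive from `0` is `O(t ^ δ)`.
  set e : ℝ → ℂ := fun t => w t - Q.derivative.eval (tlog t) / t with he
  have hecont : ContinuousOn e (Ioo 0 1) := by
    refine hw.sub (((continuousOn_eval_tlog _).mono Ioo_subset_Ioi_self).div
      Complex.continuous_ofReal.continuousOn fun t ht => ?_)
    exact_mod_cast ht.1.ne'
  obtain ⟨δ, hδ, hO⟩ := id h
  have heO : e =O[𝓝[>] 0] fun t => t ^ (δ - 1) := by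
    obtain ⟨C, hC⟩ := hO.bound
    refine Asymptotics.IsBigO.of_bound C ?_
    filter_upwards [hC, self_mem_nhdsWithin] with t ht ht0
    have ht1 : (0 : ℝ) < t := ht0
    have ht2 : (t : ℂ) ≠ 0 := by exact_mod_cast ht1.ne'
    have : e t = (t * w t - Q.derivative.eval (tlog t)) / t := by
      rw [he]; field_simp
    rw [this, norm_div, Real.rpow_sub_one ht1.ne', norm_div, ← mul_div_assoc, Complex.norm_real]
    gcongr
  have hbound : ∀ b < 1, ∃ C, 0 < C ∧ ∀ t ∈ Ioc 0 b, ‖e t‖ ≤ C * t ^ (δ - 1) :=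
    fun b hb => exists_bound_Ioc hecont heO hb
  have hint : ∀ b, 0 ≤ b → b < 1 → IntervalIntegrable e volume 0 b := by
    intro b hb0 hb1
    obtain ⟨C, -, hC⟩ := hbound b hb1
    exact intervalIntegrable_rpow_bound (by linarith) hb0
      (hecont.mono (Ioo_subset_Ioo_right hb1.le)) fun t ht => hC t (Ioo_subset_Ioc_self ht)
  refine ⟨fun t => Q.eval (tlog t) + ∫ s in (0 : ℝ)..t, e s, ?_, hw, ?_, h⟩
  · intro t ht
    have h1 := intervalIntegral.integral_hasDerivAt_right (hint t ht.1.le ht.2)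
      (hecont.stronglyMeasurableAtFilter isOpen_Ioo t ht) (hecont.continuousAt (Ioo_mem_nhds ht.1 ht.2))
    have h2 := (hasDerivAt_eval_tlog Q ht.1).add h1
    rwa [show Q.derivative.eval (tlog t) / t + e t = w t by rw [he]; ring] at h2
  · obtain ⟨C, -, hC⟩ := hbound (1 / 2) (by norm_num)
    refine ⟨δ, hδ, Asymptotics.IsBigO.of_bound (C / δ) ?_⟩
    filter_upwards [Ioo_mem_nhdsGT (show (0 : ℝ) < 1 / 2 by norm_num)] with t ht
    have := norm_integral_le_rpow (F := e) (C := C) (a := δ - 1) (by linarith) ht.1.le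
      fun s hs => hC s ⟨hs.1, (hs.2.trans ht.2).le⟩
    rw [sub_add_cancel] at this
    rw [add_sub_cancel_left, Real.norm_of_nonneg (Real.rpow_nonneg ht.1.le _)]
    exact this

/-- `f(t) = κ / t + h(t)` on `(0, 1)` with `h` continuously differentiable on `(-1, 1)`. -/
def IsKernel (f : ℝ → ℂ) (κ : ℂ) : Prop :=
  ∃ h : ℝ → ℂ, ContDiffOn ℝ 1 h (Ioo (-1) 1) ∧ ∀ t ∈ Ioo (0 : ℝ) 1, f t = κ / t + h t

theorem IsKernel.contDiffOn {f : ℝ → ℂ} {κ : ℂ} (hf : IsKernel f κ) :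
    ContDiffOn ℝ 1 f (Ioo 0 1) := by
  obtain ⟨h, hh, hf⟩ := hf
  refine ContDiffOn.congr ?_ hf
  have h1 : ContDiffOn ℝ 1 (fun t : ℝ => (t : ℂ)) (Ioo 0 1) :=
    Complex.ofRealCLM.contDiff.contDiffOn
  simp only [div_eq_mul_inv]
  exact (contDiffOn_const.mul (h1.inv fun t ht => by exact_mod_cast ht.1.ne')).add
    (hh.mono (Ioo_subset_Ioo_left (by norm_num)))

theorem IsKernel.continuousOn {f : ℝ → ℂ} {κ : ℂ} (hf : IsKernel f κ) :
    ContinuousOn f (Ioo 0 1) := hf.contDiffOn.continuousOn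

theorem IsKernel.exists_bound_sub {f : ℝ → ℂ} {κ : ℂ} (hf : IsKernel f κ) {b : ℝ} (hb : b < 1) :
    ∃ C, 0 < C ∧ ∀ t ∈ Ioc 0 b, ‖f t - κ / t‖ ≤ C := by
  obtain ⟨h, hh, hf⟩ := hf
  obtain ⟨M, hM⟩ := isCompact_Icc.exists_bound_of_continuousOn
    (hh.continuousOn.mono (Icc_subset_Ioo (by norm_num : (-1 : ℝ) < 0) hb))
  refine ⟨max 1 M, by positivity, fun t ht => ?_⟩
  rw [hf t ⟨ht.1, ht.2.trans_lt hb⟩, add_sub_cancel_left]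
  exact (hM t ⟨ht.1.le, ht.2⟩).trans (le_max_right _ _)

theorem IsKernel.exists_bound {f : ℝ → ℂ} {κ : ℂ} (hf : IsKernel f κ) {b : ℝ} (hb : b < 1) :
    ∃ C, 0 < C ∧ ∀ t ∈ Ioc 0 b, ‖f t‖ ≤ C / t := by
  obtain ⟨C, hC0, hC⟩ := hf.exists_bound_sub hb
  refine ⟨C + ‖κ‖, by positivity, fun t ht => ?_⟩
  have h1 : ‖f t‖ ≤ ‖f t - κ / t‖ + ‖κ / t‖ := by
    simpa using norm_add_le (f t - κ / t) (κ / t)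
  refine h1.trans ?_
  rw [add_div]
  have ht1 : t ≤ 1 := ht.2.trans hb.le
  refine add_le_add ((hC t ht).trans ?_) ?_
  · rw [le_div_iff₀ ht.1]
    nlinarith
  · rw [norm_div, Complex.norm_real, Real.norm_of_nonneg ht.1.le]

theorem IsKernel.negl_mul {f g g' : ℝ → ℂ} {κ : ℂ} {P Q : Polynomial ℂ} (hf : IsKernel f κ)
    (hg : LogFun g g' P) (hQ : Q.derivative = Polynomial.C κ * P) :
    Negl fun t => t * (g t * f t) - Q.derivative.eval (tlog t) := by
  obtain ⟨C, hC0, hC⟩ := hf.exists_bound_sub (b := 1 / 2) (by norm_num)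
  have h1 : Subpoly fun t => f t - κ / t := by
    refine Subpoly.of_isBigO_one (Asymptotics.IsBigO.of_bound C ?_)
    filter_upwards [Ioo_mem_nhdsGT (show (0 : ℝ) < 1 / 2 by norm_num)] with t ht
    simpa using hC t ⟨ht.1, ht.2.le⟩
  have h2 := (negl_ofReal.mul h1).mul hg.subpoly
  have h3 := hg.asymp.mul (subpoly_eval (Polynomial.C κ))
  refine (h2.add h3).congr' ?_
  filter_upwards [self_mem_nhdsWithin] with t ht
  have ht1 : (t : ℂ) ≠ 0 := by exact_mod_cast (ne_of_gt ht)
  rw [hQ, Polynomial.eval_mul, Polynomial.eval_C]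
  field_simp
  ring

theorem IsKernel.exists_prim {f g g' : ℝ → ℂ} {κ : ℂ} {P Q : Polynomial ℂ} (hf : IsKernel f κ)
    (hg : LogFun g g' P) (hQ : Q.derivative = Polynomial.C κ * P) :
    ∃ p, LogFun p (fun t => g t * f t) Q :=
  exists_logFun (hg.continuousOn.mul hf.continuousOn) (hf.negl_mul hg hQ)

theorem exists_derivative_eq (P : Polynomial ℂ) :
    ∃ Q : Polynomial ℂ, Q.derivative = P ∧ Q.coeff 0 = 0 := by
  induction P using Polynomial.induction_on' with
  | add p q hp hq =>
    obtain ⟨P, hP, hP0⟩ := hp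
    obtain ⟨Q, hQ, hQ0⟩ := hq
    exact ⟨P + Q, by rw [Polynomial.derivative_add, hP, hQ], by simp [hP0, hQ0]⟩
  | monomial n a =>
    refine ⟨Polynomial.monomial (n + 1) (a / (n + 1)), ?_, by simp [Polynomial.coeff_monomial]⟩
    rw [Polynomial.derivative_monomial]
    have : (n : ℂ) + 1 ≠ 0 := by exact_mod_cast n.succ_ne_zero
    congr 1
    push_cast
    field_simp

end EllipticPolylog

end

noncomputable section
namespace EllipticPolylog
open Filter Topology MeasureTheory Set

/-! ### Asymptotics of truncated iterated integrals -/

theorem norm_integral_le_of_rpow_sub_one {F : ℝ → ℂ} {C a ε t : ℝ} (ha : 0 < a) (hC : 0 ≤ C)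
    (hε : 0 < ε) (hεt : ε ≤ t) (ht : t ≤ 1) (h : ∀ s ∈ Ioc ε t, ‖F s‖ ≤ C * s ^ (a - 1)) :
    ‖∫ s in ε..t, F s‖ ≤ C / a := by
  have h1 : IntervalIntegrable (fun s : ℝ => C * s ^ (a - 1)) volume ε t :=
    (intervalIntegral.intervalIntegrable_rpow' (by linarith)).const_mul C
  refine (intervalIntegral.norm_integral_le_of_norm_le hεt
    (Eventually.of_forall h) h1).trans ?_
  rw [intervalIntegral.integral_const_mul, integral_rpow (Or.inl (by linarith)), sub_add_cancel,
    ← mul_div_assoc]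
  have h2 : t ^ a ≤ 1 := Real.rpow_le_one (hε.le.trans hεt) ht ha.le
  have h3 : 0 ≤ ε ^ a := Real.rpow_nonneg hε.le a
  gcongr
  nlinarith

theorem continuousOn_integral_Ico {w : ℝ → ℂ} {ε : ℝ} (hw : ContinuousOn w (Ico ε 1)) :
    ContinuousOn (fun t => ∫ s in ε..t, w s) (Ico ε 1) := by
  intro t ht
  have hb : (t + 1) / 2 < 1 := by linarith [ht.2]
  have hεb : ε ≤ (t + 1) / 2 := by linarith [ht.1, ht.2]
  have h1 : IntegrableOn w (uIcc ε ((t + 1) / 2)) := by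
    rw [uIcc_of_le hεb]
    exact (hw.mono (Icc_subset_Ico_right hb)).integrableOn_Icc
  have h2 := intervalIntegral.continuousOn_primitive_interval h1
  rw [uIcc_of_le hεb] at h2
  refine (h2 t ⟨ht.1, by linarith [ht.2]⟩).mono_of_mem_nhdsWithin ?_
  filter_upwards [self_mem_nhdsWithin, nhdsWithin_le_nhds
    (Iio_mem_nhds (show t < (t + 1) / 2 by linarith [ht.2]))] with s hs hs'
  exact ⟨hs.1, le_of_lt hs'⟩

/-- `J(ε, t)` is, uniformly in `t`, a polynomial in `log(-2πiε)` with coefficients depending on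
`t` and constant coefficient `g`, up to a power of `ε`. -/
structure IsTruncExp (J : ℝ → ℝ → ℂ) (g : ℝ → ℂ) : Prop where
  cont : ∀ ε, 0 < ε → ContinuousOn (J ε) (Ico ε 1)
  exp : ∃ (N : ℕ) (gs gs' : ℕ → ℝ → ℂ) (Ps : ℕ → Polynomial ℂ),
    (∀ j, LogFun (gs j) (gs' j) (Ps j)) ∧ gs 0 = g ∧
    ∀ b < 1, ∃ C δ : ℝ, 0 < C ∧ 0 < δ ∧ ∀ ε t, 0 < ε → ε ≤ t → t ≤ b →
      ‖J ε t - ∑ j ∈ Finset.range (N + 1), tlog ε ^ j * gs j t‖ ≤ C * ε ^ δ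

theorem isTruncExp_one : IsTruncExp (fun _ _ => 1) fun _ => 1 where
  cont _ _ := continuousOn_const
  exp := ⟨0, fun _ _ => 1, fun _ _ => 0, fun _ => Polynomial.C 1, fun _ => LogFun.const 1, rfl,
    fun b _ => ⟨1, 1, one_pos, one_pos, fun ε t hε _ _ => by simp [hε.le]⟩⟩

theorem continuousOn_tlog : ContinuousOn tlog (Ioi 0) := fun _ ht =>
  (hasDerivAt_tlog ht).continuousAt.continuousWithinAt

/-- The expansion is integrated term by term: `∫_ε^t g_j f = q_j(t) - q_j(ε)` with `q_j` a primitive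
having logarithmic expansion `R_j`. Up to a power of `ε` the lower limit contributes only the
polynomial `R_j(tlog ε)`. Since every `R_j` is chosen without constant term, the constant
coefficient of the result is the primitive `p` itself. -/
theorem IsTruncExp.step {J : ℝ → ℝ → ℂ} {g p f : ℝ → ℂ} {κ : ℂ} {Q : Polynomial ℂ}
    (hJ : IsTruncExp J g) (hf : IsKernel f κ) (hp : LogFun p (fun t => g t * f t) Q)
    (hQ : Q.coeff 0 = 0) : IsTruncExp (fun ε t => ∫ s in ε..t, J ε s * f s) p := by
  have hcont : ∀ ε, 0 < ε → ContinuousOn (fun s => J ε s * f s) (Ico ε 1) := fun ε hε =>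
    (hJ.cont ε hε).mul (hf.continuousOn.mono (Ico_subset_Ioo_left hε))
  refine ⟨fun ε hε => continuousOn_integral_Ico (hcont ε hε), ?_⟩
  obtain ⟨N, gs, gs', Ps, hgs, h0, hexp⟩ := hJ.exp
  have hex : ∀ j, ∃ (q : ℝ → ℂ) (R : Polynomial ℂ), LogFun q (fun t => gs j t * f t) R ∧
      R.coeff 0 = 0 ∧ (j = 0 → q = p) := by
    intro j
    rcases eq_or_ne j 0 with rfl | hj
    · exact ⟨p, Q, h0 ▸ hp, hQ, fun _ => rfl⟩
    · obtain ⟨R, hR, hR0⟩ := exists_derivative_eq (Polynomial.C κ * Ps j)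
      obtain ⟨q, hq⟩ := hf.exists_prim (hgs j) hR
      exact ⟨q, R, hq, hR0, fun h => absurd h hj⟩
  choose q R hq hR0 hqp using hex
  -- All contributions of the lower limit, collected as one polynomial in `tlog ε`.
  set S : Polynomial ℂ := ∑ j ∈ Finset.range (N + 1), Polynomial.X ^ j * R j with hS
  have hS0 : S.coeff 0 = 0 := by
    rw [hS, Polynomial.finsetSum_coeff]
    refine Finset.sum_eq_zero fun j _ => ?_
    rw [Polynomial.mul_coeff_zero, hR0, mul_zero]
  have hSe : ∀ ε, S.eval (tlog ε)
      = ∑ j ∈ Finset.range (N + 1), tlog ε ^ j * (R j).eval (tlog ε) := by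
    intro ε
    simp [hS, Polynomial.eval_finsetSum]
  have hlog : ∀ j, ∃ (r' : ℝ → ℂ) (T : Polynomial ℂ), LogFun
      (fun t => (if j ≤ N then q j else fun _ => 0) t - S.coeff j) r' T := by
    intro j
    split_ifs
    · exact ⟨_, _, (hq j).sub (LogFun.const _)⟩
    · exact ⟨_, _, (LogFun.const 0).sub (LogFun.const _)⟩
  choose r' T hr' using hlog
  -- The range `N + S.natDegree` covers both the indices of the `q j` and the degree of `S`. The `q
  -- j` are padded by zero beyond `N`.
  refine ⟨N + S.natDegree, fun j t => (if j ≤ N then q j else fun _ => 0) t - S.coeff j, r', T, hr',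
    ?_, fun b hb => ?_⟩
  · simp [hS0, hqp 0 rfl]
  have hsum : ∀ ε t, ∑ j ∈ Finset.range (N + S.natDegree + 1),
      tlog ε ^ j * ((if j ≤ N then q j else fun _ => 0) t - S.coeff j)
      = ∑ j ∈ Finset.range (N + 1), tlog ε ^ j * (q j t - (R j).eval (tlog ε)) := by
    intro ε t
    simp only [mul_sub, Finset.sum_sub_distrib]
    rw [← hSe, Polynomial.eval_eq_sum_range' (n := N + S.natDegree + 1) (by omega)]
    congr 1
    · rw [← Finset.sum_subset (Finset.range_subset_range.2 (by omega : N + 1 ≤ N + S.natDegree + 1))]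
      · exact Finset.sum_congr rfl fun j hj => by
          rw [if_pos (by have := Finset.mem_range.1 hj; omega)]
      · intro j _ hj
        rw [if_neg (by rw [Finset.mem_range] at hj; omega), mul_zero]
    · exact Finset.sum_congr rfl fun j _ => mul_comm _ _
  set E : ℝ → ℂ := fun ε => ∑ j ∈ Finset.range (N + 1),
    (q j ε - (R j).eval (tlog ε)) * tlog ε ^ j with hE
  have hEn : Negl E := by
    refine Negl.sum fun j _ => ?_
    have := (hq j).asymp.mul (subpoly_eval (Polynomial.X ^ j))
    simpa using this
  obtain ⟨η, hη, hEO⟩ := hEn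
  have hEc : ContinuousOn E (Ioo 0 1) := by
    refine continuousOn_finsetSum _ fun j _ => ?_
    exact ((hq j).continuousOn.sub ((continuousOn_eval_tlog _).mono Ioo_subset_Ioi_self)).mul
      ((continuousOn_tlog.mono Ioo_subset_Ioi_self).pow j)
  obtain ⟨C₁, hC₁, hb₁⟩ := exists_bound_Ioc hEc hEO hb
  obtain ⟨C₂, δ, hC₂, hδ, hb₂⟩ := hexp b hb
  obtain ⟨C₃, hC₃, hb₃⟩ := hf.exists_bound hb
  refine ⟨C₂ * C₃ / (δ / 2) + C₁, min (δ / 2) η, by positivity, by positivity, ?_⟩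
  intro ε t hε hεt htb
  have hε1 : ε ≤ 1 := hεt.trans (htb.trans hb.le)
  have hsub : Icc ε t ⊆ Ico ε 1 := Icc_subset_Ico_right (htb.trans_lt hb)
  have hsub' : Icc ε t ⊆ Ioo 0 1 := Icc_subset_Ioo hε (htb.trans_lt hb)
  have hint : ∀ w : ℝ → ℂ, ContinuousOn w (Icc ε t) → IntervalIntegrable w volume ε t :=
    fun w hw => (hw.mono (uIcc_of_le hεt).le).intervalIntegrable
  have hq_int : ∀ j, ∫ s in ε..t, gs j s * f s = q j t - q j ε := by
    intro j
    refine intervalIntegral.integral_eq_sub_of_hasDerivAt (fun s hs => ?_)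
      (hint _ (((hgs j).continuousOn.mul hf.continuousOn).mono hsub'))
    rw [uIcc_of_le hεt] at hs
    exact (hq j).hasDerivAt s (hsub' hs)
  have hgc : ∀ j, ContinuousOn (fun s => tlog ε ^ j * (gs j s * f s)) (Icc ε t) := fun j =>
    continuousOn_const.mul (((hgs j).continuousOn.mul hf.continuousOn).mono hsub')
  have hmain : (∫ s in ε..t, J ε s * f s) - ∑ j ∈ Finset.range (N + 1),
        tlog ε ^ j * (q j t - (R j).eval (tlog ε))
      = (∫ s in ε..t, (J ε s - ∑ j ∈ Finset.range (N + 1), tlog ε ^ j * gs j s) * f s)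
        - E ε := by
    have h1 : ∀ s, (J ε s - ∑ j ∈ Finset.range (N + 1), tlog ε ^ j * gs j s) * f s
        = J ε s * f s - ∑ j ∈ Finset.range (N + 1), tlog ε ^ j * (gs j s * f s) := by
      intro s
      rw [sub_mul, Finset.sum_mul]
      simp only [mul_assoc]
    simp only [h1]
    rw [intervalIntegral.integral_sub (hint _ ((hcont ε hε).mono hsub))
      (hint _ (continuousOn_finsetSum _ fun j _ => hgc j)),
      intervalIntegral.integral_finsetSum fun j _ => hint _ (hgc j), hE]
    simp only [intervalIntegral.integral_const_mul, hq_int]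
    rw [sub_sub, ← Finset.sum_add_distrib]
    congr 1
    exact Finset.sum_congr rfl fun j _ => by ring
  have hbd : ‖∫ s in ε..t, (J ε s - ∑ j ∈ Finset.range (N + 1), tlog ε ^ j * gs j s) * f s‖
      ≤ C₂ * C₃ * ε ^ (δ / 2) / (δ / 2) := by
    refine norm_integral_le_of_rpow_sub_one (by positivity) (by positivity) hε hεt
      (htb.trans hb.le) fun s hs => ?_
    have hs0 : 0 < s := hε.trans hs.1
    have h1 := hb₂ ε s hε hs.1.le (hs.2.trans htb)
    have h2 := hb₃ s ⟨hs0, hs.2.trans htb⟩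
    rw [norm_mul]
    refine (mul_le_mul h1 h2 (norm_nonneg _) (by positivity)).trans ?_
    -- Half of the power of `ε` is traded for a power of `s ≥ ε`. This makes the pole `1 / s` of the
    -- kernel integrable uniformly in `ε`, and the other half remains as decay.
    have h3 : ε ^ δ = ε ^ (δ / 2) * ε ^ (δ / 2) := by rw [← Real.rpow_add hε, add_halves]
    have h4 : ε ^ (δ / 2) ≤ s ^ (δ / 2) := Real.rpow_le_rpow hε.le hs.1.le (by positivity)
    rw [h3, Real.rpow_sub_one hs0.ne']
    calc C₂ * (ε ^ (δ / 2) * ε ^ (δ / 2)) * (C₃ / s)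
        = C₂ * C₃ * ε ^ (δ / 2) * (ε ^ (δ / 2) / s) := by ring
      _ ≤ C₂ * C₃ * ε ^ (δ / 2) * (s ^ (δ / 2) / s) := by gcongr
  have hm1 : ε ^ (δ / 2) ≤ ε ^ min (δ / 2) η :=
    Real.rpow_le_rpow_of_exponent_ge hε hε1 (min_le_left _ _)
  have hm2 : ε ^ η ≤ ε ^ min (δ / 2) η :=
    Real.rpow_le_rpow_of_exponent_ge hε hε1 (min_le_right _ _)
  rw [hsum, hmain]
  calc _ ≤ C₂ * C₃ * ε ^ (δ / 2) / (δ / 2) + C₁ * ε ^ η :=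
        (norm_sub_le _ _).trans (add_le_add hbd (hb₁ ε ⟨hε, hεt.trans htb⟩))
    _ = C₂ * C₃ / (δ / 2) * ε ^ (δ / 2) + C₁ * ε ^ η := by ring
    _ ≤ C₂ * C₃ / (δ / 2) * ε ^ min (δ / 2) η + C₁ * ε ^ min (δ / 2) η := by gcongr
    _ = _ := by ring

theorem negl_comp_sub {g : ℝ → ℂ} {z : ℝ} (hg : DifferentiableAt ℝ g z) :
    Negl fun ε => g (z - ε) - g z := by
  have h1 : Tendsto (fun ε : ℝ => z - ε) (𝓝 0) (𝓝 z) := by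
    have : Continuous fun ε : ℝ => z - ε := by fun_prop
    simpa using this.tendsto 0
  have h2 := (hg.isBigO_sub.comp_tendsto h1).mono (nhdsWithin_le_nhds (s := Ioi 0))
  refine ⟨1, one_pos, h2.trans ?_⟩
  refine Asymptotics.IsBigO.of_bound 1 (Eventually.of_forall fun ε => ?_)
  simp

/-- Uniformity in the upper limit allows `t = z - ε`. Replacing `z - ε` by `z` in the coefficient
functions costs `O(ε)` times powers of the logarithm, which is negligible. -/
theorem IsTruncExp.hasRegValue {J : ℝ → ℝ → ℂ} {g : ℝ → ℂ} (hJ : IsTruncExp J g) {z : ℝ}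
    (hz : z ∈ Ioo (0 : ℝ) 1) : HasRegValue (fun ε => J ε (z - ε)) (g z) := by
  obtain ⟨N, gs, gs', Ps, hgs, rfl, hexp⟩ := hJ.exp
  obtain ⟨C, δ, hC, hδ, hb⟩ := hexp z hz.2
  refine hasRegValue_iff.2 ⟨∑ j ∈ Finset.range (N + 1), Polynomial.monomial j (gs j z), ?_, ?_⟩
  · simp [Polynomial.finsetSum_coeff, Polynomial.coeff_monomial]
  have h1 : Negl fun ε => J ε (z - ε)
      - ∑ j ∈ Finset.range (N + 1), tlog ε ^ j * gs j (z - ε) := by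
    refine ⟨δ, hδ, Asymptotics.IsBigO.of_bound C ?_⟩
    filter_upwards [Ioo_mem_nhdsGT (half_pos hz.1)] with ε hε
    rw [Real.norm_of_nonneg (Real.rpow_nonneg hε.1.le _)]
    exact hb ε (z - ε) hε.1 (by linarith [hε.2]) (by linarith [hε.1])
  have h2 : Negl fun ε => ∑ j ∈ Finset.range (N + 1),
      (gs j (z - ε) - gs j z) * (Polynomial.X ^ j).eval (tlog ε) :=
    Negl.sum fun j _ => (negl_comp_sub ((hgs j).hasDerivAt z hz).differentiableAt).mul
      (subpoly_eval _)
  refine (h1.add h2).congr' (Eventually.of_forall fun ε => ?_)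
  simp only [Polynomial.eval_finsetSum, Polynomial.eval_monomial, Polynomial.eval_pow,
    Polynomial.eval_X]
  rw [sub_add, ← Finset.sum_sub_distrib]
  congr 1
  exact Finset.sum_congr rfl fun j _ => by ring

end EllipticPolylog

end

noncomputable section
namespace EllipticPolylog
open Filter Topology MeasureTheory Set

/-! ### Regularized convolutions -/

/-- The regularized convolution integral `∫_0^z g(t) φ(z - t) dt`, where `Φ` is a regularized
primitive of `φ`. -/
def convReg (g φ Φ : ℝ → ℂ) (z : ℝ) : ℂ :=
  (∫ t in (0 : ℝ)..z, (g t - g z) * φ (z - t)) + g z * Φ z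

theorem exists_lipschitz_bound {g g' : ℝ → ℂ} {a b : ℝ} (ha : 0 < a) (hb : b < 1)
    (hg : ∀ t ∈ Ioo (0 : ℝ) 1, HasDerivAt g (g' t) t) (hg' : ContinuousOn g' (Ioo 0 1)) :
    ∃ M, 0 < M ∧ ∀ s ∈ Icc a b, ∀ t ∈ Icc a b, ‖g s - g t‖ ≤ M * |s - t| := by
  have hsub : Icc a b ⊆ Ioo 0 1 := Icc_subset_Ioo ha hb
  obtain ⟨M, hM⟩ := isCompact_Icc.exists_bound_of_continuousOn (hg'.mono hsub)
  refine ⟨max 1 M, by positivity, fun s hs t ht => ?_⟩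
  exact (convex_Icc a b).norm_image_sub_le_of_norm_hasDerivWithin_le
    (fun x hx => (hg x (hsub hx)).hasDerivWithinAt)
    (fun x hx => (hM x hx).trans (le_max_right _ _)) ht hs

/-- Near `t = z` the difference `g t - g z` cancels the pole of `φ (z - t)` by a Lipschitz estimate.
Near `t = 0` only the logarithmic growth of `g` matters. The exponent `-1/2` is one convenient
choice between `-1` and `0`. -/
theorem LogFun.exists_conv_bound {g g' φ : ℝ → ℂ} {P : Polynomial ℂ} {κ : ℂ}
    (hg : LogFun g g' P) (hφ : IsKernel φ κ) {a b : ℝ} (ha : 0 < a) (hb : b < 1) :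
    ∃ C, 0 < C ∧ ∀ z ∈ Icc a b, ∀ t ∈ Ioo 0 z,
      ‖(g t - g z) * φ (z - t)‖ ≤ C * t ^ (-(1 / 2) : ℝ) := by
  obtain ⟨C₁, hC₁, h₁⟩ := hg.exists_bound hb (show (-(1 / 2) : ℝ) < 0 by norm_num)
  obtain ⟨M, hM, h₂⟩ := exists_lipschitz_bound (half_pos ha) hb hg.hasDerivAt hg.continuousOn'
  obtain ⟨C₂, hC₂, h₃⟩ := hφ.exists_bound hb
  refine ⟨4 * C₁ * C₂ / a + M * C₂, by positivity, fun z hz t ht => ?_⟩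
  have hz0 : 0 < z := ha.trans_le hz.1
  have ht1 : t ≤ 1 := ht.2.le.trans (hz.2.trans hb.le)
  have hzt : 0 < z - t := sub_pos.2 ht.2
  have hpos : 0 < t ^ (-(1 / 2) : ℝ) := Real.rpow_pos_of_pos ht.1 _
  have hφb := h₃ (z - t) ⟨hzt, by linarith [ht.1, hz.2]⟩
  rw [norm_mul, add_mul]
  rcases le_total t (a / 2) with h | h
  · refine le_trans ?_ (le_add_of_nonneg_right (by positivity))
    have e1 : ‖g t - g z‖ ≤ 2 * C₁ * t ^ (-(1 / 2) : ℝ) := by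
      have := h₁ t ⟨ht.1, ht.2.le.trans hz.2⟩
      have := h₁ z ⟨hz0, hz.2⟩
      have : z ^ (-(1 / 2) : ℝ) ≤ t ^ (-(1 / 2) : ℝ) :=
        Real.rpow_le_rpow_of_nonpos ht.1 ht.2.le (by norm_num)
      have := norm_sub_le (g t) (g z)
      nlinarith
    have e2 : ‖φ (z - t)‖ ≤ C₂ / (a / 2) :=
      hφb.trans (div_le_div_of_nonneg_left hC₂.le (by positivity) (by linarith [hz.1]))
    refine (mul_le_mul e1 e2 (norm_nonneg _) (by positivity)).trans (le_of_eq ?_)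
    field_simp
    ring
  · refine le_trans ?_ (le_add_of_nonneg_left (by positivity))
    have e1 := h₂ t ⟨h, ht.2.le.trans hz.2⟩ z ⟨by linarith [hz.1], hz.2⟩
    rw [abs_sub_comm, abs_of_pos hzt] at e1
    refine (mul_le_mul e1 hφb (norm_nonneg _) (by positivity)).trans ?_
    rw [show M * (z - t) * (C₂ / (z - t)) = M * C₂ by field_simp]
    refine le_mul_of_one_le_right (by positivity) ?_
    exact Real.one_le_rpow_of_pos_of_le_one_of_nonpos ht.1 ht1 (by norm_num)

theorem LogFun.continuousOn_conv {g g' φ : ℝ → ℂ} {P : Polynomial ℂ} {κ : ℂ}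
    (hg : LogFun g g' P) (hφ : IsKernel φ κ) {z : ℝ} (hz : z < 1) :
    ContinuousOn (fun t => (g t - g z) * φ (z - t)) (Ioo 0 z) := by
  refine ((hg.continuousOn.mono (Ioo_subset_Ioo_right hz.le)).sub continuousOn_const).mul ?_
  refine hφ.continuousOn.comp (by fun_prop) fun t ht => ⟨by linarith [ht.2], by linarith [ht.1]⟩

theorem LogFun.intervalIntegrable_conv {g g' φ : ℝ → ℂ} {P : Polynomial ℂ} {κ : ℂ}
    (hg : LogFun g g' P) (hφ : IsKernel φ κ) {z : ℝ} (hz : z ∈ Ioo (0 : ℝ) 1) :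
    IntervalIntegrable (fun t => (g t - g z) * φ (z - t)) volume 0 z := by
  obtain ⟨C, -, h⟩ := hg.exists_conv_bound hφ hz.1 hz.2
  exact intervalIntegrable_rpow_bound (by norm_num) hz.1.le (hg.continuousOn_conv hφ hz.2)
    (h z ⟨le_rfl, le_rfl⟩)

/-- The truncated convolution has a logarithmic expansion, locally uniformly in `z`. -/
theorem LogFun.exists_conv_expansion {g g' φ Φ : ℝ → ℂ} {P : Polynomial ℂ} {κ : ℂ}
    (hg : LogFun g g' P) (hφ : IsKernel φ κ)
    (hΦ : LogFun Φ φ (Polynomial.C κ * Polynomial.X)) {a b : ℝ} (ha : 0 < a) (hb : b < 1) :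
    ∃ C δ : ℝ, 0 < C ∧ 0 < δ ∧ ∀ ε z, 0 < ε → ε < a / 2 → z ∈ Icc a b →
      ‖(∫ t in ε..(z - ε), g t * φ (z - t)) - (convReg g φ Φ z - κ * g z * tlog ε)‖
        ≤ C * ε ^ δ := by
  obtain ⟨C₁, hC₁, h₁⟩ := hg.exists_conv_bound hφ ha hb
  obtain ⟨C₂, hC₂, h₂⟩ := hg.exists_bound hb (show (-1 : ℝ) < 0 by norm_num)
  obtain ⟨M, hM, h₃⟩ := exists_lipschitz_bound (half_pos ha) hb hΦ.hasDerivAt hΦ.continuousOn'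
  obtain ⟨η, hη, hO⟩ := hΦ.asymp
  obtain ⟨C₃, hC₃, h₄⟩ := exists_bound_Ioc (hΦ.continuousOn.sub
    ((continuousOn_eval_tlog _).mono Ioo_subset_Ioi_self)) hO hb
  refine ⟨2 * C₁ + C₁ * (a / 2) ^ (-(1 / 2) : ℝ) + C₂ * a ^ (-1 : ℝ) * (M + C₃), min (1 / 2) η,
    by positivity, by positivity, fun ε z hε hεa hz => ?_⟩
  have hz0 : 0 < z := ha.trans_le hz.1
  have hz1 : z < 1 := hz.2.trans_lt hb
  have hεz : ε ≤ z - ε := by linarith [hz.1]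
  have hε1 : ε ≤ 1 := by linarith
  set u : ℝ → ℂ := fun t => (g t - g z) * φ (z - t) with hu
  have hui : IntervalIntegrable u volume 0 z := hg.intervalIntegrable_conv hφ ⟨hz0, hz1⟩
  have hui' : ∀ x y, 0 ≤ x → x ≤ y → y ≤ z → IntervalIntegrable u volume x y := by
    intro x y hx hxy hy
    refine hui.mono_set ?_
    rw [uIcc_of_le hxy, uIcc_of_le hz0.le]
    exact Icc_subset_Icc hx hy
  have hsub : Icc ε (z - ε) ⊆ Ioo 0 1 := Icc_subset_Ioo hε (by linarith)
  have hφc : ContinuousOn (fun t => φ (z - t)) (Icc ε (z - ε)) :=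
    hφ.continuousOn.comp (by fun_prop) fun t ht => ⟨by linarith [ht.2], by linarith [ht.1]⟩
  have hi1 : IntervalIntegrable (fun t => g z * φ (z - t)) volume ε (z - ε) := by
    refine ContinuousOn.intervalIntegrable ?_
    rw [uIcc_of_le hεz]
    exact continuousOn_const.mul hφc
  -- Writing `g t = (g t - g z) + g z`, the constant part integrates to `g z * (Φ (z - ε) - Φ ε)`.
  -- Here `Φ ε` is `κ * tlog ε` up to a power of `ε`, which is the whole logarithmic divergence.
  have e1 : ∫ t in ε..(z - ε), g t * φ (z - t)
      = (∫ t in ε..(z - ε), u t) + g z * (Φ (z - ε) - Φ ε) := by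
    have h : ∀ t, g t * φ (z - t) = u t + g z * φ (z - t) := fun t => by rw [hu]; ring
    simp only [h]
    rw [intervalIntegral.integral_add (hui' _ _ hε.le hεz (by linarith)) hi1,
      intervalIntegral.integral_const_mul, intervalIntegral.integral_comp_sub_left (fun s => φ s) z,
      sub_sub_cancel]
    congr 2
    refine intervalIntegral.integral_eq_sub_of_hasDerivAt (fun s hs => ?_)
      (ContinuousOn.intervalIntegrable ?_)
    · rw [uIcc_of_le hεz] at hs
      exact hΦ.hasDerivAt s (hsub hs)
    · rw [uIcc_of_le hεz]
      exact hφ.continuousOn.mono hsub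
  have e2 : ∫ t in (0 : ℝ)..z, u t = (∫ t in (0 : ℝ)..ε, u t) + (∫ t in ε..(z - ε), u t)
      + ∫ t in (z - ε)..z, u t := by
    rw [intervalIntegral.integral_add_adjacent_intervals (hui' _ _ le_rfl hε.le (by linarith))
      (hui' _ _ hε.le hεz (by linarith)), intervalIntegral.integral_add_adjacent_intervals
      (hui' _ _ le_rfl (by linarith) (by linarith)) (hui' _ _ (by linarith) (by linarith) le_rfl)]
  have e3 : (∫ t in ε..(z - ε), g t * φ (z - t)) - (convReg g φ Φ z - κ * g z * tlog ε)
      = -(∫ t in (0 : ℝ)..ε, u t) - (∫ t in (z - ε)..z, u t)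
        + g z * ((Φ (z - ε) - Φ z)
          - (Φ ε - (Polynomial.C κ * Polynomial.X).eval (tlog ε))) := by
    rw [e1, convReg, e2, Polynomial.eval_mul, Polynomial.eval_C, Polynomial.eval_X]
    ring
  have b1 : ‖∫ t in (0 : ℝ)..ε, u t‖ ≤ 2 * C₁ * ε ^ (1 / 2 : ℝ) := by
    have := norm_integral_le_rpow (F := u) (C := C₁) (a := -(1 / 2)) (by norm_num) hε.le
      fun t ht => h₁ z hz t ⟨ht.1, by linarith [ht.2]⟩
    refine this.trans (le_of_eq ?_)
    rw [show (-(1 / 2) + 1 : ℝ) = 1 / 2 by norm_num]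
    ring
  have b2 : ‖∫ t in (z - ε)..z, u t‖ ≤ C₁ * (a / 2) ^ (-(1 / 2) : ℝ) * ε := by
    have h : ∀ᵐ t : ℝ, t ∈ uIoc (z - ε) z → ‖u t‖ ≤ C₁ * (a / 2) ^ (-(1 / 2) : ℝ) := by
      have : ∀ᵐ t : ℝ, t ≠ z := by simp [ae_iff, measure_singleton]
      filter_upwards [this] with t ht h3
      rw [uIoc_of_le (by linarith)] at h3
      have h5 : a / 2 ≤ t := by linarith [h3.1, hz.1]
      refine (h₁ z hz t ⟨by linarith, lt_of_le_of_ne h3.2 ht⟩).trans ?_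
      exact mul_le_mul_of_nonneg_left
        (Real.rpow_le_rpow_of_nonpos (by positivity) h5 (by norm_num)) hC₁.le
    have := intervalIntegral.norm_integral_le_of_norm_le_const_ae h
    rwa [sub_sub_cancel, abs_of_pos hε] at this
  have b3 : ‖g z‖ ≤ C₂ * a ^ (-1 : ℝ) := (h₂ z ⟨hz0, hz.2⟩).trans
    (mul_le_mul_of_nonneg_left (Real.rpow_le_rpow_of_nonpos ha hz.1 (by norm_num)) hC₂.le)
  have b4 : ‖Φ (z - ε) - Φ z‖ ≤ M * ε := by
    have := h₃ (z - ε) ⟨by linarith [hz.1], by linarith [hz.2]⟩ z ⟨by linarith [hz.1], hz.2⟩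
    rwa [sub_sub_cancel_left, abs_neg, abs_of_pos hε] at this
  have b5 := h₄ ε ⟨hε, by linarith [hz.1, hz.2]⟩
  have m1 : ε ^ (1 / 2 : ℝ) ≤ ε ^ min (1 / 2) η :=
    Real.rpow_le_rpow_of_exponent_ge hε hε1 (min_le_left _ _)
  have m2 : ε ^ η ≤ ε ^ min (1 / 2) η :=
    Real.rpow_le_rpow_of_exponent_ge hε hε1 (min_le_right _ _)
  have m3 : ε ≤ ε ^ min (1 / 2) η := by
    have := Real.rpow_le_rpow_of_exponent_ge hε hε1
      ((min_le_left (1 / 2) η).trans (by norm_num : (1 / 2 : ℝ) ≤ 1))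
    rwa [Real.rpow_one] at this
  rw [e3]
  calc _ ≤ 2 * C₁ * ε ^ (1 / 2 : ℝ) + C₁ * (a / 2) ^ (-(1 / 2) : ℝ) * ε
        + C₂ * a ^ (-1 : ℝ) * (M * ε + C₃ * ε ^ η) := by
        refine (norm_add_le _ _).trans (add_le_add ((norm_sub_le _ _).trans
          (add_le_add (by rwa [norm_neg]) b2)) ?_)
        rw [norm_mul]
        exact mul_le_mul b3 ((norm_sub_le _ _).trans (add_le_add b4 b5)) (norm_nonneg _)
          (by positivity)
    _ ≤ 2 * C₁ * ε ^ min (1 / 2) η + C₁ * (a / 2) ^ (-(1 / 2) : ℝ) * ε ^ min (1 / 2) η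
        + C₂ * a ^ (-1 : ℝ) * (M * ε ^ min (1 / 2) η + C₃ * ε ^ min (1 / 2) η) := by gcongr
    _ = _ := by ring

end EllipticPolylog

end

noncomputable section
namespace EllipticPolylog
open Filter Topology MeasureTheory Set

/-! ### Regularized limits of convolutions -/

theorem LogFun.eval_tlog (P : Polynomial ℂ) :
    LogFun (fun t => P.eval (tlog t)) (fun t => P.derivative.eval (tlog t) / t) P where
  hasDerivAt t ht := hasDerivAt_eval_tlog P ht.1
  continuousOn' := ((continuousOn_eval_tlog _).mono Ioo_subset_Ioi_self).div
    Complex.continuous_ofReal.continuousOn fun t ht => by exact_mod_cast ht.1.ne'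
  asymp := by simpa using Negl.zero
  asymp' := Negl.zero.congr' (by
    filter_upwards [self_mem_nhdsWithin] with t ht
    have ht1 : (t : ℂ) ≠ 0 := by exact_mod_cast (ne_of_gt ht)
    field_simp
    ring)

theorem isKernel_const_div (κ : ℂ) : IsKernel (fun t => κ / t) κ :=
  ⟨fun _ => 0, contDiffOn_const, fun t _ => by simp⟩

theorem IsKernel.sub_const_div {f : ℝ → ℂ} {κ : ℂ} (hf : IsKernel f κ) :
    IsKernel (fun t => f t - κ / t) 0 := by
  obtain ⟨h, hh, hf⟩ := hf
  exact ⟨h, hh, fun t ht => by simp only [hf t ht]; simp⟩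

/-- Both `g` and `t g'` are `O(t ^ δ)`, and this bounds the integrand by a constant times `z ^ δ /
z`. For `t ≤ z / 2` the kernel is at most of order `1 / z`; for `t ≥ z / 2` the mean value
inequality compensates the pole. The interval has length `z`. -/
theorem LogFun.negl_conv_of_zero {g g' φ : ℝ → ℂ} {κ : ℂ} (hg : LogFun g g' 0)
    (hφ : IsKernel φ κ) : Negl fun z => ∫ t in (0 : ℝ)..z, (g t - g z) * φ (z - t) := by
  obtain ⟨δ₁, hδ₁, hO₁⟩ := hg.asymp
  obtain ⟨δ₂, hδ₂, hO₂⟩ := hg.asymp'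
  simp only [Polynomial.derivative_zero, Polynomial.eval_zero, sub_zero] at hO₁ hO₂
  set δ := min δ₁ δ₂ with hδ
  have hδ0 : 0 < δ := lt_min hδ₁ hδ₂
  have hb : (1 / 2 : ℝ) < 1 := by norm_num
  obtain ⟨C₁, hC₁, h₁⟩ := exists_bound_Ioc hg.continuousOn
    (hO₁.trans (rpow_isBigO_rpow (min_le_left _ _))) hb
  obtain ⟨C₂, hC₂, h₂⟩ := exists_bound_Ioc
    (Complex.continuous_ofReal.continuousOn.mul hg.continuousOn')
    (hO₂.trans (rpow_isBigO_rpow (min_le_right _ _))) hb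
  obtain ⟨C₃, hC₃, h₃⟩ := hφ.exists_bound hb
  refine ⟨δ, hδ0, Asymptotics.IsBigO.of_bound ((4 * C₁ + 2 * C₂) * C₃) ?_⟩
  filter_upwards [Ioo_mem_nhdsGT (show (0 : ℝ) < 1 / 2 by norm_num)] with z hz
  have hzδ : 0 < z ^ δ := Real.rpow_pos_of_pos hz.1 _
  rw [Real.norm_of_nonneg hzδ.le]
  have hm : ∀ t ∈ Ioc 0 z, t ^ δ ≤ z ^ δ := fun t ht => Real.rpow_le_rpow ht.1.le ht.2 hδ0.le
  have key : ∀ t ∈ Ioo 0 z, ‖(g t - g z) * φ (z - t)‖ ≤ (4 * C₁ + 2 * C₂) * C₃ * z ^ δ / z := by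
    intro t ht
    have hzt : 0 < z - t := sub_pos.2 ht.2
    have hφb := h₃ (z - t) ⟨hzt, by linarith [ht.1, hz.2]⟩
    have hz0 := hz.1
    rw [norm_mul]
    rcases le_total t (z / 2) with h | h
    · have e1 : ‖g t - g z‖ ≤ 2 * C₁ * z ^ δ := by
        have i1 := h₁ t ⟨ht.1, by linarith [ht.2, hz.2]⟩
        have i2 := h₁ z ⟨hz.1, hz.2.le⟩
        have i3 := mul_le_mul_of_nonneg_left (hm t ⟨ht.1, ht.2.le⟩) hC₁.le
        have := norm_sub_le (g t) (g z)
        linarith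
      have e2 : ‖φ (z - t)‖ ≤ C₃ / (z / 2) :=
        hφb.trans (div_le_div_of_nonneg_left hC₃.le (by positivity) (by linarith))
      calc _ ≤ 2 * C₁ * z ^ δ * (C₃ / (z / 2)) :=
            mul_le_mul e1 e2 (norm_nonneg _) (by positivity)
        _ = (4 * C₁ + 0) * C₃ * z ^ δ / z := by field_simp; ring
        _ ≤ _ := by gcongr; positivity
    · have hsub : Icc (z / 2) z ⊆ Ioo 0 1 :=
        Icc_subset_Ioo (by positivity) (by linarith [hz.2])
      have e1 : ‖g t - g z‖ ≤ C₂ * z ^ δ / (z / 2) * ‖t - z‖ := by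
        refine (convex_Icc (z / 2) z).norm_image_sub_le_of_norm_hasDerivWithin_le
          (fun x hx => (hg.hasDerivAt x (hsub hx)).hasDerivWithinAt) (fun x hx => ?_)
          ⟨by linarith, le_rfl⟩ ⟨h, ht.2.le⟩
        have hx0 : 0 < x := (hsub hx).1
        have := h₂ x ⟨hx0, by linarith [hx.2, hz.2]⟩
        rw [Pi.mul_apply, norm_mul, Complex.norm_real, Real.norm_of_nonneg hx0.le, mul_comm,
          ← le_div_iff₀ hx0] at this
        refine this.trans ?_
        have i1 := hm x ⟨hx0, hx.2⟩
        have i2 := hx.1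
        gcongr
      rw [Real.norm_eq_abs, abs_sub_comm, abs_of_pos hzt] at e1
      calc _ ≤ C₂ * z ^ δ / (z / 2) * (z - t) * (C₃ / (z - t)) :=
            mul_le_mul e1 hφb (norm_nonneg _) (by positivity)
        _ = (0 + 2 * C₂) * C₃ * z ^ δ / z := by field_simp; ring
        _ ≤ _ := by gcongr; positivity
  have hae : ∀ᵐ t : ℝ, t ∈ uIoc 0 z →
      ‖(g t - g z) * φ (z - t)‖ ≤ (4 * C₁ + 2 * C₂) * C₃ * z ^ δ / z := by
    have : ∀ᵐ t : ℝ, t ≠ z := by simp [ae_iff, measure_singleton]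
    filter_upwards [this] with t ht h3
    rw [uIoc_of_le hz.1.le] at h3
    exact key t ⟨h3.1, lt_of_le_of_ne h3.2 ht⟩
  have := intervalIntegral.norm_integral_le_of_norm_le_const_ae hae
  rwa [sub_zero, abs_of_pos hz.1, div_mul_cancel₀ _ hz.1.ne'] at this

theorem LogFun.negl_conv_of_kernel {g g' φ : ℝ → ℂ} {P : Polynomial ℂ} (hg : LogFun g g' P)
    (hφ : IsKernel φ 0) : Negl fun z => ∫ t in (0 : ℝ)..z, (g t - g z) * φ (z - t) := by
  have hb : (1 / 2 : ℝ) < 1 := by norm_num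
  obtain ⟨C₁, hC₁, h₁⟩ := hg.exists_bound hb (show (-(1 / 2) : ℝ) < 0 by norm_num)
  obtain ⟨C₂, hC₂, h₂⟩ := hφ.exists_bound_sub hb
  simp only [zero_div, sub_zero] at h₂
  refine ⟨1 / 2, by norm_num, Asymptotics.IsBigO.of_bound (4 * C₁ * C₂) ?_⟩
  filter_upwards [Ioo_mem_nhdsGT (show (0 : ℝ) < 1 / 2 by norm_num)] with z hz
  rw [Real.norm_of_nonneg (Real.rpow_nonneg hz.1.le _)]
  have := norm_integral_le_rpow (F := fun t => (g t - g z) * φ (z - t)) (C := 2 * C₁ * C₂)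
    (a := -(1 / 2)) (z := z) (by norm_num) hz.1.le fun t ht => by
      have i1 := h₁ t ⟨ht.1, by linarith [ht.2, hz.2]⟩
      have i2 := h₁ z ⟨hz.1, hz.2.le⟩
      have i3 : z ^ (-(1 / 2) : ℝ) ≤ t ^ (-(1 / 2) : ℝ) :=
        Real.rpow_le_rpow_of_nonpos ht.1 ht.2.le (by norm_num)
      have i4 := h₂ (z - t) ⟨by linarith [ht.2], by linarith [ht.1, hz.2]⟩
      have i5 : ‖g t - g z‖ ≤ 2 * C₁ * t ^ (-(1 / 2) : ℝ) := by
        have := norm_sub_le (g t) (g z)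
        nlinarith
      rw [norm_mul]
      have := Real.rpow_nonneg ht.1.le (-(1 / 2) : ℝ)
      refine (mul_le_mul i5 i4 (norm_nonneg _) (by positivity)).trans (le_of_eq ?_)
      ring
  refine this.trans (le_of_eq ?_)
  rw [show (-(1 / 2) + 1 : ℝ) = 1 / 2 by norm_num]
  ring

/-- After `t = z s`, the binomial theorem is applied to `(tlog z + log s) ^ m`. The subtraction
removes the term free of `log s`, and each remaining power of `log s` against `1 / (1 - s)` gives a
zeta value. -/
theorem integral_tlog_pow_conv (m : ℕ) {z : ℝ} (hz : 0 < z) (κ : ℂ) :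
    ∫ t in (0 : ℝ)..z, (tlog t ^ m - tlog z ^ m) * (κ / ((z - t : ℝ) : ℂ))
      = ∑ j ∈ Finset.range m, κ * ((-1) ^ (j + 1) * (j + 1).factorial
          * riemannZeta (j + 1 + 1 : ℕ)) * (m.choose (j + 1)) * tlog z ^ (m - (j + 1)) := by
  have h1 := intervalIntegral.smul_integral_comp_mul_left
    (f := fun t : ℝ => (tlog t ^ m - tlog z ^ m) * (κ / ((z - t : ℝ) : ℂ))) (a := 0) (b := 1) z
  rw [mul_zero, mul_one] at h1
  rw [← h1, ← intervalIntegral.integral_smul]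
  have hzc : (z : ℂ) ≠ 0 := by exact_mod_cast hz.ne'
  have h2 : EqOn (fun s : ℝ => z • ((tlog (z * s) ^ m - tlog z ^ m) * (κ / ((z - z * s : ℝ) : ℂ))))
      (fun s : ℝ => ∑ j ∈ Finset.range m, κ * ((m.choose (j + 1)) * tlog z ^ (m - (j + 1)))
        * ((Real.log s : ℂ) ^ (j + 1) / (1 - s))) (uIoo 0 1) := by
    intro s hs
    rw [uIoo_of_le zero_le_one] at hs
    have hs1 : (1 - s : ℂ) ≠ 0 := by
      have : (1 - s : ℝ) ≠ 0 := by linarith [hs.2]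
      exact_mod_cast this
    have e1 : tlog (z * s) ^ m - tlog z ^ m
        = ∑ j ∈ Finset.range m, (Real.log s : ℂ) ^ (j + 1) * tlog z ^ (m - (j + 1))
          * (m.choose (j + 1)) := by
      rw [tlog_mul hs.1 hz, add_comm, add_pow, Finset.sum_range_succ']
      simp
    simp only [Complex.real_smul]
    rw [e1, Finset.sum_mul, Finset.mul_sum]
    refine Finset.sum_congr rfl fun j _ => ?_
    rw [show ((z - z * s : ℝ) : ℂ) = z * (1 - s) by push_cast; ring]
    field_simp
  rw [intervalIntegral.integral_congr_uIoo h2, intervalIntegral.integral_finsetSum]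
  · refine Finset.sum_congr rfl fun j _ => ?_
    rw [intervalIntegral.integral_const_mul, integral_log_pow_div_one_sub (by omega)]
    ring
  · exact fun j _ => (intervalIntegrable_log_pow_div_one_sub (by omega)).const_mul _

/-- The regularized value at `0` of a regularized convolution. -/
theorem LogFun.hasRegValue_convReg {g g' φ Φ : ℝ → ℂ} {κ c : ℂ} {m : ℕ}
    (hg : LogFun g g' (Polynomial.C c * Polynomial.X ^ m)) (hφ : IsKernel φ κ)
    (hΦ : LogFun Φ φ (Polynomial.C κ * Polynomial.X)) :
    HasRegValue (convReg g φ Φ)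
      (if m = 0 then 0 else κ * c * ((-1) ^ m * m.factorial * riemannZeta (m + 1 : ℕ))) := by
  set P : Polynomial ℂ := Polynomial.C c * Polynomial.X ^ m with hP
  have hg0 := LogFun.eval_tlog P
  have he := hg.sub hg0
  rw [sub_self] at he
  have hφ0 := isKernel_const_div κ
  have hφ1 := hφ.sub_const_div
  obtain ⟨a, ha⟩ : ∃ a : ℕ → ℂ, a = fun j => κ * ((-1) ^ (j + 1) * (j + 1).factorial
    * riemannZeta (j + 1 + 1 : ℕ)) * (m.choose (j + 1)) := ⟨_, rfl⟩
  refine hasRegValue_iff.2 ⟨Polynomial.C c * (∑ j ∈ Finset.range m, Polynomial.C (a j)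
    * Polynomial.X ^ (m - (j + 1))) + P * (Polynomial.C κ * Polynomial.X), ?_, ?_⟩
  · rw [Polynomial.coeff_add, Polynomial.coeff_C_mul, Polynomial.finsetSum_coeff]
    simp only [Polynomial.coeff_X_pow, Polynomial.mul_coeff_zero,
      Polynomial.coeff_X_zero, mul_zero, add_zero]
    rcases m with _ | m
    · simp
    -- Only the last index has exponent `0` in `X`, so it alone contributes to the constant
    -- coefficient.
    · rw [if_neg m.succ_ne_zero, Finset.sum_range_succ, Finset.sum_eq_zero]
      · simp only [ha, Nat.choose_self, Nat.cast_one, Nat.sub_self, if_true, zero_add,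
          mul_one, Polynomial.coeff_C_zero]
        ring
      · intro j hj
        have := Finset.mem_range.1 hj
        rw [if_neg (by omega), mul_zero]
  -- Both factors are split into leading part and remainder: `g = (g - P(tlog)) + P(tlog)` and `φ =
  -- (φ - κ/t) + κ/t`. The pieces containing a remainder are negligible, and the product of leading
  -- parts was computed in `integral_tlog_pow_conv`.
  have n1 := he.negl_conv_of_zero hφ
  have n2 := hg0.negl_conv_of_kernel hφ1
  have n3 : Negl fun z => g z * Φ z
      - (P.eval (tlog z)) * (Polynomial.C κ * Polynomial.X).eval (tlog z) := by
    refine ((hg.asymp.mul hΦ.subpoly).add (hΦ.asymp.mul (subpoly_eval P))).congr'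
      (Eventually.of_forall fun z => ?_)
    ring
  refine ((n1.add n2).add n3).congr' ?_
  filter_upwards [Ioo_mem_nhdsGT (zero_lt_one' ℝ)] with z hz
  have i1 := he.intervalIntegrable_conv hφ hz
  have i2 := hg0.intervalIntegrable_conv hφ0 hz
  have i3 := hg0.intervalIntegrable_conv hφ1 hz
  have e1 : ∫ t in (0 : ℝ)..z, (g t - g z) * φ (z - t)
      = (∫ t in (0 : ℝ)..z, (g t - P.eval (tlog t) - (g z - P.eval (tlog z))) * φ (z - t))
        + (∫ t in (0 : ℝ)..z, (P.eval (tlog t) - P.eval (tlog z))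
          * (φ (z - t) - κ / ((z - t : ℝ) : ℂ)))
        + ∫ t in (0 : ℝ)..z, (P.eval (tlog t) - P.eval (tlog z)) * (κ / ((z - t : ℝ) : ℂ)) := by
    rw [← intervalIntegral.integral_add i1 i3, ← intervalIntegral.integral_add (i1.add i3) i2]
    refine intervalIntegral.integral_congr fun t _ => ?_
    ring
  have e2 : ∫ t in (0 : ℝ)..z, (P.eval (tlog t) - P.eval (tlog z)) * (κ / ((z - t : ℝ) : ℂ))
      = c * ∫ t in (0 : ℝ)..z, (tlog t ^ m - tlog z ^ m) * (κ / ((z - t : ℝ) : ℂ)) := by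
    rw [← intervalIntegral.integral_const_mul]
    refine intervalIntegral.integral_congr fun t _ => ?_
    simp only [hP, Polynomial.eval_mul, Polynomial.eval_C, Polynomial.eval_pow, Polynomial.eval_X]
    ring
  have e3 : (∑ j ∈ Finset.range m, Polynomial.C (a j) * Polynomial.X ^ (m - (j + 1))).eval (tlog z)
      = ∫ t in (0 : ℝ)..z, (tlog t ^ m - tlog z ^ m) * (κ / ((z - t : ℝ) : ℂ)) := by
    rw [integral_tlog_pow_conv m hz.1, Polynomial.eval_finsetSum, ha]
    simp only [Polynomial.eval_mul, Polynomial.eval_C, Polynomial.eval_pow, Polynomial.eval_X]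
  clear_value P
  rw [convReg, e1, e2, Polynomial.eval_add, Polynomial.eval_mul (p := Polynomial.C c), e3,
    Polynomial.eval_mul (p := P), Polynomial.eval_C]
  abel

/-- The regularized value of a truncated convolution. -/
theorem IsTruncExp.hasRegValue_conv {J : ℝ → ℝ → ℂ} {g φ Φ : ℝ → ℂ} {κ : ℂ}
    (hJ : IsTruncExp J g) (hφ : IsKernel φ κ)
    (hΦ : LogFun Φ φ (Polynomial.C κ * Polynomial.X)) {z : ℝ} (hz : z ∈ Ioo (0 : ℝ) 1) :
    HasRegValue (fun ε => ∫ t in ε..(z - ε), J ε t * φ (z - t)) (convReg g φ Φ z) := by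
  obtain ⟨N, gs, gs', Ps, hgs, rfl, hexp⟩ := hJ.exp
  obtain ⟨C, δ, hC, hδ, hb⟩ := hexp z hz.2
  obtain ⟨C₃, hC₃, h₃⟩ := hφ.exists_bound hz.2
  -- Each coefficient function contributes its convolution together with its own divergence `-κ
  -- g_j(z) tlog ε`. The latter carries an extra factor `X`, so the constant coefficient is the
  -- convolution of `gs 0`.
  refine hasRegValue_iff.2 ⟨∑ j ∈ Finset.range (N + 1), Polynomial.X ^ j
    * (Polynomial.C (convReg (gs j) φ Φ z) - Polynomial.C (κ * gs j z) * Polynomial.X), ?_, ?_⟩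
  · rw [Polynomial.finsetSum_coeff, Finset.sum_range_succ', Finset.sum_eq_zero]
    · simp
    · intro j _
      simp [Polynomial.mul_coeff_zero]
  -- The integral is reflected by `s = z - t`, which puts the pole of the kernel at `s = 0`, where
  -- `norm_integral_le_of_rpow_sub_one` applies.
  have n1 : Negl fun ε => ∫ s in ε..(z - ε),
      (J ε (z - s) - ∑ j ∈ Finset.range (N + 1), tlog ε ^ j * gs j (z - s)) * φ s := by
    refine ⟨δ / 2, by positivity, Asymptotics.IsBigO.of_bound (C * C₃ / (δ / 2)) ?_⟩
    filter_upwards [Ioo_mem_nhdsGT (half_pos hz.1)] with ε hε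
    have hε0 := hε.1
    rw [Real.norm_of_nonneg (Real.rpow_nonneg hε.1.le _)]
    refine (norm_integral_le_of_rpow_sub_one (C := C * C₃ * ε ^ (δ / 2)) (a := δ / 2)
      (by positivity) (by positivity) hε.1 (by linarith [hε.2]) (by linarith [hz.2]) fun s hs => ?_
      ).trans (le_of_eq (by ring))
    have hs0 : 0 < s := hε.1.trans hs.1
    have h1 := hb ε (z - s) hε.1 (by linarith [hs.2]) (by linarith)
    have h2 := h₃ s ⟨hs0, by linarith [hs.2]⟩
    rw [norm_mul]
    refine (mul_le_mul h1 h2 (norm_nonneg _) (by positivity)).trans ?_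
    have h3 : ε ^ δ = ε ^ (δ / 2) * ε ^ (δ / 2) := by rw [← Real.rpow_add hε.1, add_halves]
    have h4 : ε ^ (δ / 2) ≤ s ^ (δ / 2) := Real.rpow_le_rpow hε.1.le hs.1.le (by positivity)
    rw [h3, Real.rpow_sub_one hs0.ne']
    calc C * (ε ^ (δ / 2) * ε ^ (δ / 2)) * (C₃ / s)
        = C * C₃ * ε ^ (δ / 2) * (ε ^ (δ / 2) / s) := by ring
      _ ≤ C * C₃ * ε ^ (δ / 2) * (s ^ (δ / 2) / s) := by gcongr
  have n2 : Negl fun ε => ∑ j ∈ Finset.range (N + 1),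
      ((∫ t in ε..(z - ε), gs j t * φ (z - t)) - (convReg (gs j) φ Φ z - κ * gs j z * tlog ε))
        * (Polynomial.X ^ j).eval (tlog ε) := by
    refine Negl.sum fun j _ => Negl.mul ?_ (subpoly_eval _)
    obtain ⟨C', δ', -, hδ', h⟩ := (hgs j).exists_conv_expansion hφ hΦ hz.1 hz.2
    refine ⟨δ', hδ', Asymptotics.IsBigO.of_bound C' ?_⟩
    filter_upwards [Ioo_mem_nhdsGT (half_pos hz.1)] with ε hε
    rw [Real.norm_of_nonneg (Real.rpow_nonneg hε.1.le _)]
    exact h ε z hε.1 hε.2 ⟨le_rfl, le_rfl⟩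
  refine (n1.add n2).congr' ?_
  filter_upwards [Ioo_mem_nhdsGT (half_pos hz.1)] with ε hε
  have hεz : ε ≤ z - ε := by linarith [hε.2]
  have hsub : Icc ε (z - ε) ⊆ Ioo 0 1 := Icc_subset_Ioo hε.1 (by linarith [hz.2, hε.1])
  have hφc : ContinuousOn (fun t => φ (z - t)) (Icc ε (z - ε)) :=
    hφ.continuousOn.comp (by fun_prop) fun t ht =>
      ⟨by linarith [ht.2, hε.1], by linarith [ht.1, hz.2, hε.1]⟩
  have hint : ∀ w : ℝ → ℂ, ContinuousOn w (Icc ε (z - ε)) →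
      IntervalIntegrable w volume ε (z - ε) :=
    fun w hw => (hw.mono (uIcc_of_le hεz).le).intervalIntegrable
  have hgc : ∀ j, ContinuousOn (fun t => tlog ε ^ j * (gs j t * φ (z - t))) (Icc ε (z - ε)) :=
    fun j => continuousOn_const.mul (((hgs j).continuousOn.mono hsub).mul hφc)
  have e1 : ∫ s in ε..(z - ε),
      (J ε (z - s) - ∑ j ∈ Finset.range (N + 1), tlog ε ^ j * gs j (z - s)) * φ s
      = (∫ t in ε..(z - ε), J ε t * φ (z - t)) - ∑ j ∈ Finset.range (N + 1),
        tlog ε ^ j * ∫ t in ε..(z - ε), gs j t * φ (z - t) := by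
    have h1 := intervalIntegral.integral_comp_sub_left (a := ε) (b := z - ε) (fun t =>
      (J ε t - ∑ j ∈ Finset.range (N + 1), tlog ε ^ j * gs j t) * φ (z - t)) z
    simp only [sub_sub_cancel] at h1
    rw [h1]
    have h2 : ∀ t, (J ε t - ∑ j ∈ Finset.range (N + 1), tlog ε ^ j * gs j t) * φ (z - t)
        = J ε t * φ (z - t)
          - ∑ j ∈ Finset.range (N + 1), tlog ε ^ j * (gs j t * φ (z - t)) := by
      intro t
      rw [sub_mul, Finset.sum_mul]
      simp only [mul_assoc]
    simp only [h2]
    rw [intervalIntegral.integral_sub (hint (fun t => J ε t * φ (z - t)) (((hJ.cont ε hε.1).mono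
        (Icc_subset_Ico_right (by linarith [hz.2, hε.1]))).mul hφc))
      (hint _ (continuousOn_finsetSum _ fun j _ => hgc j)),
      intervalIntegral.integral_finsetSum fun j _ => hint _ (hgc j)]
    simp only [intervalIntegral.integral_const_mul]
  rw [e1, Polynomial.eval_finsetSum, sub_add, ← Finset.sum_sub_distrib]
  congr 1
  refine Finset.sum_congr rfl fun j _ => ?_
  simp only [Polynomial.eval_mul, Polynomial.eval_sub, Polynomial.eval_C, Polynomial.eval_pow,
    Polynomial.eval_X]
  ring

end EllipticPolylog

end

noncomputable section
namespace EllipticPolylog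
open Filter Topology MeasureTheory Set

/-! ### Derivatives of truncated convolutions -/

/-- Rescaling to `[0, 1]` moves the dependence on `z` from the limits into the integrand, in
preparation for differentiation under the integral sign. -/
theorem truncConv_eq_integral_unit (g φ : ℝ → ℂ) (ε z : ℝ) :
    ∫ t in ε..(z - ε), g t * φ (z - t)
      = ∫ s in (0 : ℝ)..1, (z - 2 * ε) •
        (g (ε + (z - 2 * ε) * s) * φ (z - (ε + (z - 2 * ε) * s))) := by
  rw [intervalIntegral.integral_smul]
  have := intervalIntegral.smul_integral_comp_add_mul
    (f := fun t : ℝ => g t * φ (z - t)) (a := 0) (b := 1) (z - 2 * ε) ε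
  simp only [mul_zero, add_zero, mul_one] at this
  rw [this, show ε + (z - 2 * ε) = z - ε by ring]

/-- The derivative is arranged to fall on `g`, where it produces another kernel factor to which the
Fay identity applies. Integration by parts removes `φ'`, whose double pole would not have a limit as
`ε → 0`, and leaves one boundary term. -/
theorem hasDerivAt_truncConv {g g' φ φ' : ℝ → ℂ}
    (hg : ∀ t ∈ Ioo (0 : ℝ) 1, HasDerivAt g (g' t) t) (hg' : ContinuousOn g' (Ioo 0 1))
    (hφ : ∀ t ∈ Ioo (0 : ℝ) 1, HasDerivAt φ (φ' t) t) (hφ' : ContinuousOn φ' (Ioo 0 1))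
    {ε z : ℝ} (hε : 0 < ε) (hεz : 2 * ε < z) (hz : z < 1) :
    HasDerivAt (fun z => ∫ t in ε..(z - ε), g t * φ (z - t))
      (g ε * φ (z - ε) + ∫ t in ε..(z - ε), g' t * φ (z - t)) z := by
  have hgc : ContinuousOn g (Ioo 0 1) := fun t ht => (hg t ht).continuousAt.continuousWithinAt
  have hφc : ContinuousOn φ (Ioo 0 1) := fun t ht => (hφ t ht).continuousAt.continuousWithinAt
  set a : ℝ → ℝ → ℝ := fun y s => ε + (y - 2 * ε) * s with ha
  set b : ℝ → ℝ → ℝ := fun y s => y - (ε + (y - 2 * ε) * s) with hb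
  have ham : ∀ y s, 2 * ε < y → y < 1 → s ∈ Icc (0 : ℝ) 1 → a y s ∈ Ioo 0 1 := by
    intro y s h1 h2 hs
    have e1 : 0 ≤ (y - 2 * ε) * s := mul_nonneg (by linarith) hs.1
    have e2 : 0 ≤ (y - 2 * ε) * (1 - s) := mul_nonneg (by linarith) (by linarith [hs.2])
    simp only [ha, mem_Ioo]
    constructor <;> nlinarith
  have hbm : ∀ y s, 2 * ε < y → y < 1 → s ∈ Icc (0 : ℝ) 1 → b y s ∈ Ioo 0 1 := by
    intro y s h1 h2 hs
    have e1 : 0 ≤ (y - 2 * ε) * s := mul_nonneg (by linarith) hs.1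
    have e2 : 0 ≤ (y - 2 * ε) * (1 - s) := mul_nonneg (by linarith) (by linarith [hs.2])
    simp only [hb, mem_Ioo]
    constructor <;> nlinarith
  set F : ℝ → ℝ → ℂ := fun y s => ((y - 2 * ε : ℝ) : ℂ) * (g (a y s) * φ (b y s)) with hF
  set F' : ℝ → ℝ → ℂ := fun y s => g (a y s) * φ (b y s) + ((y - 2 * ε : ℝ) : ℂ)
    * ((s * g' (a y s)) * φ (b y s) + g (a y s) * ((1 - s : ℝ) * φ' (b y s))) with hF'
  obtain ⟨y₁, hy₁, hy₁'⟩ := exists_between hεz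
  obtain ⟨y₂, hy₂, hy₂'⟩ := exists_between hz
  have hK : ContinuousOn (Function.uncurry F') (Icc y₁ y₂ ×ˢ Icc (0 : ℝ) 1) := by
    have hca : Continuous fun p : ℝ × ℝ => a p.1 p.2 := by simp only [ha]; fun_prop
    have hcb : Continuous fun p : ℝ × ℝ => b p.1 p.2 := by simp only [hb]; fun_prop
    have ma : MapsTo (fun p : ℝ × ℝ => a p.1 p.2) (Icc y₁ y₂ ×ˢ Icc (0 : ℝ) 1) (Ioo 0 1) :=
      fun p hp => ham _ _ (by linarith [hp.1.1]) (by linarith [hp.1.2]) hp.2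
    have mb : MapsTo (fun p : ℝ × ℝ => b p.1 p.2) (Icc y₁ y₂ ×ˢ Icc (0 : ℝ) 1) (Ioo 0 1) :=
      fun p hp => hbm _ _ (by linarith [hp.1.1]) (by linarith [hp.1.2]) hp.2
    have c1 := hgc.comp hca.continuousOn ma
    have c2 := hg'.comp hca.continuousOn ma
    have c3 := hφc.comp hcb.continuousOn mb
    have c4 := hφ'.comp hcb.continuousOn mb
    have c5 : Continuous fun p : ℝ × ℝ => ((p.1 - 2 * ε : ℝ) : ℂ) := by fun_prop
    have c6 : Continuous fun p : ℝ × ℝ => (p.2 : ℂ) := by fun_prop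
    have c7 : Continuous fun p : ℝ × ℝ => ((1 - p.2 : ℝ) : ℂ) := by fun_prop
    exact (c1.mul c3).add (c5.continuousOn.mul (((c6.continuousOn.mul c2).mul c3).add
      (c1.mul (c7.continuousOn.mul c4))))
  obtain ⟨M, hM⟩ := (isCompact_Icc.prod isCompact_Icc).exists_bound_of_continuousOn hK
  have hsl : ∀ y ∈ Icc y₁ y₂, ContinuousOn (F' y) (Icc 0 1) := fun y hy =>
    hK.comp (f := fun s => (y, s)) (by fun_prop) fun s hs => ⟨hy, hs⟩
  have hd : ∀ y ∈ Icc y₁ y₂, ∀ s ∈ Icc (0 : ℝ) 1, HasDerivAt (fun y => F y s) (F' y s) y := by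
    intro y hy s hs
    have d1 : HasDerivAt (fun y => a y s) s y := by
      have := ((((hasDerivAt_id y).sub_const (2 * ε)).mul_const s).const_add ε)
      simpa [ha] using this
    have d2 : HasDerivAt (fun y => b y s) (1 - s) y := (hasDerivAt_id y).sub d1
    have d3 := (hg _ (ham y s (by linarith [hy.1]) (by linarith [hy.2]) hs)).scomp y d1
    have d4 := (hφ _ (hbm y s (by linarith [hy.1]) (by linarith [hy.2]) hs)).scomp y d2
    have d5 : HasDerivAt (fun y : ℝ => ((y - 2 * ε : ℝ) : ℂ)) 1 y := by
      simpa using ((hasDerivAt_id y).sub_const (2 * ε)).ofReal_comp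
    have := d5.mul (d3.mul d4)
    refine this.congr_deriv ?_
    simp only [hF', Function.comp, Complex.real_smul, Pi.mul_apply]
    ring
  have hFc : ∀ y ∈ Icc y₁ y₂, ContinuousOn (F y) (Icc 0 1) := by
    intro y hy
    have ma : MapsTo (a y) (Icc (0 : ℝ) 1) (Ioo 0 1) :=
      fun s hs => ham _ _ (by linarith [hy.1]) (by linarith [hy.2]) hs
    have mb : MapsTo (b y) (Icc (0 : ℝ) 1) (Ioo 0 1) :=
      fun s hs => hbm _ _ (by linarith [hy.1]) (by linarith [hy.2]) hs
    have ca : Continuous (a y) := by simp only [ha]; fun_prop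
    have cb : Continuous (b y) := by simp only [hb]; fun_prop
    exact continuousOn_const.mul
      ((hgc.comp ca.continuousOn ma).mul (hφc.comp cb.continuousOn mb))
  have hzI : z ∈ Icc y₁ y₂ := ⟨hy₁'.le, hy₂.le⟩
  have hsub : uIoc (0 : ℝ) 1 ⊆ Icc 0 1 := by
    rw [uIoc_of_le zero_le_one]
    exact Ioc_subset_Icc_self
  have key := (intervalIntegral.hasDerivAt_integral_of_dominated_loc_of_deriv_le
    (μ := volume) (F := F) (F' := F') (x₀ := z) (s := Icc y₁ y₂) (a := 0) (b := 1)
    (bound := fun _ => M) (Icc_mem_nhds hy₁' hy₂)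
    (by
      filter_upwards [Icc_mem_nhds hy₁' hy₂] with y hy
      exact ((hFc y hy).mono hsub).aestronglyMeasurable measurableSet_uIoc)
    ((hFc z hzI).mono (uIcc_of_le zero_le_one).le).intervalIntegrable
    (((hsl z hzI).mono hsub).aestronglyMeasurable measurableSet_uIoc)
    (Eventually.of_forall fun s hs y hy => hM (y, s) ⟨hy, hsub hs⟩)
    intervalIntegrable_const
    (Eventually.of_forall fun s hs y hy => hd y hy s (hsub hs))).2
  have e1 : (fun z => ∫ t in ε..(z - ε), g t * φ (z - t)) = fun y => ∫ s in (0 : ℝ)..1, F y s := by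
    funext y
    rw [truncConv_eq_integral_unit]
    simp only [hF, Complex.real_smul, ha, hb]
  rw [e1]
  refine key.congr_deriv ?_
  -- The integration by parts in rescaled form: `E` is a primitive of the difference between the
  -- desired integrand and `F' z`, and `E 1 - E 0` is the boundary term.
  set E : ℝ → ℂ := fun s => ((1 - s : ℝ) : ℂ) * (g (a z s) * φ (b z s)) with hE
  set E' : ℝ → ℂ := fun s => ((z - 2 * ε : ℝ) : ℂ) * (g' (a z s) * φ (b z s)) - F' z s with hE'
  have hE1 : ∀ s ∈ Icc (0 : ℝ) 1, HasDerivAt E (E' s) s := by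
    intro s hs
    have d1 : HasDerivAt (fun s => a z s) (z - 2 * ε) s := by
      have := (((hasDerivAt_id s).const_mul (z - 2 * ε)).const_add ε)
      simpa [ha] using this
    have d2 : HasDerivAt (fun s => b z s) (-(z - 2 * ε)) s := d1.const_sub z
    have d3 := (hg _ (ham z s hεz hz hs)).scomp s d1
    have d4 := (hφ _ (hbm z s hεz hz hs)).scomp s d2
    have d5 : HasDerivAt (fun s : ℝ => ((1 - s : ℝ) : ℂ)) (-1) s := by
      simpa using ((hasDerivAt_id s).const_sub 1).ofReal_comp
    refine (d5.mul (d3.mul d4)).congr_deriv ?_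
    simp only [hE', hF', Function.comp, Complex.real_smul, Pi.mul_apply]
    push_cast
    ring
  have ma : MapsTo (a z) (Icc (0 : ℝ) 1) (Ioo 0 1) := fun s hs => ham _ _ hεz hz hs
  have mb : MapsTo (b z) (Icc (0 : ℝ) 1) (Ioo 0 1) := fun s hs => hbm _ _ hεz hz hs
  have ca : Continuous (a z) := by simp only [ha]; fun_prop
  have cb : Continuous (b z) := by simp only [hb]; fun_prop
  have hc1 : ContinuousOn (fun s => ((z - 2 * ε : ℝ) : ℂ) * (g' (a z s) * φ (b z s))) (Icc 0 1) :=
    continuousOn_const.mul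
      ((hg'.comp ca.continuousOn ma).mul (hφc.comp cb.continuousOn mb))
  have hi1 := (hc1.mono (uIcc_of_le zero_le_one).le).intervalIntegrable (μ := volume)
  have hi2 := ((hsl z hzI).mono (uIcc_of_le zero_le_one).le).intervalIntegrable (μ := volume)
  have h3 := intervalIntegral.integral_eq_sub_of_hasDerivAt
    (fun s hs => hE1 s (by rwa [uIcc_of_le zero_le_one] at hs)) (hi1.sub hi2)
  simp only [hE', intervalIntegral.integral_sub hi1 hi2] at h3
  rw [truncConv_eq_integral_unit]
  simp only [Complex.real_smul]
  have h4 : E 1 - E 0 = -(g ε * φ (z - ε)) := by simp [hE, ha, hb]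
  rw [h4] at h3
  simp only [ha, hb] at h3
  linear_combination -h3

end EllipticPolylog

end

noncomputable section
namespace EllipticPolylog
open Filter Topology MeasureTheory Set

/-! ### Regularized iterated integrals of the kernels -/

theorem LogFun.const_mul {g g' : ℝ → ℂ} {P : Polynomial ℂ} (c : ℂ) (hg : LogFun g g' P) :
    LogFun (fun t => c * g t) (fun t => c * g' t) (Polynomial.C c * P) where
  hasDerivAt t ht := (hg.hasDerivAt t ht).const_mul c
  continuousOn' := continuousOn_const.mul hg.continuousOn'
  asymp := (hg.asymp.mul (subpoly_eval (Polynomial.C c))).congr' (Eventually.of_forall fun t => by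
    simp only [Polynomial.eval_mul, Polynomial.eval_C]; ring)
  asymp' := (hg.asymp'.mul (subpoly_eval (Polynomial.C c))).congr' (Eventually.of_forall fun t => by
    simp only [Polynomial.derivative_C_mul, Polynomial.eval_mul, Polynomial.eval_C]; ring)

theorem LogFun.congr_deriv {g g' g'' : ℝ → ℂ} {P : Polynomial ℂ} (hg : LogFun g g' P)
    (h : EqOn g' g'' (Ioo 0 1)) : LogFun g g'' P where
  hasDerivAt t ht := h ht ▸ hg.hasDerivAt t ht
  continuousOn' := hg.continuousOn'.congr h.symm
  asymp := hg.asymp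
  asymp' := hg.asymp'.congr' (by
    filter_upwards [Ioo_mem_nhdsGT (zero_lt_one' ℝ)] with t ht
    rw [h ht])

theorem kernelCoeff_neg_ofReal (τ : UpperHalfPlane) (n : ℕ) {t : ℝ} (ht : t ∈ Ioo (0 : ℝ) 1) :
    kernelCoeff τ n (-(t : ℂ)) = (-1) ^ n * kernelCoeff τ n t :=
  kernelCoeff_neg τ n (theta_ofReal_ne_zero τ ht.1.ne' (by rw [abs_of_pos ht.1]; exact ht.2))

theorem isKernel_kernelCoeff (τ : UpperHalfPlane) (n : ℕ) :
    IsKernel (fun t => kernelCoeff τ n t) (if n = 1 then 1 else 0) :=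
  ⟨_, contDiffOn_kernelReg τ n, fun t ht => kernelCoeff_eq_add τ n ht.1.ne'
    (by rw [abs_of_pos ht.1]; exact ht.2)⟩

theorem isKernel_kernelCoeff_neg (τ : UpperHalfPlane) (n : ℕ) :
    IsKernel (fun t => kernelCoeff τ n (-(t : ℂ))) (-(if n = 1 then 1 else 0)) := by
  refine ⟨fun t => (-1) ^ n * kernelReg τ n t, contDiffOn_const.mul (contDiffOn_kernelReg τ n),
    fun t ht => ?_⟩
  have h1 := kernelCoeff_eq_add τ n ht.1.ne' (by rw [abs_of_pos ht.1]; exact ht.2)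
  simp only [kernelCoeff_neg_ofReal τ n ht, h1]
  split_ifs with h
  · subst h
    ring
  · ring

/-- The polynomial in `log(-2πit)` to which `regIter τ n k` is asymptotic at `0`. -/
def regIterPoly (n : ℕ) (k : Fin n → ℕ) : Polynomial ℂ :=
  if ∀ i, k i = 1 then Polynomial.C (1 / n.factorial : ℂ) * Polynomial.X ^ n else 0

/-- The regularized iterated integral `∫_{0 < t_1 < ⋯ < t_n < t} f^{(k_1)}(t_1) ⋯ f^{(k_n)}(t_n)`. -/
def regIter (τ : UpperHalfPlane) : (n : ℕ) → (Fin n → ℕ) → ℝ → ℂ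
  | 0, _ => fun _ => 1
  -- The normalization is the expansion at `0` without constant term, which determines the primitive
  -- on `(0, 1)`. Existence is available only by an induction through this very definition, hence
  -- the choice operator.
  | n + 1, k => Classical.epsilon fun p =>
      LogFun p (fun t => regIter τ n (fun i => k i.castSucc) t * kernelCoeff τ (k (Fin.last n)) t)
        (regIterPoly (n + 1) k)

theorem regIterPoly_zero (k : Fin 0 → ℕ) : regIterPoly 0 k = 1 := by
  simp [regIterPoly]

/-- The `n`-fold integration of `1 / t` yields `tlog ^ n / n!`, and one kernel without a pole
removes the divergence altogether. This is the compatibility that `IsKernel.exists_prim` requires.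
-/
theorem derivative_regIterPoly (n : ℕ) (k : Fin (n + 1) → ℕ) :
    (regIterPoly (n + 1) k).derivative
      = Polynomial.C (if k (Fin.last n) = 1 then 1 else 0)
        * regIterPoly n (fun i => k i.castSucc) := by
  rw [regIterPoly, regIterPoly]
  simp only [Fin.forall_fin_succ']
  have hn : (n.factorial : ℂ) ≠ 0 := by exact_mod_cast n.factorial_ne_zero
  have hn1 : (n + 1 : ℂ) ≠ 0 := by exact_mod_cast n.succ_ne_zero
  by_cases h1 : ∀ i : Fin n, k i.castSucc = 1 <;> by_cases h2 : k (Fin.last n) = 1 <;>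
    simp only [h1, h2, and_true, and_false, if_true, if_false,
      Polynomial.derivative_zero, Polynomial.C_0, Polynomial.C_1, one_mul, zero_mul, mul_zero,
      implies_true]
  rw [Polynomial.derivative_C_mul, Polynomial.derivative_X_pow, ← mul_assoc, ← Polynomial.C_mul,
    Nat.add_sub_cancel, Nat.factorial_succ]
  congr 2
  push_cast
  field_simp

theorem exists_logFun_regIter (τ : UpperHalfPlane) (n : ℕ) (k : Fin n → ℕ) :
    ∃ g', LogFun (regIter τ n k) g' (regIterPoly n k) := by
  induction n with
  | zero =>
    refine ⟨fun _ => 0, ?_⟩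
    rw [regIterPoly_zero]
    exact LogFun.const 1
  | succ n ih =>
    obtain ⟨g', hg⟩ := ih fun i => k i.castSucc
    have h := (isKernel_kernelCoeff τ (k (Fin.last n))).exists_prim hg (derivative_regIterPoly n k)
    exact ⟨_, Classical.epsilon_spec h⟩

theorem logFun_regIter_succ (τ : UpperHalfPlane) (n : ℕ) (k : Fin (n + 1) → ℕ) :
    LogFun (regIter τ (n + 1) k)
      (fun t => regIter τ n (fun i => k i.castSucc) t * kernelCoeff τ (k (Fin.last n)) t)
      (regIterPoly (n + 1) k) := by
  obtain ⟨g', hg⟩ := exists_logFun_regIter τ n fun i => k i.castSucc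
  exact Classical.epsilon_spec ((isKernel_kernelCoeff τ (k (Fin.last n))).exists_prim hg
    (derivative_regIterPoly n k))

theorem regIterPoly_coeff_zero (n : ℕ) (k : Fin (n + 1) → ℕ) :
    (regIterPoly (n + 1) k).coeff 0 = 0 := by
  rw [regIterPoly]
  split_ifs
  · simp [Polynomial.mul_coeff_zero]
  · simp

theorem isTruncExp_iteratedIntegral (τ : UpperHalfPlane) (n : ℕ) (k : Fin n → ℕ) :
    IsTruncExp (iteratedIntegral n fun i t => kernelCoeff τ (k i) t) (regIter τ n k) := by
  induction n with
  | zero => exact isTruncExp_one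
  | succ n ih =>
    exact (ih fun i => k i.castSucc).step (isKernel_kernelCoeff τ _) (logFun_regIter_succ τ n k)
      (regIterPoly_coeff_zero n k)

/-- A regularized primitive of `f^{(k)}(-t)`. -/
def regPrimNeg (τ : UpperHalfPlane) (k : ℕ) (t : ℝ) : ℂ := (-1) ^ k * regIter τ 1 (fun _ => k) t

theorem logFun_regPrimNeg (τ : UpperHalfPlane) (k : ℕ) :
    LogFun (regPrimNeg τ k) (fun t => kernelCoeff τ k (-(t : ℂ)))
      (Polynomial.C (-(if k = 1 then 1 else 0)) * Polynomial.X) := by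
  have h1 := ((logFun_regIter_succ τ 0 fun _ => k).const_mul ((-1) ^ k)).congr_deriv
    (g'' := fun t => kernelCoeff τ k (-(t : ℂ))) fun t ht => by
      simp only [regIter, one_mul]
      rw [kernelCoeff_neg_ofReal τ k ht]
  have h2 : Polynomial.C ((-1 : ℂ) ^ k) * regIterPoly (0 + 1) (fun _ => k)
      = Polynomial.C (-(if k = 1 then 1 else 0)) * Polynomial.X := by
    rw [regIterPoly]
    simp only [forall_const]
    split_ifs with h
    · subst h
      simp
    · simp
  rw [h2] at h1
  exact h1

/-- The regularized iterated integral `∫_{0 < t_1 < ⋯ < t_{n+1} < z}` of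
`f^{(k_1)}(t_1) ⋯ f^{(k_n)}(t_n) f^{(k_{n+1})}(t_{n+1} - z)`. -/
def regIterLast (τ : UpperHalfPlane) (n : ℕ) (k : Fin (n + 1) → ℕ) (z : ℝ) : ℂ :=
  convReg (regIter τ n fun i => k i.castSucc)
    (fun t => kernelCoeff τ (k (Fin.last n)) (-(t : ℂ))) (regPrimNeg τ (k (Fin.last n))) z

theorem hasRegValue_truncatedIntegral_zero (τ : UpperHalfPlane) {n : ℕ} (k : Fin n → ℕ) {z : ℝ}
    (hz : z ∈ Ioo (0 : ℝ) 1) :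
    HasRegValue (truncatedIntegral τ k (fun _ => 0) z) (regIter τ n k z) := by
  have h := (isTruncExp_iteratedIntegral τ n k).hasRegValue hz
  have : truncatedIntegral τ k (fun _ => 0) z
      = fun ε => iteratedIntegral n (fun i t => kernelCoeff τ (k i) t) ε (z - ε) := by
    funext ε
    simp [truncatedIntegral]
  rwa [this]

theorem hasRegValue_truncatedIntegral_lowerLast (τ : UpperHalfPlane) {n : ℕ} (k : Fin (n + 1) → ℕ)
    {z : ℝ} (hz : z ∈ Ioo (0 : ℝ) 1) :
    HasRegValue (truncatedIntegral τ k (lowerLast (n + 1) z) z) (regIterLast τ n k z) := by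
  have h := (isTruncExp_iteratedIntegral τ n fun i => k i.castSucc).hasRegValue_conv
    (isKernel_kernelCoeff_neg τ (k (Fin.last n))) (logFun_regPrimNeg τ (k (Fin.last n))) hz
  have : truncatedIntegral τ k (lowerLast (n + 1) z) z
      = fun ε => ∫ t in ε..(z - ε), iteratedIntegral n
          (fun i t => kernelCoeff τ (k i.castSucc) t) ε t
          * kernelCoeff τ (k (Fin.last n)) (-((z - t : ℝ) : ℂ)) := by
    funext ε
    have h1 : ∀ i : Fin n, lowerLast (n + 1) z i.castSucc = 0 := fun i => by
      have := i.2
      rw [lowerLast, if_neg]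
      simp only [Fin.val_castSucc]
      omega
    simp only [truncatedIntegral, iteratedIntegral, h1]
    simp [lowerLast]
  rwa [this]

theorem Gam_zero (τ : UpperHalfPlane) {n : ℕ} (k : Fin n → ℕ) {z : ℝ} (hz : z ∈ Ioo (0 : ℝ) 1) :
    Gam τ k (fun _ => 0) z = regIter τ n k z :=
  regValue_eq (hasRegValue_truncatedIntegral_zero τ k hz)

theorem Gam_lowerLast (τ : UpperHalfPlane) {n : ℕ} (k : Fin (n + 1) → ℕ) {z : ℝ}
    (hz : z ∈ Ioo (0 : ℝ) 1) :
    Gam τ k (lowerLast (n + 1) z) z = regIterLast τ n k z :=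
  regValue_eq (hasRegValue_truncatedIntegral_lowerLast τ k hz)

end EllipticPolylog

end

noncomputable section
namespace EllipticPolylog
open Filter Topology MeasureTheory Set
open scoped MvPowerSeries.WithPiTopology

/-! ### Analysis of generating series -/

section PowerSeries

variable {σ : Type*}

/-- A coefficient is a finite linear combination of the `c k` with constants independent of `c`. For
this reason limits, integrals and derivatives all pass through generating series. -/
theorem coeff_mul_genSeries {n : ℕ} {v : Fin n → MvPowerSeries σ ℂ}
    (hv : ∀ i, MvPowerSeries.constantCoeff (v i) = 0) (B : MvPowerSeries σ ℂ)
    (c : (Fin n → ℕ) → ℂ) (e : σ →₀ ℕ) :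
    MvPowerSeries.coeff e (B * genSeries v c)
      = ∑ k ∈ Fintype.piFinset fun _ : Fin n => Finset.range (e.degree + 1),
          c k * MvPowerSeries.coeff e (B * ∏ i, v i ^ k i) := by
  have h : truncMap σ e.degree (B * genSeries v c) = truncMap σ e.degree
      (∑ k ∈ Fintype.piFinset fun _ : Fin n => Finset.range (e.degree + 1),
        c k • (B * ∏ i, v i ^ k i)) := by
    rw [map_mul, truncMap_genSeries hv, map_sum, Finset.mul_sum]
    refine Finset.sum_congr rfl fun k _ => ?_
    simp only [map_smul, map_mul, map_prod, map_pow, mul_smul_comm]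
  rw [truncMap_eq_iff.1 h e le_rfl, map_sum]
  rfl

theorem tendsto_genSeries {X : Type*} {l : Filter X} {n : ℕ} {v : Fin n → MvPowerSeries σ ℂ}
    (hv : ∀ i, MvPowerSeries.constantCoeff (v i) = 0) {c : X → (Fin n → ℕ) → ℂ}
    {c₀ : (Fin n → ℕ) → ℂ} (h : ∀ k, Tendsto (fun x => c x k) l (𝓝 (c₀ k))) :
    Tendsto (fun x => genSeries v (c x)) l (𝓝 (genSeries v c₀)) := by
  rw [MvPowerSeries.WithPiTopology.tendsto_iff_coeff_tendsto]
  intro e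
  simp only [coeff_genSeries hv _ (le_refl e.degree)]
  exact tendsto_finsetSum _ fun k _ => (h k).mul_const _

theorem tendsto_genSeriesOne {X : Type*} {l : Filter X} {x : MvPowerSeries σ ℂ}
    (hx : MvPowerSeries.constantCoeff x = 0) {c : X → ℕ → ℂ}
    {c₀ : ℕ → ℂ} (h : ∀ k, Tendsto (fun x => c x k) l (𝓝 (c₀ k))) :
    Tendsto (fun t => genSeriesOne x (c t)) l (𝓝 (genSeriesOne x c₀)) :=
  tendsto_genSeries (fun _ => hx) fun k => h (k 0)

theorem genSeries_indicator_one {n : ℕ} {v : Fin n → MvPowerSeries σ ℂ}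
    (hv : ∀ i, MvPowerSeries.constantCoeff (v i) = 0) (c : ℂ) :
    genSeries v (fun k => if ∀ i, k i = 1 then c else 0) = c • ∏ i, v i := by
  ext e
  rw [coeff_genSeries hv _ (Nat.le_succ e.degree), Finset.sum_eq_single fun _ => 1]
  · simp
  · intro k _ hk
    rw [if_neg fun h => hk (funext h), zero_mul]
  · intro h
    refine absurd (Fintype.mem_piFinset.2 fun _ => Finset.mem_range.2 ?_) h
    omega

theorem genSeriesOne_indicator_one {x : MvPowerSeries σ ℂ}
    (hx : MvPowerSeries.constantCoeff x = 0) (c : ℂ) :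
    genSeriesOne x (fun k => if k = 1 then c else 0) = c • x := by
  have := genSeries_indicator_one (v := fun _ : Fin 1 => x) (fun _ => hx) c
  simp only [Fin.forall_fin_one, Finset.univ_unique, Finset.prod_singleton] at this
  exact this

theorem genSeriesOne_neg {x : MvPowerSeries σ ℂ}
    (hx : MvPowerSeries.constantCoeff x = 0) (c : ℕ → ℂ) :
    genSeriesOne (-x) c = genSeriesOne x fun k => (-1) ^ k * c k := by
  have hx' : MvPowerSeries.constantCoeff (-x) = 0 := by rw [map_neg, hx, neg_zero]
  refine ext_truncMap fun N => ?_
  rw [truncMap_genSeriesOne hx, truncMap_genSeriesOne hx']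
  refine Finset.sum_congr rfl fun k _ => ?_
  rw [map_neg, mul_comm, mul_smul]
  congr 1
  rw [← neg_one_smul ℂ, smul_pow]

theorem coeff_mul_genSeries_integral {n : ℕ} {v : Fin n → MvPowerSeries σ ℂ}
    (hv : ∀ i, MvPowerSeries.constantCoeff (v i) = 0) (B : MvPowerSeries σ ℂ)
    {w : ℝ → (Fin n → ℕ) → ℂ} {a b : ℝ}
    (hw : ∀ k, IntervalIntegrable (fun t => w t k) volume a b) (e : σ →₀ ℕ) :
    IntervalIntegrable (fun t => MvPowerSeries.coeff e (B * genSeries v (w t))) volume a b ∧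
    MvPowerSeries.coeff e (B * genSeries v fun k => ∫ t in a..b, w t k)
      = ∫ t in a..b, MvPowerSeries.coeff e (B * genSeries v (w t)) := by
  simp only [coeff_mul_genSeries hv]
  have h : ∀ k, IntervalIntegrable (fun t => w t k * MvPowerSeries.coeff e (B * ∏ i, v i ^ k i))
      volume a b := fun k => (hw k).mul_const _
  constructor
  · have := IntervalIntegrable.sum (Fintype.piFinset fun _ : Fin n => Finset.range (e.degree + 1))
      fun k _ => h k
    refine this.congr fun t _ => ?_
    simp only [Finset.sum_apply]
  · rw [intervalIntegral.integral_finsetSum fun k _ => h k]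
    simp only [intervalIntegral.integral_mul_const]

theorem hasDerivAt_coeff_mul_genSeries {n : ℕ} {v : Fin n → MvPowerSeries σ ℂ}
    (hv : ∀ i, MvPowerSeries.constantCoeff (v i) = 0) (B : MvPowerSeries σ ℂ)
    {w : ℝ → (Fin n → ℕ) → ℂ} {w' : (Fin n → ℕ) → ℂ} {z : ℝ}
    (hw : ∀ k, HasDerivAt (fun t => w t k) (w' k) z) (e : σ →₀ ℕ) :
    HasDerivAt (fun t => MvPowerSeries.coeff e (B * genSeries v (w t)))
      (MvPowerSeries.coeff e (B * genSeries v w')) z := by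
  simp only [coeff_mul_genSeries hv]
  exact HasDerivAt.fun_sum fun k _ => (hw k).mul_const _

/-- The families of power series all of whose coefficients belong to a given space of functions. -/
def coeffSubmodule (σ : Type*) {X : Type*} (S : Submodule ℂ (X → ℂ)) :
    Submodule (MvPowerSeries σ ℂ) (X → MvPowerSeries σ ℂ) where
  carrier := {Y | ∀ e, (fun x => MvPowerSeries.coeff e (Y x)) ∈ S}
  zero_mem' e := by
    simp only [Pi.zero_apply, map_zero]
    exact S.zero_mem
  add_mem' hY hZ e := by
    simp only [Pi.add_apply, map_add]
    exact S.add_mem (hY e) (hZ e)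
  smul_mem' B Y hY e := by
    classical
    have : (fun x => MvPowerSeries.coeff e ((B • Y) x))
        = ∑ p ∈ Finset.HasAntidiagonal.antidiagonal e, MvPowerSeries.coeff p.1 B •
          fun x => MvPowerSeries.coeff p.2 (Y x) := by
      funext x
      simp only [Pi.smul_apply, smul_eq_mul, MvPowerSeries.coeff_mul, Finset.sum_apply]
    rw [this]
    exact S.sum_mem fun p _ => S.smul_mem _ (hY p.2)

theorem genSeries_mem_coeffSubmodule {X : Type*} {S : Submodule ℂ (X → ℂ)} {n : ℕ}
    {v : Fin n → MvPowerSeries σ ℂ} (hv : ∀ i, MvPowerSeries.constantCoeff (v i) = 0)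
    {c : X → (Fin n → ℕ) → ℂ} (h : ∀ k, (fun x => c x k) ∈ S) :
    (fun x => genSeries v (c x)) ∈ coeffSubmodule σ S := by
  intro e
  have : (fun x => MvPowerSeries.coeff e (genSeries v (c x)))
      = ∑ k ∈ Fintype.piFinset fun _ : Fin n => Finset.range (e.degree + 1),
          MvPowerSeries.coeff e (∏ i, v i ^ k i) • fun x => c x k := by
    funext x
    simp only [coeff_genSeries hv _ (le_refl e.degree), Finset.sum_apply, Pi.smul_apply,
      smul_eq_mul, mul_comm]
  rw [this]
  exact S.sum_mem fun k _ => S.smul_mem _ (h k)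

/-- The families of fractions of power series that have a common denominator and numerators all of
whose coefficients belong to a given space of functions. -/
def fracSubmodule (σ : Type*) {X : Type*} (S : Submodule ℂ (X → ℂ)) :
    Submodule (FractionRing (MvPowerSeries σ ℂ)) (X → FractionRing (MvPowerSeries σ ℂ)) where
  carrier := {h | ∃ d : MvPowerSeries σ ℂ, d ≠ 0 ∧ ∃ Y ∈ coeffSubmodule σ S,
    ∀ x, algebraMap _ (FractionRing (MvPowerSeries σ ℂ)) d * h x = algebraMap _ _ (Y x)}
  zero_mem' := ⟨1, one_ne_zero, 0, Submodule.zero_mem _, fun x => by simp⟩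
  add_mem' := by
    rintro g h ⟨d, hd, Y, hY, hg⟩ ⟨d', hd', Y', hY', hh⟩
    refine ⟨d * d', mul_ne_zero hd hd', d' • Y + d • Y',
      Submodule.add_mem _ (Submodule.smul_mem _ _ hY) (Submodule.smul_mem _ _ hY'), fun x => ?_⟩
    simp only [Pi.add_apply, Pi.smul_apply, smul_eq_mul, map_add, map_mul, ← hg, ← hh]
    ring
  smul_mem' := by
    rintro q h ⟨d, hd, Y, hY, hh⟩
    obtain ⟨a, b, hb, rfl⟩ := IsFractionRing.div_surjective (A := MvPowerSeries σ ℂ) q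
    have hb0 : b ≠ 0 := nonZeroDivisors.ne_zero hb
    have hb1 : algebraMap _ (FractionRing (MvPowerSeries σ ℂ)) b ≠ 0 :=
      IsFractionRing.to_map_ne_zero_of_mem_nonZeroDivisors hb
    refine ⟨d * b, mul_ne_zero hd hb0, a • Y, Submodule.smul_mem _ _ hY, fun x => ?_⟩
    simp only [Pi.smul_apply, smul_eq_mul, map_mul, ← hh]
    field_simp

end PowerSeries

end EllipticPolylog

end

noncomputable section
namespace EllipticPolylog
open Filter Topology MeasureTheory Set
open scoped MvPowerSeries.WithPiTopology

/-! ### Joint limits of truncated convolutions -/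

theorem eventually_prod_nhds {z₀ : ℝ} (hz : z₀ ∈ Ioo (0 : ℝ) 1) :
    ∀ᶠ q : ℝ × ℝ in 𝓝[>] 0 ×ˢ 𝓝 z₀, 0 < q.1 ∧ 2 * q.1 < q.2 ∧ q.2 < 1 := by
  have h1 : ∀ᶠ ε in 𝓝[>] (0 : ℝ), ε ∈ Ioo 0 (z₀ / 4) :=
    Ioo_mem_nhdsGT (by linarith [hz.1])
  have h2 : ∀ᶠ z in 𝓝 z₀, z ∈ Ioo (z₀ / 2) 1 := Ioo_mem_nhds (by linarith [hz.1]) hz.2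
  filter_upwards [h1.prod_mk h2] with q hq
  exact ⟨hq.1.1, by linarith [hq.1.2, hq.2.1], hq.2.2⟩

theorem tendsto_sub_prod_nhds (z₀ : ℝ) :
    Tendsto (fun q : ℝ × ℝ => q.2 - q.1) (𝓝[>] 0 ×ˢ 𝓝 z₀) (𝓝 z₀) := by
  have h : Tendsto (fun q : ℝ × ℝ => q.2 - q.1) (𝓝 0 ×ˢ 𝓝 z₀) (𝓝 (z₀ - 0)) :=
    tendsto_snd.sub tendsto_fst
  rw [sub_zero] at h
  exact h.mono_left (prod_mono_left _ nhdsWithin_le_nhds)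

theorem LogFun.tendsto_comp_sub {g g' : ℝ → ℂ} {P : Polynomial ℂ} (hg : LogFun g g' P) {z₀ : ℝ}
    (hz : z₀ ∈ Ioo (0 : ℝ) 1) :
    Tendsto (fun q : ℝ × ℝ => g (q.2 - q.1)) (𝓝[>] 0 ×ˢ 𝓝 z₀) (𝓝 (g z₀)) :=
  (hg.hasDerivAt z₀ hz).continuousAt.tendsto.comp (tendsto_sub_prod_nhds z₀)

theorem IsKernel.hasDerivAt {φ : ℝ → ℂ} {κ : ℂ} (hφ : IsKernel φ κ) :
    ∀ t ∈ Ioo (0 : ℝ) 1, HasDerivAt φ (deriv φ t) t := fun t ht =>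
  ((hφ.contDiffOn.differentiableOn one_ne_zero t ht).differentiableAt
    (Ioo_mem_nhds ht.1 ht.2)).hasDerivAt

theorem IsKernel.continuousOn_deriv {φ : ℝ → ℂ} {κ : ℂ} (hφ : IsKernel φ κ) :
    ContinuousOn (deriv φ) (Ioo 0 1) :=
  hφ.contDiffOn.continuousOn_deriv_of_isOpen isOpen_Ioo le_rfl

/-- The limit is taken jointly in `(ε, z)`, as needed for exchanging limit and derivative.
Convergence is uniform in `z` near `z₀`, so the limit function is continuous there, and the two
facts together give the joint limit. -/
theorem LogFun.tendsto_truncConv {g g' φ Φ : ℝ → ℂ} {P : Polynomial ℂ} {κ : ℂ}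
    (hg : LogFun g g' P) (hφ : IsKernel φ κ)
    (hΦ : LogFun Φ φ (Polynomial.C κ * Polynomial.X)) {z₀ : ℝ} (hz : z₀ ∈ Ioo (0 : ℝ) 1) :
    Tendsto (fun q : ℝ × ℝ => (∫ t in q.1..(q.2 - q.1), g t * φ (q.2 - t))
      + κ * g q.2 * tlog q.1) (𝓝[>] 0 ×ˢ 𝓝 z₀) (𝓝 (convReg g φ Φ z₀)) := by
  have ha : 0 < z₀ / 2 := by linarith [hz.1]
  have hb : (z₀ + 1) / 2 < 1 := by linarith [hz.2]
  have hI : Icc (z₀ / 2) ((z₀ + 1) / 2) ∈ 𝓝 z₀ :=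
    Icc_mem_nhds (by linarith [hz.1]) (by linarith [hz.2])
  obtain ⟨C, δ, hC, hδ, h⟩ := hg.exists_conv_expansion hφ hΦ ha hb
  set F : ℝ → ℝ → ℂ := fun ε z => (∫ t in ε..(z - ε), g t * φ (z - t)) + κ * g z * tlog ε with hF
  have hFb : ∀ ε z, 0 < ε → ε < z₀ / 2 / 2 → z ∈ Icc (z₀ / 2) ((z₀ + 1) / 2) →
      ‖F ε z - convReg g φ Φ z‖ ≤ C * ε ^ δ := by
    intro ε z h1 h2 h3
    have := h ε z h1 h2 h3
    rwa [show F ε z - convReg g φ Φ z = (∫ t in ε..(z - ε), g t * φ (z - t))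
      - (convReg g φ Φ z - κ * g z * tlog ε) by simp only [hF]; ring]
  have hlim : Tendsto (fun ε : ℝ => C * ε ^ δ) (𝓝[>] 0) (𝓝 0) := by
    have := ((Real.continuousAt_rpow_const 0 δ (Or.inr hδ.le)).tendsto).const_mul C
    rw [Real.zero_rpow hδ.ne', mul_zero] at this
    exact this.mono_left nhdsWithin_le_nhds
  have hev : ∀ᶠ ε in 𝓝[>] (0 : ℝ), ε ∈ Ioo 0 (z₀ / 2 / 2) := Ioo_mem_nhdsGT (by linarith)
  have hunif : TendstoUniformlyOn F (convReg g φ Φ) (𝓝[>] 0)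
      (Icc (z₀ / 2) ((z₀ + 1) / 2)) := by
    rw [Metric.tendstoUniformlyOn_iff]
    intro η hη
    filter_upwards [hev, hlim.eventually_lt_const hη] with ε h1 h2 z h3
    rw [dist_comm, dist_eq_norm]
    exact (hFb ε z h1.1 h1.2 h3).trans_lt h2
  have hcont : ContinuousOn (convReg g φ Φ) (Icc (z₀ / 2) ((z₀ + 1) / 2)) := by
    refine hunif.continuousOn (Eventually.frequently ?_)
    filter_upwards [hev] with ε h1 z h3
    have hz' : z ∈ Ioo (0 : ℝ) 1 := ⟨by linarith [h3.1], by linarith [h3.2]⟩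
    refine ContinuousAt.continuousWithinAt (ContinuousAt.add ?_ ?_)
    · exact (hasDerivAt_truncConv hg.hasDerivAt hg.continuousOn' hφ.hasDerivAt
        hφ.continuousOn_deriv h1.1 (by linarith [h1.2, h3.1]) hz'.2).continuousAt
    · exact (continuousAt_const.mul (hg.hasDerivAt z hz').continuousAt).mul continuousAt_const
  have h1 : Tendsto (fun q : ℝ × ℝ => F q.1 q.2 - convReg g φ Φ q.2) (𝓝[>] 0 ×ˢ 𝓝 z₀)
      (𝓝 0) := by
    refine squeeze_zero_norm' ?_ (hlim.comp tendsto_fst)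
    filter_upwards [hev.prod_mk hI] with q hq
    exact hFb q.1 q.2 hq.1.1 hq.1.2 hq.2
  have h2 := h1.add ((hcont.continuousAt hI).tendsto.comp
    (tendsto_snd (f := 𝓝[>] (0 : ℝ)) (g := 𝓝 z₀)))
  rw [zero_add] at h2
  exact h2.congr fun q => sub_add_cancel _ _

/-- The kernel is Lipschitz near `z₀`, so the difference is `O(ε)` and beats every power of the
logarithm. -/
theorem IsKernel.tendsto_tlog_pow_mul {φ : ℝ → ℂ} {κ : ℂ} (hφ : IsKernel φ κ) {z₀ : ℝ}
    (hz : z₀ ∈ Ioo (0 : ℝ) 1) (m : ℕ) :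
    Tendsto (fun q : ℝ × ℝ => tlog q.1 ^ m * (φ (q.2 - q.1) - φ q.2)) (𝓝[>] 0 ×ˢ 𝓝 z₀)
      (𝓝 0) := by
  have ha : 0 < z₀ / 4 := by linarith [hz.1]
  have hb : (z₀ + 1) / 2 < 1 := by linarith [hz.2]
  obtain ⟨M, hM, h⟩ := exists_lipschitz_bound ha hb hφ.hasDerivAt hφ.continuousOn_deriv
  have hn : Negl fun ε => (ε : ℂ) * (Polynomial.X ^ m : Polynomial ℂ).eval (tlog ε) :=
    negl_ofReal.mul (subpoly_eval _)
  have h0 : Tendsto (fun ε : ℝ => M * ‖(ε : ℂ) * tlog ε ^ m‖) (𝓝[>] 0) (𝓝 0) := by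
    have := (hn.tendsto.norm).const_mul M
    simpa using this
  refine squeeze_zero_norm' ?_ (h0.comp tendsto_fst)
  have h1 : ∀ᶠ ε in 𝓝[>] (0 : ℝ), ε ∈ Ioo 0 (z₀ / 4) := Ioo_mem_nhdsGT ha
  have h2 : ∀ᶠ z in 𝓝 z₀, z ∈ Ioo (z₀ / 2) ((z₀ + 1) / 2) :=
    Ioo_mem_nhds (by linarith [hz.1]) (by linarith [hz.2])
  filter_upwards [h1.prod_mk h2] with q hq
  obtain ⟨⟨e1, e2⟩, e3, e4⟩ := hq
  have h3 := h (q.2 - q.1) ⟨by linarith, by linarith⟩ q.2 ⟨by linarith, by linarith⟩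
  rw [sub_sub_cancel_left, abs_neg, abs_of_pos e1] at h3
  simp only [Function.comp, norm_mul, Complex.norm_real, Real.norm_of_nonneg e1.le]
  nlinarith [norm_nonneg (tlog q.1 ^ m)]

end EllipticPolylog

end

noncomputable section
namespace EllipticPolylog
open Filter Topology MeasureTheory Set
open scoped MvPowerSeries.WithPiTopology

/-! ### Generating series of regularized iterated integrals -/

section PowerSeries

variable {σ : Type*}

/-- The generating series of the functions `regIter`. -/
def iterSeries (τ : UpperHalfPlane) (n : ℕ) (w : ℕ → MvPowerSeries σ ℂ) (z : ℝ) :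
    MvPowerSeries σ ℂ :=
  genSeries (fun p : Fin n => w p) fun k => regIter τ n k z

/-- The generating series of the functions `regIterLast`. -/
def iterLastSeries (τ : UpperHalfPlane) (n : ℕ) (w : ℕ → MvPowerSeries σ ℂ) (z : ℝ) :
    MvPowerSeries σ ℂ :=
  genSeries (fun p : Fin (n + 1) => w p) fun k => regIterLast τ n k z

/-- The integrals `∫_ε^{z-ε}` whose regularized values are the functions `regIterLast`. -/
def truncLast (τ : UpperHalfPlane) (n : ℕ) (q : ℝ × ℝ) (k : Fin (n + 1) → ℕ) : ℂ :=
  ∫ t in q.1..(q.2 - q.1), regIter τ n (fun i => k i.castSucc) t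
    * kernelCoeff τ (k (Fin.last n)) (-((q.2 - t : ℝ) : ℂ))

theorem genSeries_congr_seq {n : ℕ} {w w' : ℕ → MvPowerSeries σ ℂ} (h : ∀ p < n, w p = w' p)
    (c : (Fin n → ℕ) → ℂ) :
    genSeries (fun p : Fin n => w p) c = genSeries (fun p : Fin n => w' p) c := by
  congr 1
  funext p
  exact h p p.2

theorem genSeries_mul_seq {n : ℕ} {w : ℕ → MvPowerSeries σ ℂ}
    (hw : ∀ j, MvPowerSeries.constantCoeff (w j) = 0) (a : (Fin n → ℕ) → ℂ) (b : ℕ → ℂ) :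
    genSeries (fun p : Fin (n + 1) => w p)
        (fun k => a (fun i => k i.castSucc) * b (k (Fin.last n)))
      = genSeries (fun p : Fin n => w p) a * genSeriesOne (w n) b :=
  genSeries_mul (v := fun p : Fin (n + 1) => w p) (fun _ => hw _) a b

theorem continuousOn_regIter (τ : UpperHalfPlane) (n : ℕ) (k : Fin n → ℕ) :
    ContinuousOn (regIter τ n k) (Ioo 0 1) := by
  obtain ⟨g', hg⟩ := exists_logFun_regIter τ n k
  exact hg.continuousOn

theorem continuousOn_kernelCoeff_neg_sub (τ : UpperHalfPlane) (j : ℕ) {ε z : ℝ} (hε : 0 < ε)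
    (hz : z < 1) :
    ContinuousOn (fun t => kernelCoeff τ j (-((z - t : ℝ) : ℂ))) (Icc ε (z - ε)) :=
  (isKernel_kernelCoeff_neg τ j).continuousOn.comp (f := fun t => z - t) (by fun_prop)
    fun t ht => ⟨by linarith [ht.2], by linarith [ht.1]⟩

theorem intervalIntegrable_truncLast (τ : UpperHalfPlane) (n : ℕ) (k : Fin (n + 1) → ℕ)
    {ε z : ℝ} (hε : 0 < ε) (hεz : 2 * ε < z) (hz : z < 1) :
    IntervalIntegrable (fun t => regIter τ n (fun i => k i.castSucc) t
      * kernelCoeff τ (k (Fin.last n)) (-((z - t : ℝ) : ℂ))) volume ε (z - ε) := by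
  refine ContinuousOn.intervalIntegrable ?_
  rw [uIcc_of_le (by linarith)]
  exact ((continuousOn_regIter τ n _).mono (Icc_subset_Ioo hε (by linarith))).mul
    (continuousOn_kernelCoeff_neg_sub τ _ hε hz)

theorem intervalIntegrable_regIter_mul (τ : UpperHalfPlane) (n : ℕ) (k : Fin (n + 1) → ℕ)
    {ε z : ℝ} (hε : 0 < ε) (hεz : 2 * ε < z) (hz : z < 1) :
    IntervalIntegrable (fun t => regIter τ n (fun i => k i.castSucc) t
      * kernelCoeff τ (k (Fin.last n)) t) volume ε (z - ε) := by
  refine ContinuousOn.intervalIntegrable ?_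
  rw [uIcc_of_le (by linarith)]
  have hsub : Icc ε (z - ε) ⊆ Ioo 0 1 := Icc_subset_Ioo hε (by linarith)
  exact ((continuousOn_regIter τ n _).mono hsub).mul
    ((isKernel_kernelCoeff τ _).continuousOn.mono hsub)

theorem integral_regIter_mul (τ : UpperHalfPlane) (n : ℕ) (k : Fin (n + 1) → ℕ)
    {ε z : ℝ} (hε : 0 < ε) (hεz : 2 * ε < z) (hz : z < 1) :
    ∫ t in ε..(z - ε), regIter τ n (fun i => k i.castSucc) t * kernelCoeff τ (k (Fin.last n)) t
      = regIter τ (n + 1) k (z - ε) - regIter τ (n + 1) k ε := by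
  refine intervalIntegral.integral_eq_sub_of_hasDerivAt (fun t ht => ?_)
    (intervalIntegrable_regIter_mul τ n k hε hεz hz)
  rw [uIcc_of_le (by linarith)] at ht
  exact (logFun_regIter_succ τ n k).hasDerivAt t ⟨by linarith [ht.1], by linarith [ht.2]⟩

theorem theta_ofReal_ne_zero' (τ : UpperHalfPlane) {t : ℝ} (ht : t ∈ Ioo (0 : ℝ) 1) :
    theta τ t ≠ 0 :=
  theta_ofReal_ne_zero τ ht.1.ne' (by rw [abs_of_pos ht.1]; exact ht.2)

/-- The Fay identity under the integral sign. -/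
theorem fay_integral (τ : UpperHalfPlane) (n : ℕ) {w w' : ℕ → MvPowerSeries σ ℂ}
    (hw : ∀ j, MvPowerSeries.constantCoeff (w j) = 0)
    (hw' : ∀ j, MvPowerSeries.constantCoeff (w' j) = 0)
    (h : ∀ p < n, w' p = w p) (hn : w' n = w n + w (n + 1))
    {ε z : ℝ} (hε : 0 < ε) (hεz : 2 * ε < z) (hz : z < 1) :
    (w n + w (n + 1)) * genSeries (fun p : Fin (n + 2) => w p) (fun k => ∫ t in ε..(z - ε),
        (regIter τ n (fun i => k i.castSucc.castSucc) t
          * kernelCoeff τ (k (Fin.last n).castSucc) t)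
        * kernelCoeff τ (k (Fin.last (n + 1))) (-((z - t : ℝ) : ℂ)))
      = w (n + 1) * kerSeries τ z (w n)
          * genSeries (fun p : Fin (n + 1) => w' p) (truncLast τ n (ε, z))
        + w n * kerSeries τ (-z) (w (n + 1))
          * (iterSeries τ (n + 1) w' (z - ε) - iterSeries τ (n + 1) w' ε) := by
  have hle : ε ≤ z - ε := by linarith
  have hsub : Icc ε (z - ε) ⊆ Ioo 0 1 := Icc_subset_Ioo hε (by linarith)
  have e0 : iterSeries τ (n + 1) w' (z - ε) - iterSeries τ (n + 1) w' ε
      = genSeries (fun p : Fin (n + 1) => w' p) fun k => ∫ t in ε..(z - ε),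
          regIter τ n (fun i => k i.castSucc) t * kernelCoeff τ (k (Fin.last n)) t := by
    rw [sub_eq_iff_eq_add, iterSeries, iterSeries, ← genSeries_add fun _ => hw' _]
    congr 1
    funext k
    rw [integral_regIter_mul τ n k hε hεz hz, sub_add_cancel]
  rw [e0]
  have i1 : ∀ k : Fin (n + 2) → ℕ, IntervalIntegrable (fun t =>
      (regIter τ n (fun i => k i.castSucc.castSucc) t * kernelCoeff τ (k (Fin.last n).castSucc) t)
        * kernelCoeff τ (k (Fin.last (n + 1))) (-((z - t : ℝ) : ℂ))) volume ε (z - ε) := by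
    intro k
    refine ContinuousOn.intervalIntegrable ?_
    rw [uIcc_of_le hle]
    exact (((continuousOn_regIter τ n _).mono hsub).mul
      ((isKernel_kernelCoeff τ _).continuousOn.mono hsub)).mul
      (continuousOn_kernelCoeff_neg_sub τ _ hε hz)
  have i2 := fun k => intervalIntegrable_truncLast τ n k hε hεz hz
  have i3 := fun k => intervalIntegrable_regIter_mul τ n k hε hεz hz
  ext e
  obtain ⟨-, c1⟩ := coeff_mul_genSeries_integral
    (v := fun p : Fin (n + 2) => w p) (fun _ => hw _) (w n + w (n + 1)) i1 e
  obtain ⟨j2, c2⟩ := coeff_mul_genSeries_integral (v := fun p : Fin (n + 1) => w' p)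
    (fun _ => hw' _) (w (n + 1) * kerSeries τ z (w n)) i2 e
  obtain ⟨j3, c3⟩ := coeff_mul_genSeries_integral (v := fun p : Fin (n + 1) => w' p)
    (fun _ => hw' _) (w n * kerSeries τ (-z) (w (n + 1))) i3 e
  have c2' : MvPowerSeries.coeff e (w (n + 1) * kerSeries τ z (w n)
      * genSeries (fun p : Fin (n + 1) => w' p) (truncLast τ n (ε, z))) = _ := c2
  rw [map_add, c1, c2', c3, ← intervalIntegral.integral_add j2 j3]
  refine intervalIntegral.integral_congr fun t ht => ?_
  rw [uIcc_of_le hle] at ht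
  have ht1 := hsub ht
  have hzt : z - t ∈ Ioo (0 : ℝ) 1 := ⟨by linarith [ht.2], by linarith [ht.1]⟩
  have hcast : -((z - t : ℝ) : ℂ) = (t : ℂ) - z := by push_cast; ring
  have hth : theta τ ((t : ℂ) - z) ≠ 0 := by
    rw [← hcast, theta_neg, neg_ne_zero]
    exact theta_ofReal_ne_zero' τ hzt
  have g1 : genSeries (fun p : Fin (n + 2) => w p) (fun k =>
      (regIter τ n (fun i => k i.castSucc.castSucc) t * kernelCoeff τ (k (Fin.last n).castSucc) t)
        * kernelCoeff τ (k (Fin.last (n + 1))) (-((z - t : ℝ) : ℂ)))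
      = iterSeries τ n w t * kerSeries τ t (w n) * kerSeries τ (t - z) (w (n + 1)) := by
    have := genSeries_mul_seq hw (n := n + 1) (fun k => regIter τ n (fun i => k i.castSucc) t
      * kernelCoeff τ (k (Fin.last n)) t) fun j => kernelCoeff τ j (-((z - t : ℝ) : ℂ))
    rw [this, genSeries_mul_seq hw (fun k => regIter τ n k t) fun j => kernelCoeff τ j t, hcast]
    rfl
  have gc : genSeries (fun p : Fin n => w' p) (fun k => regIter τ n k t) = iterSeries τ n w t :=
    genSeries_congr_seq h _
  have g2 : genSeries (fun p : Fin (n + 1) => w' p) (fun k => regIter τ n (fun i => k i.castSucc) t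
      * kernelCoeff τ (k (Fin.last n)) (-((z - t : ℝ) : ℂ)))
      = iterSeries τ n w t * kerSeries τ (t - z) (w n + w (n + 1)) := by
    rw [genSeries_mul_seq hw' (fun k => regIter τ n k t)
      fun j => kernelCoeff τ j (-((z - t : ℝ) : ℂ)), gc, hcast, hn]
    rfl
  have g3 : genSeries (fun p : Fin (n + 1) => w' p) (fun k => regIter τ n (fun i => k i.castSucc) t
      * kernelCoeff τ (k (Fin.last n)) t)
      = iterSeries τ n w t * kerSeries τ t (w n + w (n + 1)) := by
    rw [genSeries_mul_seq hw' (fun k => regIter τ n k t) fun j => kernelCoeff τ j t, gc, hn]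
    rfl
  -- With `s = t - z` the differences `t - s = z` and `s - t = -z` no longer involve `t`. On the
  -- right each term has a single kernel in the integration variable, and the other factor leaves
  -- the integral.
  have fay := kerSeries_fay τ (theta_ofReal_ne_zero' τ ht1) hth (s := (t : ℂ) - z)
    (by rw [sub_sub_cancel]; exact theta_ofReal_ne_zero' τ ⟨by linarith, hz⟩) (hw n) (hw (n + 1))
  rw [sub_sub_cancel, sub_sub_cancel_left] at fay
  simp only [g1, g2, g3]
  rw [← map_add]
  congr 1
  linear_combination iterSeries τ n w t * fay

end PowerSeries

end EllipticPolylog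

end

noncomputable section
namespace EllipticPolylog
open Filter Topology MeasureTheory Set
open scoped MvPowerSeries.WithPiTopology

/-! ### The differential equation of the shifted generating series -/

section PowerSeries

variable {σ : Type*}

theorem genSeries_zero_fun {n : ℕ} {v : Fin n → MvPowerSeries σ ℂ}
    (hv : ∀ i, MvPowerSeries.constantCoeff (v i) = 0) : genSeries v (fun _ => 0) = 0 := by
  ext e
  rw [coeff_genSeries hv _ le_rfl]
  simp

/-- `truncLast`, with its logarithmic divergence removed. -/
def truncLastReg (τ : UpperHalfPlane) (n : ℕ) (q : ℝ × ℝ) (k : Fin (n + 1) → ℕ) : ℂ :=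
  truncLast τ n q k
    + regIter τ n (fun i => k i.castSucc) q.2 * (if k (Fin.last n) = 1 then -tlog q.1 else 0)

theorem tendsto_truncLastReg (τ : UpperHalfPlane) (n : ℕ) (k : Fin (n + 1) → ℕ) {z₀ : ℝ}
    (hz : z₀ ∈ Ioo (0 : ℝ) 1) :
    Tendsto (fun q => truncLastReg τ n q k) (𝓝[>] 0 ×ˢ 𝓝 z₀) (𝓝 (regIterLast τ n k z₀)) := by
  obtain ⟨g', hg⟩ := exists_logFun_regIter τ n fun i => k i.castSucc
  refine (hg.tendsto_truncConv (isKernel_kernelCoeff_neg τ (k (Fin.last n)))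
    (logFun_regPrimNeg τ (k (Fin.last n))) hz).congr fun q => ?_
  rw [truncLastReg, truncLast]
  congr 1
  split_ifs <;> ring

theorem tendsto_kernelCoeff (τ : UpperHalfPlane) (j : ℕ) {z₀ : ℝ} (hz : z₀ ∈ Ioo (0 : ℝ) 1) :
    Tendsto (fun t : ℝ => kernelCoeff τ j t) (𝓝 z₀) (𝓝 (kernelCoeff τ j z₀)) :=
  (((isKernel_kernelCoeff τ j).continuousOn).continuousAt (Ioo_mem_nhds hz.1 hz.2)).tendsto

theorem tendsto_kernelCoeff_neg (τ : UpperHalfPlane) (j : ℕ) {z₀ : ℝ} (hz : z₀ ∈ Ioo (0 : ℝ) 1) :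
    Tendsto (fun t : ℝ => kernelCoeff τ j (-(t : ℂ))) (𝓝 z₀) (𝓝 (kernelCoeff τ j (-(z₀ : ℂ)))) :=
  (((isKernel_kernelCoeff_neg τ j).continuousOn).continuousAt (Ioo_mem_nhds hz.1 hz.2)).tendsto

/-- The part of `iterSeries` that vanishes at `0`. -/
def iterSeriesRem (τ : UpperHalfPlane) (n : ℕ) (w : ℕ → MvPowerSeries σ ℂ) (t : ℝ) :
    MvPowerSeries σ ℂ :=
  genSeries (fun p : Fin n => w p) fun k => regIter τ n k t - (regIterPoly n k).eval (tlog t)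

theorem iterSeries_eq_add (τ : UpperHalfPlane) (n : ℕ) {w : ℕ → MvPowerSeries σ ℂ}
    (hw : ∀ j, MvPowerSeries.constantCoeff (w j) = 0) (t : ℝ) :
    iterSeries τ n w t
      = iterSeriesRem τ n w t + (tlog t ^ n / n.factorial) • ∏ p : Fin n, w p := by
  rw [iterSeriesRem, ← genSeries_indicator_one fun _ => hw _, ← genSeries_add fun _ => hw _,
    iterSeries]
  congr 1
  funext k
  rw [regIterPoly]
  split_ifs
  · simp only [Polynomial.eval_mul, Polynomial.eval_C, Polynomial.eval_pow, Polynomial.eval_X]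
    ring
  · simp

theorem tendsto_iterSeriesRem (τ : UpperHalfPlane) (n : ℕ) {w : ℕ → MvPowerSeries σ ℂ}
    (hw : ∀ j, MvPowerSeries.constantCoeff (w j) = 0) :
    Tendsto (iterSeriesRem τ n w) (𝓝[>] 0) (𝓝 0) := by
  rw [← genSeries_zero_fun (v := fun p : Fin n => w p) fun _ => hw _]
  refine tendsto_genSeries (fun _ => hw _) fun k => ?_
  obtain ⟨g', hg⟩ := exists_logFun_regIter τ n k
  exact hg.asymp.tendsto

/-- The two products have the same divergent leading part, `tlog ε ^ (n + 1) / (n + 1)!` times `w n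
* w' n * ∏_{p < n} w p`. That part meets only the difference of the kernels at `z - ε` and `z`,
which is `O(ε)`, while the remainders of the two series tend to `0`. -/
theorem tendsto_boundary (τ : UpperHalfPlane) (n : ℕ) {w w' : ℕ → MvPowerSeries σ ℂ}
    (hw : ∀ j, MvPowerSeries.constantCoeff (w j) = 0)
    (hw' : ∀ j, MvPowerSeries.constantCoeff (w' j) = 0)
    (h : ∀ p < n, w' p = w p) (y : MvPowerSeries σ ℂ)
    (hy : MvPowerSeries.constantCoeff y = 0) {z₀ : ℝ} (hz : z₀ ∈ Ioo (0 : ℝ) 1) :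
    Tendsto (fun q : ℝ × ℝ => w' n * iterSeries τ (n + 1) w q.1
        * kerSeries τ (-((q.2 - q.1 : ℝ) : ℂ)) y
      - w n * iterSeries τ (n + 1) w' q.1 * kerSeries τ (-(q.2 : ℂ)) y)
      (𝓝[>] 0 ×ˢ 𝓝 z₀) (𝓝 0) := by
  have k1 : Tendsto (fun q : ℝ × ℝ => kerSeries τ (-((q.2 - q.1 : ℝ) : ℂ)) y)
      (𝓝[>] 0 ×ˢ 𝓝 z₀) (𝓝 (kerSeries τ (-(z₀ : ℂ)) y)) :=
    tendsto_genSeriesOne hy fun j => (tendsto_kernelCoeff_neg τ j hz).comp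
      (tendsto_sub_prod_nhds z₀)
  have k2 : Tendsto (fun q : ℝ × ℝ => kerSeries τ (-(q.2 : ℂ)) y)
      (𝓝[>] 0 ×ˢ 𝓝 z₀) (𝓝 (kerSeries τ (-(z₀ : ℂ)) y)) :=
    tendsto_genSeriesOne hy fun j => (tendsto_kernelCoeff_neg τ j hz).comp tendsto_snd
  have k3 : Tendsto (fun q : ℝ × ℝ => genSeriesOne y fun j => tlog q.1 ^ (n + 1)
      * (kernelCoeff τ j (-((q.2 - q.1 : ℝ) : ℂ)) - kernelCoeff τ j (-(q.2 : ℂ))))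
      (𝓝[>] 0 ×ˢ 𝓝 z₀) (𝓝 0) := by
    rw [← genSeries_zero_fun (v := fun _ : Fin 1 => y) fun _ => hy]
    exact tendsto_genSeriesOne (c₀ := fun _ => 0) hy fun j =>
      (isKernel_kernelCoeff_neg τ j).tendsto_tlog_pow_mul hz (n + 1)
  have e1 := (tendsto_iterSeriesRem τ (n + 1) hw).comp
    (tendsto_fst (f := 𝓝[>] (0 : ℝ)) (g := 𝓝 z₀))
  have e2 := (tendsto_iterSeriesRem τ (n + 1) hw').comp
    (tendsto_fst (f := 𝓝[>] (0 : ℝ)) (g := 𝓝 z₀))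
  have key := (((e1.const_mul (w' n)).mul k1).sub ((e2.const_mul (w n)).mul k2)).add
    (k3.const_mul (algebraMap ℂ _ (1 / (n + 1).factorial : ℂ)
      * (w n * w' n * ∏ p : Fin n, w p)))
  simp only [mul_zero, zero_mul, sub_zero, add_zero] at key
  refine key.congr fun q => ?_
  have e3 : (genSeriesOne y fun j => tlog q.1 ^ (n + 1)
      * (kernelCoeff τ j (-((q.2 - q.1 : ℝ) : ℂ)) - kernelCoeff τ j (-(q.2 : ℂ))))
      = algebraMap ℂ _ (tlog q.1 ^ (n + 1)) * (kerSeries τ (-((q.2 - q.1 : ℝ) : ℂ)) y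
        - kerSeries τ (-(q.2 : ℂ)) y) := by
    rw [← Algebra.smul_def, genSeriesOne, genSeries_smul fun _ => hy]
    congr 1
    rw [eq_sub_iff_add_eq, kerSeries, kerSeries, genSeriesOne, genSeriesOne,
      ← genSeries_add fun _ => hy]
    simp only [sub_add_cancel]
  have p1 : ∏ p : Fin (n + 1), w p = (∏ p : Fin n, w p) * w n := by
    rw [Fin.prod_univ_castSucc]
    rfl
  have p2 : ∏ p : Fin (n + 1), w' p = (∏ p : Fin n, w p) * w' n := by
    rw [Fin.prod_univ_castSucc]
    congr 1
    exact Finset.prod_congr rfl fun p _ => h p p.2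
  have e4 : algebraMap ℂ (MvPowerSeries σ ℂ) (tlog q.1 ^ (n + 1) / (n + 1).factorial)
      = algebraMap ℂ _ (tlog q.1 ^ (n + 1)) * algebraMap ℂ _ (1 / (n + 1).factorial : ℂ) := by
    rw [← map_mul, mul_one_div]
  rw [e3, iterSeries_eq_add τ (n + 1) hw, iterSeries_eq_add τ (n + 1) hw', p1, p2]
  simp only [Function.comp, Algebra.smul_def, e4]
  ring

/-- The integrals `truncLastReg` are differentiated for fixed `ε`, and their derivatives converge
jointly in `(ε, z)`, which justifies exchanging the limit with `d/dz`. The factor `w' n = w n + w (n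
+ 1)` clears the denominator of the Fay identity. After that identity the subtracted logarithms on
the two sides agree, and the terms from the ends of the interval are those of `tendsto_boundary`. -/
theorem hasDerivAt_iterLastSeries (τ : UpperHalfPlane) (n : ℕ) {w w' : ℕ → MvPowerSeries σ ℂ}
    (hw : ∀ j, MvPowerSeries.constantCoeff (w j) = 0)
    (hw' : ∀ j, MvPowerSeries.constantCoeff (w' j) = 0)
    (h : ∀ p < n, w' p = w p) (hn : w' n = w n + w (n + 1)) {z₀ : ℝ} (hz : z₀ ∈ Ioo (0 : ℝ) 1)
    (e : σ →₀ ℕ) :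
    HasDerivAt (fun z => MvPowerSeries.coeff e (w' n * iterLastSeries τ (n + 1) w z))
      (MvPowerSeries.coeff e (w (n + 1) * kerSeries τ z₀ (w n) * iterLastSeries τ n w' z₀
        + w n * kerSeries τ (-z₀) (w (n + 1)) * iterSeries τ (n + 1) w' z₀)) z₀ := by
  set d : ℝ × ℝ → (Fin (n + 2) → ℕ) → ℂ := fun q k =>
    (regIter τ (n + 1) (fun i => k i.castSucc) q.1
        * kernelCoeff τ (k (Fin.last (n + 1))) (-((q.2 - q.1 : ℝ) : ℂ))
      + ∫ t in q.1..(q.2 - q.1), (regIter τ n (fun i => k i.castSucc.castSucc) t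
          * kernelCoeff τ (k (Fin.last n).castSucc) t)
        * kernelCoeff τ (k (Fin.last (n + 1))) (-((q.2 - t : ℝ) : ℂ)))
    + (regIter τ n (fun i => k i.castSucc.castSucc) q.2
        * kernelCoeff τ (k (Fin.last n).castSucc) q.2)
      * (if k (Fin.last (n + 1)) = 1 then -tlog q.1 else 0) with hd
  have hderiv : ∀ᶠ q : ℝ × ℝ in 𝓝[>] 0 ×ˢ 𝓝 z₀, HasDerivAt
      (fun z => MvPowerSeries.coeff e (w' n * genSeries (fun p : Fin (n + 2) => w p)
        (truncLastReg τ (n + 1) (q.1, z))))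
      (MvPowerSeries.coeff e (w' n * genSeries (fun p : Fin (n + 2) => w p) (d q))) q.2 := by
    filter_upwards [eventually_prod_nhds hz] with q hq
    refine hasDerivAt_coeff_mul_genSeries (v := fun p : Fin (n + 2) => w p) (fun _ => hw _) _
      (fun k => ?_) e
    have hg := logFun_regIter_succ τ n fun i => k i.castSucc
    have hφ := isKernel_kernelCoeff_neg τ (k (Fin.last (n + 1)))
    have h1 := hasDerivAt_truncConv hg.hasDerivAt hg.continuousOn' hφ.hasDerivAt
      hφ.continuousOn_deriv hq.1 hq.2.1 hq.2.2
    have hq2 : q.2 ∈ Ioo (0 : ℝ) 1 := ⟨by linarith [hq.1, hq.2.1], hq.2.2⟩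
    exact h1.add ((hg.hasDerivAt q.2 hq2).mul_const
      (if k (Fin.last (n + 1)) = 1 then -tlog q.1 else 0))
  have hpt : ∀ᶠ z in 𝓝 z₀, Tendsto (fun ε => MvPowerSeries.coeff e (w' n
      * genSeries (fun p : Fin (n + 2) => w p) (truncLastReg τ (n + 1) (ε, z)))) (𝓝[>] 0)
      (𝓝 (MvPowerSeries.coeff e (w' n * iterLastSeries τ (n + 1) w z))) := by
    filter_upwards [Ioo_mem_nhds hz.1 hz.2] with z hz'
    have h1 : Tendsto (fun ε : ℝ => (ε, z)) (𝓝[>] 0) (𝓝[>] 0 ×ˢ 𝓝 z) :=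
      tendsto_id.prodMk tendsto_const_nhds
    have h2 := tendsto_genSeries (v := fun p : Fin (n + 2) => w p) (fun _ => hw _)
      fun k => (tendsto_truncLastReg τ (n + 1) k hz').comp h1
    exact ((MvPowerSeries.WithPiTopology.continuous_coeff ℂ e).tendsto _).comp
      (h2.const_mul (w' n))
  refine hasDerivAt_of_tendstoUniformlyOnFilter (g' := fun _ => MvPowerSeries.coeff e
    (w (n + 1) * kerSeries τ z₀ (w n) * iterLastSeries τ n w' z₀
        + w n * kerSeries τ (-z₀) (w (n + 1)) * iterSeries τ (n + 1) w' z₀))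
    (f' := fun ε z => MvPowerSeries.coeff e (w' n
      * genSeries (fun p : Fin (n + 2) => w p) (d (ε, z)))) ?_ hderiv hpt
  -- The comparison function is constant in `z`, so uniform convergence near `z₀` is just the limit
  -- along the product filter.
  rw [tendstoUniformlyOnFilter_iff_tendsto]
  refine (Filter.Tendsto.prodMk_nhds tendsto_const_nhds ?_).mono_right (nhds_le_uniformity _)
  refine ((MvPowerSeries.WithPiTopology.continuous_coeff ℂ e).tendsto _).comp ?_
  have k1 : Tendsto (fun q : ℝ × ℝ => kerSeries τ (q.2 : ℂ) (w n))
      (𝓝[>] 0 ×ˢ 𝓝 z₀) (𝓝 (kerSeries τ (z₀ : ℂ) (w n))) :=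
    tendsto_genSeriesOne (hw n) fun j => (tendsto_kernelCoeff τ j hz).comp tendsto_snd
  have k2 : Tendsto (fun q : ℝ × ℝ => kerSeries τ (-(q.2 : ℂ)) (w (n + 1)))
      (𝓝[>] 0 ×ˢ 𝓝 z₀) (𝓝 (kerSeries τ (-(z₀ : ℂ)) (w (n + 1)))) :=
    tendsto_genSeriesOne (hw (n + 1)) fun j =>
      (tendsto_kernelCoeff_neg τ j hz).comp tendsto_snd
  have k3 : Tendsto (fun q => genSeries (fun p : Fin (n + 1) => w' p) (truncLastReg τ n q))
      (𝓝[>] 0 ×ˢ 𝓝 z₀) (𝓝 (iterLastSeries τ n w' z₀)) :=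
    tendsto_genSeries (fun _ => hw' _) fun k => tendsto_truncLastReg τ n k hz
  have k4 : Tendsto (fun q : ℝ × ℝ => iterSeries τ (n + 1) w' (q.2 - q.1))
      (𝓝[>] 0 ×ˢ 𝓝 z₀) (𝓝 (iterSeries τ (n + 1) w' z₀)) :=
    tendsto_genSeries (fun _ => hw' _) fun k => (logFun_regIter_succ τ n k).tendsto_comp_sub hz
  have k5 := tendsto_boundary τ n hw hw' h (w (n + 1)) (hw (n + 1)) hz
  have key := (((k1.const_mul (w (n + 1))).mul k3).add ((k2.const_mul (w n)).mul k4)).add k5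
  rw [add_zero] at key
  refine key.congr' ?_
  filter_upwards [eventually_prod_nhds hz] with q hq
  have hcc := hw (n + 1)
  have s1 : genSeries (fun p : Fin (n + 2) => w p) (d q)
      = iterSeries τ (n + 1) w q.1 * kerSeries τ (-((q.2 - q.1 : ℝ) : ℂ)) (w (n + 1))
        + genSeries (fun p : Fin (n + 2) => w p) (fun k => ∫ t in q.1..(q.2 - q.1),
          (regIter τ n (fun i => k i.castSucc.castSucc) t
            * kernelCoeff τ (k (Fin.last n).castSucc) t)
          * kernelCoeff τ (k (Fin.last (n + 1))) (-((q.2 - t : ℝ) : ℂ)))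
        + iterSeries τ n w q.2 * kerSeries τ q.2 (w n) * ((-tlog q.1) • w (n + 1)) := by
    simp only [hd]
    rw [genSeries_add fun _ => hw _, genSeries_add fun _ => hw _,
      genSeries_mul_seq hw (fun k => regIter τ (n + 1) k q.1)
        fun j => kernelCoeff τ j (-((q.2 - q.1 : ℝ) : ℂ)),
      genSeries_mul_seq hw (fun k => regIter τ n (fun i => k i.castSucc) q.2
        * kernelCoeff τ (k (Fin.last n)) q.2) fun j => if j = 1 then -tlog q.1 else 0,
      genSeries_mul_seq hw (fun k => regIter τ n k q.2) fun j => kernelCoeff τ j q.2,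
      genSeriesOne_indicator_one hcc]
    rfl
  have s2 : genSeries (fun p : Fin (n + 1) => w' p) (truncLastReg τ n q)
      = genSeries (fun p : Fin (n + 1) => w' p) (truncLast τ n q)
        + iterSeries τ n w q.2 * ((-tlog q.1) • w' n) := by
    have : truncLastReg τ n q = fun k => truncLast τ n q k
      + regIter τ n (fun i => k i.castSucc) q.2
        * (if k (Fin.last n) = 1 then -tlog q.1 else 0) := rfl
    rw [this, genSeries_add fun _ => hw' _,
      genSeries_mul_seq hw' (fun k => regIter τ n k q.2) fun j => if j = 1 then -tlog q.1 else 0,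
      genSeriesOne_indicator_one (hw' n), genSeries_congr_seq h]
    rfl
  have s3 := fay_integral τ n hw hw' h hn hq.1 hq.2.1 hq.2.2
  rw [← hn] at s3
  rw [s1, s2, mul_add (w' n), mul_add (w' n), s3]
  simp only [Algebra.smul_def]
  ring

end PowerSeries

end EllipticPolylog

end

noncomputable section
namespace EllipticPolylog
open Filter Topology MeasureTheory Set

/-! ### Regularized values and derivatives of families of fractions -/

theorem HasRegValue.add {f g : ℝ → ℂ} {a b : ℂ} (hf : HasRegValue f a) (hg : HasRegValue g b) :
    HasRegValue (fun t => f t + g t) (a + b) := by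
  obtain ⟨P, hP, hfP⟩ := hasRegValue_iff.1 hf
  obtain ⟨Q, hQ, hgQ⟩ := hasRegValue_iff.1 hg
  refine hasRegValue_iff.2 ⟨P + Q, by rw [Polynomial.coeff_add, hP, hQ],
    (hfP.add hgQ).congr' (Eventually.of_forall fun t => ?_)⟩
  simp only [Polynomial.eval_add]
  ring

theorem HasRegValue.const_mul {f : ℝ → ℂ} {a : ℂ} (c : ℂ) (hf : HasRegValue f a) :
    HasRegValue (fun t => c * f t) (c * a) := by
  obtain ⟨P, hP, hfP⟩ := hasRegValue_iff.1 hf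
  refine hasRegValue_iff.2 ⟨Polynomial.C c * P, by rw [Polynomial.coeff_C_mul, hP],
    (hfP.mul (subpoly_eval (Polynomial.C c))).congr' (Eventually.of_forall fun t => ?_)⟩
  simp only [Polynomial.eval_mul, Polynomial.eval_C]
  ring

theorem HasRegValue.const (c : ℂ) : HasRegValue (fun _ => c) c :=
  hasRegValue_iff.2 ⟨Polynomial.C c, Polynomial.coeff_C_zero,
    Negl.zero.congr' (Eventually.of_forall fun t => by simp)⟩

theorem HasRegValue.congr' {f g : ℝ → ℂ} {c : ℂ} (hf : HasRegValue f c) (h : f =ᶠ[𝓝[>] 0] g) :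
    HasRegValue g c := by
  obtain ⟨P, hP, hfP⟩ := hasRegValue_iff.1 hf
  refine hasRegValue_iff.2 ⟨P, hP, hfP.congr' ?_⟩
  filter_upwards [h] with t ht
  rw [ht]

theorem HasRegValue.sum {ι : Type*} {s : Finset ι} {f : ι → ℝ → ℂ} {c : ι → ℂ}
    (h : ∀ i ∈ s, HasRegValue (f i) (c i)) :
    HasRegValue (fun t => ∑ i ∈ s, f i t) (∑ i ∈ s, c i) := by
  classical
  induction s using Finset.induction_on with
  | empty => simpa using HasRegValue.const 0
  | insert i s hi ih =>
    simp only [Finset.sum_insert hi]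
    exact (h i (Finset.mem_insert_self _ _)).add
      (ih fun j hj => h j (Finset.mem_insert_of_mem hj))

theorem LogFun.hasRegValue {g g' : ℝ → ℂ} {P : Polynomial ℂ} (hg : LogFun g g' P) :
    HasRegValue g (P.coeff 0) := hasRegValue_iff.2 ⟨P, rfl, hg.asymp⟩

/-- The triples of a function, its derivative on `(0, 1)` and its regularized value at `0`. -/
def regDerivSubmodule : Submodule ℂ (ℝ ⊕ ℝ ⊕ Unit → ℂ) where
  carrier := {h | (∀ z ∈ Ioo (0 : ℝ) 1,
      HasDerivAt (fun t => h (Sum.inl t)) (h (Sum.inr (Sum.inl z))) z) ∧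
    HasRegValue (fun t => h (Sum.inl t)) (h (Sum.inr (Sum.inr ())))}
  zero_mem' := ⟨fun z _ => hasDerivAt_const z 0, HasRegValue.const 0⟩
  add_mem' := fun hg hh => ⟨fun z hz => (hg.1 z hz).add (hh.1 z hz), hg.2.add hh.2⟩
  smul_mem' := fun c _ hh => ⟨fun z hz => (hh.1 z hz).const_mul c, hh.2.const_mul c⟩

/-- A family consisting of a function, its derivative and its regularized value. -/
def regTriple {α : Type*} (f f' : ℝ → α) (c : α) : ℝ ⊕ ℝ ⊕ Unit → α :=
  Sum.elim f (Sum.elim f' fun _ => c)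

section PowerSeries

variable {σ : Type*}

/-- The function `f` with values in the field of fractions of a ring of power series has the
derivative `f'` on `(0, 1)` and the regularized value `c` at `0`, coefficientwise. -/
def HasRegDeriv (f f' : ℝ → FractionRing (MvPowerSeries σ ℂ))
    (c : FractionRing (MvPowerSeries σ ℂ)) : Prop :=
  regTriple f f' c ∈ fracSubmodule σ regDerivSubmodule

theorem HasRegDeriv.add {f f' g g' : ℝ → FractionRing (MvPowerSeries σ ℂ)}
    {c d : FractionRing (MvPowerSeries σ ℂ)} (hf : HasRegDeriv f f' c) (hg : HasRegDeriv g g' d) :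
    HasRegDeriv (fun t => f t + g t) (fun t => f' t + g' t) (c + d) := by
  have := Submodule.add_mem _ hf hg
  rw [HasRegDeriv]
  convert this using 1
  funext x
  rcases x with t | t | t <;> rfl

theorem HasRegDeriv.const_mul {f f' : ℝ → FractionRing (MvPowerSeries σ ℂ)}
    {c : FractionRing (MvPowerSeries σ ℂ)} (q : FractionRing (MvPowerSeries σ ℂ))
    (hf : HasRegDeriv f f' c) :
    HasRegDeriv (fun t => q * f t) (fun t => q * f' t) (q * c) := by
  have := Submodule.smul_mem _ q hf
  rw [HasRegDeriv]
  convert this using 1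
  funext x
  rcases x with t | t | t <;> rfl

theorem HasRegDeriv.const (q : FractionRing (MvPowerSeries σ ℂ)) :
    HasRegDeriv (fun _ => q) (fun _ => 0) q := by
  have h : HasRegDeriv (fun _ => (1 : FractionRing (MvPowerSeries σ ℂ))) (fun _ => 0) 1 := by
    refine ⟨1, one_ne_zero, regTriple (fun _ => 1) (fun _ => 0) 1, fun e => ?_, fun x => ?_⟩
    · exact ⟨fun z _ => by simpa [regTriple] using hasDerivAt_const z _, HasRegValue.const _⟩
    · rcases x with t | t | t <;> simp [regTriple]
  simpa using h.const_mul q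

theorem HasRegDeriv.sum {ι : Type*} {s : Finset ι}
    {f f' : ι → ℝ → FractionRing (MvPowerSeries σ ℂ)} {c : ι → FractionRing (MvPowerSeries σ ℂ)}
    (h : ∀ i ∈ s, HasRegDeriv (f i) (f' i) (c i)) :
    HasRegDeriv (fun t => ∑ i ∈ s, f i t) (fun t => ∑ i ∈ s, f' i t) (∑ i ∈ s, c i) := by
  classical
  induction s using Finset.induction_on with
  | empty => simpa using HasRegDeriv.const 0
  | insert i s hi ih =>
    simp only [Finset.sum_insert hi]
    exact (h i (Finset.mem_insert_self _ _)).add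
      (ih fun j hj => h j (Finset.mem_insert_of_mem hj))

/-- The initial value principle. After clearing the common denominator, every coefficient of the
numerator is constant on `(0, 1)`. The regularized value of a constant is that constant, so it is
zero. -/
theorem HasRegDeriv.eq_zero {f f' : ℝ → FractionRing (MvPowerSeries σ ℂ)}
    (h : HasRegDeriv f f' 0) (hf' : ∀ z ∈ Ioo (0 : ℝ) 1, f' z = 0) :
    ∀ z ∈ Ioo (0 : ℝ) 1, f z = 0 := by
  intro z hz
  obtain ⟨d, hd, Y, hY, hdY⟩ := h
  have hinj := IsFractionRing.injective (MvPowerSeries σ ℂ) (FractionRing (MvPowerSeries σ ℂ))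
  have hd' : algebraMap _ (FractionRing (MvPowerSeries σ ℂ)) d ≠ 0 :=
    (map_ne_zero_iff _ hinj).2 hd
  have h1 : ∀ t ∈ Ioo (0 : ℝ) 1, Y (Sum.inr (Sum.inl t)) = 0 := fun t ht => hinj (by
    rw [← hdY, map_zero]
    simp [regTriple, hf' t ht])
  have h2 : Y (Sum.inr (Sum.inr ())) = 0 := hinj (by
    rw [← hdY, map_zero]
    simp [regTriple])
  have h3 : Y (Sum.inl z) = 0 := by
    ext e
    obtain ⟨hder, hreg⟩ := hY e
    simp only [h2, map_zero] at hreg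
    have hconst : ∀ t ∈ Ioo (0 : ℝ) 1, MvPowerSeries.coeff e (Y (Sum.inl t))
        = MvPowerSeries.coeff e (Y (Sum.inl z)) := fun t ht =>
      isOpen_Ioo.is_const_of_deriv_eq_zero isPreconnected_Ioo
        (fun s hs => (hder s hs).differentiableAt.differentiableWithinAt)
        (fun s hs => by
          rw [(hder s hs).deriv]
          simp only [h1 s hs, map_zero, Pi.zero_apply]) ht hz
    have h4 : HasRegValue (fun t => MvPowerSeries.coeff e (Y (Sum.inl t)))
        (MvPowerSeries.coeff e (Y (Sum.inl z))) := by
      refine (HasRegValue.const _).congr' ?_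
      filter_upwards [Ioo_mem_nhdsGT (zero_lt_one' ℝ)] with t ht
      exact (hconst t ht).symm
    rw [h4.unique hreg, map_zero]
  have h5 := hdY (Sum.inl z)
  rw [h3, map_zero] at h5
  exact (mul_eq_zero.1 h5).resolve_left hd'

/-- The generating series of the functions `regIter`, with exponents `k_i - 1`. -/
def iterFrac (τ : UpperHalfPlane) (n : ℕ) (w : ℕ → MvPowerSeries σ ℂ) (z : ℝ) :
    FractionRing (MvPowerSeries σ ℂ) :=
  algebraMap _ _ (iterSeries τ n w z)
    / ∏ p : Fin n, algebraMap _ (FractionRing (MvPowerSeries σ ℂ)) (w p)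

/-- The generating series of the functions `regIterLast`, with exponents `k_i - 1`. -/
def iterLastFrac (τ : UpperHalfPlane) (n : ℕ) (w : ℕ → MvPowerSeries σ ℂ) (z : ℝ) :
    FractionRing (MvPowerSeries σ ℂ) :=
  algebraMap _ _ (iterLastSeries τ n w z)
    / ∏ p : Fin (n + 1), algebraMap _ (FractionRing (MvPowerSeries σ ℂ)) (w p)

/-- The Kronecker series `F_τ(x; t)` in a formal parameter `x`. -/
def kerFrac (τ : UpperHalfPlane) (t : ℂ) (x : MvPowerSeries σ ℂ) :
    FractionRing (MvPowerSeries σ ℂ) :=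
  algebraMap _ _ (kerSeries τ t x) / algebraMap _ _ x

theorem algebraMap_frac_ne_zero {x : MvPowerSeries σ ℂ} (hx : x ≠ 0) :
    algebraMap _ (FractionRing (MvPowerSeries σ ℂ)) x ≠ 0 :=
  (map_ne_zero_iff _ (IsFractionRing.injective _ _)).2 hx

theorem iterFrac_congr (τ : UpperHalfPlane) {n : ℕ} {w w' : ℕ → MvPowerSeries σ ℂ}
    (h : ∀ p < n, w p = w' p) (z : ℝ) : iterFrac τ n w z = iterFrac τ n w' z := by
  rw [iterFrac, iterFrac, iterSeries, iterSeries, genSeries_congr_seq h]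
  congr 1
  exact Finset.prod_congr rfl fun p _ => by rw [h p p.2]

theorem iterFrac_zero (τ : UpperHalfPlane) (w : ℕ → MvPowerSeries σ ℂ) (z : ℝ) :
    iterFrac τ 0 w z = 1 := by
  simp [iterFrac, iterSeries, genSeries_zero, regIter]

/-- The oddness of `F` under a simultaneous change of sign. It accounts for the argument `-u_r` in
the last term of the second sum. -/
theorem kerFrac_neg (τ : UpperHalfPlane) {z : ℝ} (hz : z ∈ Ioo (0 : ℝ) 1)
    {x : MvPowerSeries σ ℂ} (hx : MvPowerSeries.constantCoeff x = 0) :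
    kerFrac τ z (-x) = -kerFrac τ (-z) x := by
  have : kerSeries τ (z : ℂ) (-x) = kerSeries τ (-(z : ℂ)) x := by
    rw [kerSeries, kerSeries, genSeriesOne_neg hx]
    congr 1
    funext k
    rw [kernelCoeff_neg_ofReal τ k hz]
  rw [kerFrac, kerFrac, this, map_neg]
  ring

theorem hasRegDeriv_iterFrac_succ (τ : UpperHalfPlane) (n : ℕ) {w : ℕ → MvPowerSeries σ ℂ}
    (hw : ∀ j, MvPowerSeries.constantCoeff (w j) = 0) (hw0 : ∀ p < n + 1, w p ≠ 0) :
    HasRegDeriv (iterFrac τ (n + 1) w) (fun z => kerFrac τ z (w n) * iterFrac τ n w z) 0 := by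
  set c : ℝ ⊕ ℝ ⊕ Unit → (Fin (n + 1) → ℕ) → ℂ := regTriple
    (fun t k => regIter τ (n + 1) k t)
    (fun t k => regIter τ n (fun i => k i.castSucc) t * kernelCoeff τ (k (Fin.last n)) t)
    (fun _ => 0) with hc
  refine ⟨∏ p : Fin (n + 1), w p, Finset.prod_ne_zero_iff.2 fun p _ => hw0 p p.2,
    fun x => genSeries (fun p : Fin (n + 1) => w p) (c x),
    genSeries_mem_coeffSubmodule (fun _ => hw _) fun k => ⟨fun z hz => ?_, ?_⟩, fun x => ?_⟩
  · exact (logFun_regIter_succ τ n k).hasDerivAt z hz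
  · have := (logFun_regIter_succ τ n k).hasRegValue
    rw [regIterPoly_coeff_zero] at this
    exact this
  · have hp : ∏ p : Fin (n + 1), algebraMap _ (FractionRing (MvPowerSeries σ ℂ)) (w p) ≠ 0 :=
      Finset.prod_ne_zero_iff.2 fun p _ => algebraMap_frac_ne_zero (hw0 p p.2)
    have hn := algebraMap_frac_ne_zero (hw0 n (Nat.lt_succ_self n))
    rw [map_prod]
    rcases x with t | t | t
    · exact mul_div_cancel₀ _ hp
    · have e1 : genSeries (fun p : Fin (n + 1) => w p) (c (Sum.inr (Sum.inl t)))
          = iterSeries τ n w t * kerSeries τ t (w n) :=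
        genSeries_mul_seq hw (fun k => regIter τ n k t) fun j => kernelCoeff τ j t
      simp only [e1, map_mul, regTriple, Sum.elim_inr, Sum.elim_inl, kerFrac, iterFrac]
      rw [Fin.prod_univ_castSucc] at hp ⊢
      simp only [Fin.val_castSucc, Fin.val_last] at hp ⊢
      have hp' := left_ne_zero_of_mul hp
      field_simp
    · have e1 : genSeries (fun p : Fin (n + 1) => w p) (c (Sum.inr (Sum.inr t))) = 0 :=
        genSeries_zero_fun fun _ => hw _
      simp only [e1, map_zero]
      simp [regTriple]

/-- Three factors meet when all `k i = 1`: the leading coefficient `1 / (n + 1)!` of the inner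
integral, the residue `-1` of the reflected kernel, and `(-1)^(n+1) (n + 1)! ζ(n + 2)` from the
logarithmic integral. In all other cases the leading coefficient or the residue is `0`. -/
theorem hasRegValue_regIterLast (τ : UpperHalfPlane) (n : ℕ) (k : Fin (n + 2) → ℕ) :
    HasRegValue (regIterLast τ (n + 1) k)
      (if ∀ i, k i = 1 then (-1) ^ (n + 2) * riemannZeta (n + 2 : ℕ) else 0) := by
  have hg := logFun_regIter_succ τ n fun i => k i.castSucc
  have hP : regIterPoly (n + 1) (fun i => k i.castSucc) = Polynomial.C
      (if ∀ i : Fin (n + 1), k i.castSucc = 1 then (1 / (n + 1).factorial : ℂ) else 0)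
        * Polynomial.X ^ (n + 1) := by
    rw [regIterPoly]
    split_ifs <;> simp
  rw [hP] at hg
  have h := hg.hasRegValue_convReg (isKernel_kernelCoeff_neg τ (k (Fin.last (n + 1))))
    (logFun_regPrimNeg τ (k (Fin.last (n + 1))))
  rw [if_neg n.succ_ne_zero] at h
  have hf : ((n + 1).factorial : ℂ) ≠ 0 := by exact_mod_cast (n + 1).factorial_ne_zero
  convert h using 1
  · rfl
  have h0 : (∀ i, k i = 1) ↔ (∀ i : Fin (n + 1), k i.castSucc = 1) ∧ k (Fin.last (n + 1)) = 1 :=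
    Fin.forall_fin_succ'
  simp only [h0]
  by_cases h1 : ∀ i : Fin (n + 1), k i.castSucc = 1 <;> by_cases h2 : k (Fin.last (n + 1)) = 1 <;>
    simp only [h1, h2, and_true, and_false, if_true, if_false, implies_true, mul_zero, zero_mul,
      neg_zero]
  field_simp
  ring

/-- Division of `hasDerivAt_iterLastSeries` by `w' n * ∏ w p` restores the usual form of the Fay
identity. The regularized value of the numerator is concentrated in the monomial `∏ w p`, so the
quotient has a scalar regularized value. -/
theorem hasRegDeriv_iterLastFrac (τ : UpperHalfPlane) (n : ℕ) {w w' : ℕ → MvPowerSeries σ ℂ}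
    (hw : ∀ j, MvPowerSeries.constantCoeff (w j) = 0)
    (hw' : ∀ j, MvPowerSeries.constantCoeff (w' j) = 0)
    (h : ∀ p < n, w' p = w p) (hn : w' n = w n + w (n + 1)) (hw0 : ∀ p < n + 2, w p ≠ 0)
    (hn0 : w' n ≠ 0) :
    HasRegDeriv (iterLastFrac τ (n + 1) w)
      (fun z => kerFrac τ z (w n) * iterLastFrac τ n w' z
        + kerFrac τ (-z) (w (n + 1)) * iterFrac τ (n + 1) w' z)
      (algebraMap ℂ _ ((-1) ^ (n + 2) * riemannZeta (n + 2 : ℕ))) := by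
  refine ⟨w' n * ∏ p : Fin (n + 2), w p,
    mul_ne_zero hn0 (Finset.prod_ne_zero_iff.2 fun p _ => hw0 p p.2),
    regTriple (fun t => w' n * iterLastSeries τ (n + 1) w t)
      (fun t => w (n + 1) * kerSeries τ t (w n) * iterLastSeries τ n w' t
        + w n * kerSeries τ (-t) (w (n + 1)) * iterSeries τ (n + 1) w' t)
      (w' n * (((-1) ^ (n + 2) * riemannZeta (n + 2 : ℕ) : ℂ) • ∏ p : Fin (n + 2), w p)),
    fun e => ⟨fun z hz => ?_, ?_⟩, fun x => ?_⟩
  · exact hasDerivAt_iterLastSeries τ n hw hw' h hn hz e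
  · simp only [regTriple, Sum.elim_inl, Sum.elim_inr]
    rw [← genSeries_indicator_one (v := fun p : Fin (n + 2) => w p) (fun _ => hw _)]
    simp only [iterLastSeries, coeff_mul_genSeries (v := fun p : Fin (n + 2) => w p)
      (fun _ => hw _)]
    refine HasRegValue.sum fun k _ => ?_
    simp only [mul_comm _ (MvPowerSeries.coeff e _)]
    exact (hasRegValue_regIterLast τ n k).const_mul _
  · have hp : ∏ p : Fin (n + 2), algebraMap _ (FractionRing (MvPowerSeries σ ℂ)) (w p) ≠ 0 :=
      Finset.prod_ne_zero_iff.2 fun p _ => algebraMap_frac_ne_zero (hw0 p p.2)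
    have h0 := algebraMap_frac_ne_zero hn0
    rw [map_mul, map_prod]
    rcases x with t | t | t
    · simp only [regTriple, Sum.elim_inl, iterLastFrac, map_mul]
      field_simp
    · simp only [regTriple, Sum.elim_inl, Sum.elim_inr, iterLastFrac, iterFrac, kerFrac, map_add,
        map_mul]
      have e1 : ∏ p : Fin (n + 1), algebraMap _ (FractionRing (MvPowerSeries σ ℂ)) (w' p)
          = (∏ p : Fin n, algebraMap _ (FractionRing (MvPowerSeries σ ℂ)) (w p))
            * algebraMap _ _ (w' n) := by
        rw [Fin.prod_univ_castSucc]
        congr 1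
        exact Finset.prod_congr rfl fun p _ => congrArg _ (h p p.2)
      have e2 : ∏ p : Fin (n + 2), algebraMap _ (FractionRing (MvPowerSeries σ ℂ)) (w p)
          = (∏ p : Fin n, algebraMap _ (FractionRing (MvPowerSeries σ ℂ)) (w p))
            * algebraMap _ _ (w n) * algebraMap _ _ (w (n + 1)) := by
        rw [Fin.prod_univ_castSucc, Fin.prod_univ_castSucc]
        rfl
      rw [e2] at hp
      rw [e1, e2]
      have p1 := right_ne_zero_of_mul hp
      have p2 := right_ne_zero_of_mul (left_ne_zero_of_mul hp)
      have p3 := left_ne_zero_of_mul (left_ne_zero_of_mul hp)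
      field_simp
    · simp only [regTriple, Sum.elim_inr]
      rw [Algebra.smul_def, map_mul _ (w' n), map_mul _ (algebraMap ℂ (MvPowerSeries σ ℂ) _),
        map_prod, ← IsScalarTower.algebraMap_apply]
      ring

end PowerSeries

end EllipticPolylog

end

noncomputable section
namespace EllipticPolylog
open Filter Topology MeasureTheory Set

/-! ### The identity of generating series -/

section PowerSeries

variable {σ : Type*}

/-- The arguments `(v_1,…,v_{i-1}, v_i+⋯+v_n, -v_{i+1}-⋯-v_n, v_{i+1},…,v_{n-1})`. -/
def splitArgs (v : ℕ → MvPowerSeries σ ℂ) (n i p : ℕ) : MvPowerSeries σ ℂ :=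
  if p + 1 < i then v (p + 1)
  else if p + 1 = i then ∑ j ∈ Finset.Icc i n, v j
  else if p + 1 = i + 1 then -∑ j ∈ Finset.Icc (i + 1) n, v j
  else v p

theorem constantCoeff_splitArgs {v : ℕ → MvPowerSeries σ ℂ}
    (hv : ∀ j, MvPowerSeries.constantCoeff (v j) = 0) (n i p : ℕ) :
    MvPowerSeries.constantCoeff (splitArgs v n i p) = 0 := by
  rw [splitArgs]
  split_ifs <;> simp [hv]

theorem splitArgs_ne_zero {v : ℕ → MvPowerSeries σ ℂ} {n i p : ℕ} (hi : i < n) (hp : p < n)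
    (hv : ∀ j ∈ Finset.Icc 1 n, v j ≠ 0)
    (hs : ∀ j ∈ Finset.Icc 1 n, ∑ l ∈ Finset.Icc j n, v l ≠ 0) : splitArgs v n i p ≠ 0 := by
  rw [splitArgs]
  split_ifs with h1 h2 h3
  · exact hv _ (Finset.mem_Icc.2 (by omega))
  · exact hs _ (Finset.mem_Icc.2 (by omega))
  · exact neg_ne_zero.2 (hs _ (Finset.mem_Icc.2 (by omega)))
  · exact hv _ (Finset.mem_Icc.2 (by omega))

theorem sum_Icc_update {v : ℕ → MvPowerSeries σ ℂ} {n i : ℕ} (hi : i ≤ n) :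
    ∑ j ∈ Finset.Icc i n, Function.update v n (v n + v (n + 1)) j
      = ∑ j ∈ Finset.Icc i (n + 1), v j := by
  rw [Finset.sum_Icc_succ_top (by omega), ← Finset.Ico_insert_right hi,
    Finset.sum_insert (by simp), Finset.sum_insert (by simp), Function.update_self]
  have : ∑ j ∈ Finset.Ico i n, Function.update v n (v n + v (n + 1)) j
      = ∑ j ∈ Finset.Ico i n, v j := Finset.sum_congr rfl fun j hj => by
    rw [Function.update_of_ne (Finset.mem_Ico.1 hj).2.ne]
  rw [this]
  ring

/-- Merging the last two arguments does not change any tail sum beginning at or before position `n`.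
The right-hand side for the merged family is therefore what differentiation leaves of the right-hand
side for the original one. -/
theorem splitArgs_update {v : ℕ → MvPowerSeries σ ℂ} {n i p : ℕ} (hi : i < n) (hp : p < n) :
    splitArgs (Function.update v n (v n + v (n + 1))) n i p = splitArgs v (n + 1) i p := by
  rw [splitArgs, splitArgs]
  split_ifs with h1 h2 h3
  · rw [Function.update_of_ne (by omega)]
  · exact sum_Icc_update hi.le
  · rw [sum_Icc_update hi]
  · rw [Function.update_of_ne hp.ne]

/-- The case `r = 1`: reflecting `t ↦ z - t` turns `f^{(k)}(t - z)` into `(-1)^k f^{(k)}(t)`, that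
is, `x` into `-x` in the numerator. The overall sign comes from the denominator. -/
theorem iterLastFrac_zero (τ : UpperHalfPlane) {w w' : ℕ → MvPowerSeries σ ℂ}
    (hw : MvPowerSeries.constantCoeff (w 0) = 0) (h : w' 0 = -w 0) (z : ℝ) :
    iterLastFrac τ 0 w z = -iterFrac τ 1 w' z := by
  have e1 : iterLastSeries τ 0 w z
      = genSeriesOne (w 0) fun j => (-1) ^ j * regIter τ 1 (fun _ => j) z := by
    rw [iterLastSeries, genSeriesOne]
    congr 1
    · funext p
      rw [Fin.fin_one_eq_zero p]
      rfl
    · funext k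
      simp [regIterLast, convReg, regIter, regPrimNeg]
  have e2 : iterSeries τ 1 w' z = iterLastSeries τ 0 w z := by
    rw [e1, ← genSeriesOne_neg hw, ← h, iterSeries, genSeriesOne]
    congr 1
    · funext p
      rw [Fin.fin_one_eq_zero p]
      rfl
    · funext k
      congr 1
      funext p
      rw [Fin.fin_one_eq_zero p]
  rw [iterLastFrac, iterFrac, e2]
  have p1 : ∏ p : Fin (0 + 1), algebraMap _ (FractionRing (MvPowerSeries σ ℂ)) (w p)
      = algebraMap _ _ (w 0) := Fin.prod_univ_one _
  have p2 : ∏ p : Fin 1, algebraMap _ (FractionRing (MvPowerSeries σ ℂ)) (w' p)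
      = -algebraMap _ _ (w 0) := by
    rw [Fin.prod_univ_one, ← map_neg, ← h]
    rfl
  rw [p1, p2]
  ring

/-- Arbitrary arguments `v` are allowed because the inductive step replaces the last two by their
sum. Nonvanishing of the tail sums is preserved by this merging and keeps all denominators nonzero.
-/
theorem iterLastFrac_eq (τ : UpperHalfPlane) (N : ℕ) (v : ℕ → MvPowerSeries σ ℂ)
    (hv : ∀ j, MvPowerSeries.constantCoeff (v j) = 0)
    (hv0 : ∀ j ∈ Finset.Icc 1 (N + 1), v j ≠ 0)
    (hs : ∀ j ∈ Finset.Icc 1 (N + 1), ∑ l ∈ Finset.Icc j (N + 1), v l ≠ 0)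
    {z : ℝ} (hz : z ∈ Ioo (0 : ℝ) 1) :
    iterLastFrac τ N (fun p => v (p + 1)) z
      = ∑ i ∈ Finset.Icc 2 (N + 1), algebraMap ℂ _ ((-1) ^ i * riemannZeta (i : ℂ))
          * iterFrac τ (N + 1 - i) (fun p => v (i + p)) z
        - ∑ i ∈ Finset.range (N + 1), iterFrac τ (N + 1) (splitArgs v (N + 1) i) z := by
  induction N generalizing v z with
  | zero =>
    rw [iterLastFrac_zero τ (w := fun p => v (p + 1)) (w' := splitArgs v 1 0) (hv _)
      (by simp [splitArgs])]
    simp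
  | succ N ih =>
    set v' := Function.update v (N + 1) (v (N + 1) + v (N + 2)) with hv'
    have hlt : ∀ j < N + 1, v' j = v j := fun j hj => Function.update_of_ne hj.ne _ _
    have hv'c : ∀ j, MvPowerSeries.constantCoeff (v' j) = 0 := by
      intro j
      rcases eq_or_ne j (N + 1) with rfl | hj
      · rw [hv', Function.update_self, map_add, hv, hv, add_zero]
      · rw [hv', Function.update_of_ne hj, hv]
    have hv'N : v' (N + 1) = v (N + 1) + v (N + 2) := Function.update_self _ _ _
    have hs' : ∀ j ∈ Finset.Icc 1 (N + 1), ∑ l ∈ Finset.Icc j (N + 1), v' l ≠ 0 := by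
      intro j hj
      rw [Finset.mem_Icc] at hj
      rw [hv', sum_Icc_update hj.2]
      exact hs j (Finset.mem_Icc.2 (by omega))
    have hv'N0 : v' (N + 1) ≠ 0 := by simpa using hs' (N + 1) (Finset.mem_Icc.2 (by omega))
    have hv'0 : ∀ j ∈ Finset.Icc 1 (N + 1), v' j ≠ 0 := by
      intro j hj
      rw [Finset.mem_Icc] at hj
      rcases eq_or_ne j (N + 1) with rfl | hj'
      · exact hv'N0
      · rw [hlt j (by omega)]
        exact hv0 j (Finset.mem_Icc.2 (by omega))
    have dL := hasRegDeriv_iterLastFrac τ N (w := fun p => v (p + 1)) (w' := fun p => v' (p + 1))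
      (fun _ => hv _) (fun _ => hv'c _) (fun p hp => hlt _ (by omega)) hv'N
      (fun p hp => hv0 _ (Finset.mem_Icc.2 (by omega))) hv'N0
    -- The sum stops at `N + 1`: the term `i = N + 2` has an empty argument list, is constant in
    -- `z`, and is supplied by `dC`.
    have dZ : HasRegDeriv
        (fun z => ∑ i ∈ Finset.Icc 2 (N + 1), algebraMap ℂ (FractionRing (MvPowerSeries σ ℂ))
          ((-1) ^ i * riemannZeta (i : ℂ)) * iterFrac τ (N + 2 - i) (fun p => v (i + p)) z)
        (fun z => ∑ i ∈ Finset.Icc 2 (N + 1), algebraMap ℂ (FractionRing (MvPowerSeries σ ℂ))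
          ((-1) ^ i * riemannZeta (i : ℂ)) * (kerFrac τ z (v (N + 1))
            * iterFrac τ (N + 1 - i) (fun p => v' (i + p)) z))
        (∑ i ∈ Finset.Icc 2 (N + 1), algebraMap ℂ (FractionRing (MvPowerSeries σ ℂ))
          ((-1) ^ i * riemannZeta (i : ℂ)) * 0) := by
      refine HasRegDeriv.sum fun i hi => HasRegDeriv.const_mul _ ?_
      rw [Finset.mem_Icc] at hi
      have := hasRegDeriv_iterFrac_succ τ (N + 1 - i) (w := fun p => v (i + p)) (fun _ => hv _)
        fun p hp => hv0 _ (Finset.mem_Icc.2 (by omega))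
      rw [show N + 1 - i + 1 = N + 2 - i by omega] at this
      simp only [show i + (N + 1 - i) = N + 1 by omega] at this
      convert this using 3 with z
      exact iterFrac_congr τ (fun p hp => hlt _ (by omega)) z
    have dU : HasRegDeriv
        (fun z => ∑ i ∈ Finset.range (N + 1), iterFrac τ (N + 2) (splitArgs v (N + 2) i) z)
        (fun z => ∑ i ∈ Finset.range (N + 1),
          kerFrac τ z (v (N + 1)) * iterFrac τ (N + 1) (splitArgs v' (N + 1) i) z)
        (∑ i ∈ Finset.range (N + 1), 0) := by
      refine HasRegDeriv.sum fun i hi => ?_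
      rw [Finset.mem_range] at hi
      have := hasRegDeriv_iterFrac_succ τ (N + 1) (w := splitArgs v (N + 2) i)
        (fun _ => constantCoeff_splitArgs hv _ _ _)
        fun p hp => splitArgs_ne_zero (by omega) hp hv0 hs
      rw [show splitArgs v (N + 2) i (N + 1) = v (N + 1) by
        rw [splitArgs, if_neg (by omega), if_neg (by omega), if_neg (by omega)]] at this
      convert this using 3 with z
      exact iterFrac_congr τ (fun p hp => splitArgs_update hi hp) z
    have dE : HasRegDeriv (iterFrac τ (N + 2) (splitArgs v (N + 2) (N + 1)))
        (fun z => kerFrac τ z (-v (N + 2)) * iterFrac τ (N + 1) (fun p => v' (p + 1)) z) 0 := by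
      have := hasRegDeriv_iterFrac_succ τ (N + 1) (w := splitArgs v (N + 2) (N + 1))
        (fun _ => constantCoeff_splitArgs hv _ _ _)
        fun p hp => splitArgs_ne_zero (by omega) hp hv0 hs
      rw [show splitArgs v (N + 2) (N + 1) (N + 1) = -v (N + 2) by simp [splitArgs]] at this
      convert this using 3 with z
      refine iterFrac_congr τ (fun p hp => ?_) z
      rw [splitArgs]
      split_ifs with h1 h2 h3
      · exact hlt _ h1
      · rw [h2, hv'N, Finset.sum_Icc_succ_top (by omega), Finset.Icc_self, Finset.sum_singleton]
      · omega
      · omega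
    have dC := HasRegDeriv.const (algebraMap ℂ (FractionRing (MvPowerSeries σ ℂ))
      ((-1) ^ (N + 2) * riemannZeta (N + 2 : ℕ)))
    -- Left side minus right side. Its regularized value is `0` because the zeta value in `dL` is
    -- cancelled by `dC` and the other parts have regularized value `0`.
    have key := (((dL.add (dZ.const_mul (-1))).add (dC.const_mul (-1))).add dU).add dE
    simp only [mul_zero, Finset.sum_const_zero, add_zero] at key
    rw [neg_one_mul, add_neg_cancel] at key
    have h0 := key.eq_zero (fun t ht => ?_) z hz
    · rw [Finset.sum_Icc_succ_top (by omega), Finset.sum_range_succ, Nat.sub_self, iterFrac_zero]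
      linear_combination h0
    -- The derivative vanishes: the terms with `F(v_{N+1}; t)` cancel by the induction hypothesis
    -- for `v'`, and those with `F(v_{N+2}; -t)` cancel against `dE` by `kerFrac_neg`.
    · rw [ih v' hv'c hv'0 hs' ht, kerFrac_neg τ ht (hv _), mul_sub, Finset.mul_sum, Finset.mul_sum]
      have : ∀ i : ℕ, algebraMap ℂ (FractionRing (MvPowerSeries σ ℂ))
          ((-1) ^ i * riemannZeta (i : ℂ)) * (kerFrac τ t (v (N + 1))
            * iterFrac τ (N + 1 - i) (fun p => v' (i + p)) t)
          = kerFrac τ t (v (N + 1)) * (algebraMap ℂ _ ((-1) ^ i * riemannZeta (i : ℂ))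
            * iterFrac τ (N + 1 - i) (fun p => v' (i + p)) t) := fun i => by ring
      simp only [this]
      ring

end PowerSeries

/-! ### Specialization to the variables `u_1, …, u_r` -/

theorem constantCoeff_u (r j : ℕ) : MvPowerSeries.constantCoeff (u r j) = 0 := by
  rw [u]
  split_ifs <;> simp

theorem coeff_u {r : ℕ} {j l : ℕ} (hj : 1 ≤ j ∧ j ≤ r) (hl : 1 ≤ l ∧ l ≤ r) :
    MvPowerSeries.coeff (Finsupp.single ⟨j - 1, by omega⟩ 1) (u r l) = if l = j then 1 else 0 := by
  classical
  rw [u, dif_pos hl, MvPowerSeries.coeff_X]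
  congr 1
  rw [Finsupp.single_left_inj one_ne_zero, Fin.mk.injEq, eq_iff_iff]
  omega

theorem sum_u_ne_zero {r j : ℕ} (hj : 1 ≤ j ∧ j ≤ r) : ∑ l ∈ Finset.Icc j r, u r l ≠ 0 := by
  intro h
  have h1 := congrArg (MvPowerSeries.coeff (Finsupp.single (⟨j - 1, by omega⟩ : Fin r) 1)) h
  rw [map_sum, map_zero, Finset.sum_congr rfl fun l hl => coeff_u hj
    (show 1 ≤ l ∧ l ≤ r by rw [Finset.mem_Icc] at hl; omega)] at h1
  rw [Finset.sum_ite_eq', if_pos (Finset.mem_Icc.2 ⟨le_rfl, hj.2⟩)] at h1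
  exact one_ne_zero h1

theorem u_ne_zero {r j : ℕ} (hj : 1 ≤ j ∧ j ≤ r) : u r j ≠ 0 := by
  intro h
  have h1 := coeff_u hj hj
  rw [h, map_zero, if_pos rfl] at h1
  exact zero_ne_one h1

theorem A_zero (τ : UpperHalfPlane) {r n : ℕ} (w : ℕ → MvPowerSeries (Fin r) ℂ) {z : ℝ}
    (hz : z ∈ Ioo (0 : ℝ) 1) :
    A τ (fun p : Fin n => w p) (fun _ => 0) z = iterFrac τ n w z := by
  have : gammaSeries τ (fun _ : Fin n => (0 : ℝ)) z = coeffSeries fun k => regIter τ n k z := by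
    funext k
    exact Gam_zero τ _ hz
  rw [A, this]
  rfl

theorem A_lowerLast (τ : UpperHalfPlane) {r n : ℕ} (w : ℕ → MvPowerSeries (Fin r) ℂ) {z : ℝ}
    (hz : z ∈ Ioo (0 : ℝ) 1) :
    A τ (fun p : Fin (n + 1) => w p) (lowerLast (n + 1) z) z = iterLastFrac τ n w z := by
  have : gammaSeries τ (lowerLast (n + 1) z) z
      = coeffSeries fun k => regIterLast τ n k z := by
    funext k
    exact Gam_lowerLast τ _ hz
  rw [A, this]
  rfl

end EllipticPolylog

end

theorem mainTheorem3 (τ : UpperHalfPlane) (z : ℝ) (hz0 : 0 < z) (hz1 : z < 1)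
    (r : ℕ) (hr : 1 ≤ r) :
    -- all regularized values that enter the identity exist
    (∀ k : Fin r → ℕ, ∃ c : ℂ, EllipticPolylog.HasRegValue
      (EllipticPolylog.truncatedIntegral τ k (EllipticPolylog.lowerLast r z) z) c) ∧
    (∀ m : ℕ, m ≤ r → ∀ k : Fin m → ℕ, ∃ c : ℂ, EllipticPolylog.HasRegValue
      (EllipticPolylog.truncatedIntegral τ k (fun _ : Fin m => (0 : ℝ)) z) c) ∧
    -- the identity in the fraction field of the ring of power series in `u_1,…,u_r`
    EllipticPolylog.A τ (fun p : Fin r => EllipticPolylog.u r (p + 1))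
        (EllipticPolylog.lowerLast r z) z
      = ∑ i ∈ Finset.Icc 2 r,
          algebraMap ℂ (FractionRing (MvPowerSeries (Fin r) ℂ)) ((-1) ^ i * riemannZeta (i : ℂ))
            * EllipticPolylog.A τ (fun p : Fin (r - i) => EllipticPolylog.u r (i + p))
                (fun _ : Fin (r - i) => (0 : ℝ)) z
        - ∑ i ∈ Finset.range r,
            EllipticPolylog.A τ (EllipticPolylog.upperArgs r i) (fun _ : Fin r => (0 : ℝ)) z := by
  have hz : z ∈ Set.Ioo (0 : ℝ) 1 := ⟨hz0, hz1⟩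
  obtain ⟨N, rfl⟩ : ∃ N, r = N + 1 := ⟨r - 1, by omega⟩
  refine ⟨fun k => ⟨_, EllipticPolylog.hasRegValue_truncatedIntegral_lowerLast τ k hz⟩,
    fun m _ k => ⟨_, EllipticPolylog.hasRegValue_truncatedIntegral_zero τ k hz⟩, ?_⟩
  have hmem : ∀ j ∈ Finset.Icc 1 (N + 1), 1 ≤ j ∧ j ≤ N + 1 := fun j hj => Finset.mem_Icc.1 hj
  have key := EllipticPolylog.iterLastFrac_eq τ N (EllipticPolylog.u (N + 1))
    (EllipticPolylog.constantCoeff_u _) (fun j hj => EllipticPolylog.u_ne_zero (hmem j hj))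
    (fun j hj => EllipticPolylog.sum_u_ne_zero (hmem j hj)) hz
  rw [← EllipticPolylog.A_lowerLast τ _ hz] at key
  simp only [← EllipticPolylog.A_zero τ _ hz] at key
  exact key
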